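/- For $n\ge 1$ let $\Vert n\Vert$ be the least number of $1$'s in an expression for $n$ that uses only $1$, $+$, $\times$ and parentheses. Let $E(0)=1$ and let $E(k)$ be the largest number of complexity $k\ge 1$ (so $E(1)=1$, $E(3i)=3^i$, $E(3i+1)=4\cdot 3^{i-1}$, $E(3i-1)=2\cdot 3^{i-1}$ for $i\ge1$). Put $\alpha=1.230175$ and $\beta=\frac{\log 3}{\log 2}-1$. **The algorithm.** Fuller's space-improved algorithm has parameters $N,H,\ell$; put $L=2\ell$. For given $n$ and $s$, $\mathrm{kMax}(n,s)=E(t)$, where $t$ is found by starting at $t=\lfloor s/2\rfloor$ and decreasing $t$ by $1$ while $E(t)+E(s-t)<n$; each value of $E$ is computed by repeated multiplication by $3$. "Improve $n$ by $v$" means: replace the stored value for $n$ by $v$ if $v$ is smaller. 1. *Fixed block.* An array $B_0$ for $1\le n\le H$ is filled with $\lfloor 3\log_2 H\rfloor+1$, except for the entry $1$ at $n=1$. For $n=2,\dots,H$ in this order: improve $n$ by $B_0[n-1]+1$; improve $n$ by $B_0[m]+B_0[n-m]$ for $6\le m\le \mathrm{kMax}(n,B_0[n-1])$; improve $kn$ by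 $B_0[k]+B_0[n]$ for $2\le k\le\min(n,\lfloor H/n\rfloor)$. Output $B_0[1],\dots,B_0[H]$. 2. *Running blocks.* A running block $B_j$ ($j\ge1$) is an array of length $L$ with a head $H_j$; it holds values for $H_j-L<n\le H_j$. It is created with $H_j=H$ as a copy of the last $L$ entries of $B_0$. First create $B_1$. While $H_1<N$, put $h=\min(H_1+\ell,N)$, and for $j=\lceil h/H\rceil-1,\dots,2,1$ in this order: put $h_j=\ell\lceil h/(j\ell)\rceil$; create $B_j$ if it does not exist and $h_j>H$; if $H_j<h_j$, then increase $H_j$ by $\ell$, move the upper half of $B_j$ to its lower half, fill the upper half with $\lfloor 3\log_2N\rfloor+1$, and - for all $2\le a\le b$ with $h_j-\ell<ab\le h_j$, improve $ab$ in $B_j$ by $\Vert a\Vert+\Vert b\Vert$, where $\Vert a\Vert$ is read from $B_0$, and $\Vert b\Vert$ is read from $B_0$ if $\lfloor h_j/a\rfloor\le H$ and from $B_{aj}$ otherwise; - for $n=h_j-\ell+1,\dots,h_j$ in this order, improve $n$ in $B_j$ by $B_j[n-1]+1$, and then, with $s$ the current value for $n$, by $B_0[m]+B_j[n-m]$ for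 $6\le m\le\mathrm{kMax}(n,s)$; - if $j=1$, output the new values for $h_1-\ell<n\le h_1$. Time is the number of elementary operations (arithmetic operations, comparisons, reading or writing a variable or an array cell, each of unit cost; creating an array costs its length). Storage is the peak number of bits occupied by all scalars (in binary) and all arrays (length times cell width, where the cell width is the binary length of the initial value); the output is not stored. Call $(N,H,\ell)$ admissible if $N\ge 1$, $H\le N$, and $$2N^\beta\le\ell,\qquad N\le \ell H,\qquad \ell\mid H,\qquad \ell\mid N,\qquad H\ge\sqrt{LN}.$$ **Statement.** (a) There is a constant $C$ such that for all admissible $(N,H,\ell)$ the algorithm halts without an error, outputs $\Vert 1\Vert,\Vert 2\Vert,\dots,\Vert N\Vert$, and takes time at most $C\,N^{\alpha}$. (b) For every constant $A$ there is a constant $C$ such that for all admissible $(N,H,\ell)$ with $L\le A N^\beta$ and $H\le A\sqrt{LN}$ (so that $L\asymp N^\beta$, $H\asymp\sqrt{LN}$) the algorithm outputs $\Vert 1\Vert,\dots,\Vert N\Vert$ in time at most $C\,N^\alpha$ and uses at most $C\,N^{(1+\beta)/2}\log\log N$ bits of storage. (c) There are constants $A,C,N_0$ such that for every $N\ge N_0$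 there are $N',H,\ell$ with $N\le N'<N+\ell$, $(N',H,\ell)$ admissible, $L\le A N'^{\beta}$ and $H\le A\sqrt{LN'}$, for which the algorithm outputs $\Vert 1\Vert,\dots,\Vert N'\Vert$ in time at most $C\,N^\alpha$ with at most $C\,N^{(1+\beta)/2}\log\log N$ bits of storage. Moreover $\left|\frac{1+\beta}{2}-0.792481\right|<10^{-6}$. -/

import Mathlib

namespace Fuller

/-! ### Integer complexity -/

/-- Expressions built from the number `1` with `+` and `×`. -/
inductive OnesExpr : Type
  | one : OnesExpr
  | add : OnesExpr → OnesExpr → OnesExpr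
  | mul : OnesExpr → OnesExpr → OnesExpr

/-- The positive integer denoted by an expression. -/
def OnesExpr.value : OnesExpr → ℕ
  | .one => 1
  | .add e f => e.value + f.value
  | .mul e f => e.value * f.value

/-- The number of `1`'s in an expression. -/
def OnesExpr.ones : OnesExpr → ℕ
  | .one => 1
  | .add e f => e.ones + f.ones
  | .mul e f => e.ones + f.ones

/-- `‖n‖`: the least number of `1`'s in an expression for `n` (used for `n ≥ 1` only). -/
noncomputable def complexity (n : ℕ) : ℕ :=
  sInf {k : ℕ | ∃ e : OnesExpr, e.value = n ∧ e.ones = k}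

/-! ### The machine model

A small imperative language over natural numbers, with scalar variables and growing lists of
arrays. Every operation has unit cost, and the storage in use is measured in bits. -/

/-- The scalar variables. `N`, `H`, `ell` hold the input. -/
inductive Var : Type
  | N | H | ell | L | cMax | x | e₁ | e₂ | t | target | kMax
  | n | m | k | j | h | newH | sh | a | b | ab | blk | shB | bmax | val
  deriving DecidableEq

instance : Fintype Var where
  elems := {.N, .H, .ell, .L, .cMax, .x, .e₁, .e₂, .t, .target, .kMax, .n, .m, .k, .j, .h, .newH,
    .sh, .a, .b, .ab, .blk, .shB, .bmax, .val}
  complete := by intro v; cases v <;> decide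

/-- The two lists of arrays: the blocks `B[0], B[1], …` and the heads `Heads[0], Heads[1], …`
(each entry of `Heads` is an array with one cell). -/
inductive Arr : Type
  | B | Heads
  deriving DecidableEq

instance : Fintype Arr where
  elems := {.B, .Heads}
  complete := by intro r; cases r <;> decide

/-- An array: all its cells have the same width in bits. -/
structure Cells : Type where
  width : ℕ
  cells : List ℕ

/-- The number of bits that an array occupies. -/
def Cells.bits (c : Cells) : ℕ := c.cells.length * c.width

/-- A machine state. `out` is the (write-only) output produced so far. -/
structure State : Type where
  vars : Var → ℕ
  arrs : Arr → List Cells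
  out : List ℕ

/-- The number of bits of storage in use: the binary lengths of the scalars, and all arrays. -/
def State.bits (s : State) : ℕ :=
  (∑ v : Var, Nat.size (s.vars v)) + ∑ r : Arr, ((s.arrs r).map Cells.bits).sum

/-- Assign the scalar `v`. -/
def State.set (s : State) (v : Var) (x : ℕ) : State :=
  { s with vars := Function.update s.vars v x }

/-- The cell `r[i][k]`, if it exists. -/
def State.read (s : State) (r : Arr) (i k : ℕ) : Option ℕ :=
  ((s.arrs r)[i]?).bind fun c => c.cells[k]?

/-- Store `x` in the cell `r[i][k]`; fails if there is no such cell or if `x` does not fit. -/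
def State.write (s : State) (r : Arr) (i k x : ℕ) : Option State :=
  ((s.arrs r)[i]?).bind fun c =>
    if k < c.cells.length ∧ Nat.size x ≤ c.width then
      some { s with arrs := Function.update s.arrs r
                      ((s.arrs r).set i { c with cells := c.cells.set k x }) }
    else none

/-- Append to `r` a new array with `len` cells, all with initial value `x` and just wide enough
to hold `x`. -/
def State.append (s : State) (r : Arr) (len x : ℕ) : State :=
  { s with arrs := Function.update s.arrs r
                    (s.arrs r ++ [⟨Nat.size x, List.replicate len x⟩]) }

/-- Output `x`. -/
def State.print (s : State) (x : ℕ) : State := { s with out := s.out ++ [x] }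

/-- Arithmetic expressions: constants, variables, arithmetic operations, `r[i][k]`, and the number
of arrays in the list `r`. -/
inductive Expr : Type
  | const : ℕ → Expr
  | var : Var → Expr
  | add : Expr → Expr → Expr
  | sub : Expr → Expr → Expr
  | mul : Expr → Expr → Expr
  | div : Expr → Expr → Expr
  | read : Arr → Expr → Expr → Expr
  | len : Arr → Expr

/-- The value of an expression; `none` is an index error. -/
def Expr.eval (s : State) : Expr → Option ℕ
  | .const c => some c
  | .var v => some (s.vars v)
  | .add e f => (e.eval s).bind fun p => (f.eval s).bind fun q => some (p + q)
  | .sub e f => (e.eval s).bind fun p => (f.eval s).bind fun q => some (p - q)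
  | .mul e f => (e.eval s).bind fun p => (f.eval s).bind fun q => some (p * q)
  | .div e f => (e.eval s).bind fun p => (f.eval s).bind fun q => some (p / q)
  | .read r e f => (e.eval s).bind fun p => (f.eval s).bind fun q => s.read r p q
  | .len r => some (s.arrs r).length

/-- The number of elementary operations needed to evaluate an expression. -/
def Expr.cost : Expr → ℕ
  | .const _ => 1
  | .var _ => 1
  | .add e f => e.cost + f.cost + 1
  | .sub e f => e.cost + f.cost + 1
  | .mul e f => e.cost + f.cost + 1
  | .div e f => e.cost + f.cost + 1
  | .read _ e f => e.cost + f.cost + 1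
  | .len _ => 1

/-- Tests. -/
inductive Test : Type
  | lt : Expr → Expr → Test
  | le : Expr → Expr → Test
  | and : Test → Test → Test

/-- The truth value of a test; `none` is an index error. -/
def Test.eval (s : State) : Test → Option Bool
  | .lt e f => (e.eval s).bind fun p => (f.eval s).bind fun q => some (decide (p < q))
  | .le e f => (e.eval s).bind fun p => (f.eval s).bind fun q => some (decide (p ≤ q))
  | .and c d => (c.eval s).bind fun p => (d.eval s).bind fun q => some (p && q)

/-- The number of elementary operations needed to evaluate a test. -/
def Test.cost : Test → ℕ
  | .lt e f => e.cost + f.cost + 1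
  | .le e f => e.cost + f.cost + 1
  | .and c d => c.cost + d.cost + 1

/-- Programs. -/
inductive Stmt : Type
  | skip : Stmt
  | assign : Var → Expr → Stmt
  | write : Arr → Expr → Expr → Expr → Stmt
  | append : Arr → Expr → Expr → Stmt
  | print : Expr → Stmt
  | seq : Stmt → Stmt → Stmt
  | ite : Test → Stmt → Stmt → Stmt
  | while : Test → Stmt → Stmt

/-- `Exec p s s' T S`: started in the state `s`, the program `p` halts without an error in the
state `s'`, after `T` elementary operations, with a peak of `S` bits of storage in use. Creating an array costs its length. -/
inductive Exec : Stmt → State → State → ℕ → ℕ → Prop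
  | skip (s : State) : Exec .skip s s 1 s.bits
  | assign {v : Var} {e : Expr} {s : State} {x : ℕ} (he : e.eval s = some x) :
      Exec (.assign v e) s (s.set v x) (e.cost + 1) (max s.bits (s.set v x).bits)
  | write {r : Arr} {ei ek e : Expr} {s s' : State} {i k x : ℕ} (hi : ei.eval s = some i)
      (hk : ek.eval s = some k) (he : e.eval s = some x) (hw : s.write r i k x = some s') :
      Exec (.write r ei ek e) s s' (ei.cost + ek.cost + e.cost + 1) (max s.bits s'.bits)
  | append {r : Arr} {el e : Expr} {s : State} {len x : ℕ} (hl : el.eval s = some len)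
      (he : e.eval s = some x) :
      Exec (.append r el e) s (s.append r len x) (el.cost + e.cost + len + 1)
        (max s.bits (s.append r len x).bits)
  | print {e : Expr} {s : State} {x : ℕ} (he : e.eval s = some x) :
      Exec (.print e) s (s.print x) (e.cost + 1) s.bits
  | seq {p q : Stmt} {s s' s'' : State} {T T' S S' : ℕ} (hp : Exec p s s' T S)
      (hq : Exec q s' s'' T' S') : Exec (.seq p q) s s'' (T + T') (max S S')
  | iteTrue {c : Test} {p q : Stmt} {s s' : State} {T S : ℕ} (hc : c.eval s = some true)
      (hp : Exec p s s' T S) : Exec (.ite c p q) s s' (c.cost + T) S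
  | iteFalse {c : Test} {p q : Stmt} {s s' : State} {T S : ℕ} (hc : c.eval s = some false)
      (hq : Exec q s s' T S) : Exec (.ite c p q) s s' (c.cost + T) S
  | whileFalse {c : Test} {p : Stmt} {s : State} (hc : c.eval s = some false) :
      Exec (.while c p) s s c.cost s.bits
  | whileTrue {c : Test} {p : Stmt} {s s' s'' : State} {T T' S S' : ℕ}
      (hc : c.eval s = some true) (hp : Exec p s s' T S) (hw : Exec (.while c p) s' s'' T' S') :
      Exec (.while c p) s s'' (c.cost + T + T') (max S S')

/-- Programs are deterministic: final state, running time and peak storage are determined by the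
program and the initial state. -/
theorem Exec.unique {p : Stmt} {s s₁ : State} {T₁ S₁ : ℕ} (h₁ : Exec p s s₁ T₁ S₁) :
    ∀ {s₂ : State} {T₂ S₂ : ℕ}, Exec p s s₂ T₂ S₂ → s₁ = s₂ ∧ T₁ = T₂ ∧ S₁ = S₂ := by
  induction h₁ with
  | skip s => intro _ _ _ h; cases h; simp
  | assign he =>
    intro _ _ _ h
    cases h with
    | assign he' => rw [he] at he'; cases he'; simp
  | write hi hk he hw =>
    intro _ _ _ h
    cases h with
    | write hi' hk' he' hw' =>
      rw [hi] at hi'; rw [hk] at hk'; rw [he] at he'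
      cases hi'; cases hk'; cases he'
      rw [hw] at hw'; cases hw'; simp
  | append hl he =>
    intro _ _ _ h
    cases h with
    | append hl' he' => rw [hl] at hl'; rw [he] at he'; cases hl'; cases he'; simp
  | print he =>
    intro _ _ _ h
    cases h with
    | print he' => rw [he] at he'; cases he'; simp
  | seq _ _ ihp ihq =>
    intro _ _ _ h
    cases h with
    | seq hp' hq' =>
      obtain ⟨rfl, rfl, rfl⟩ := ihp hp'
      obtain ⟨rfl, rfl, rfl⟩ := ihq hq'
      simp
  | iteTrue hc _ ih =>
    intro _ _ _ h
    cases h with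
    | iteTrue hc' hp' => obtain ⟨rfl, rfl, rfl⟩ := ih hp'; simp
    | iteFalse hc' _ => rw [hc] at hc'; cases hc'
  | iteFalse hc _ ih =>
    intro _ _ _ h
    cases h with
    | iteTrue hc' _ => rw [hc] at hc'; cases hc'
    | iteFalse hc' hp' => obtain ⟨rfl, rfl, rfl⟩ := ih hp'; simp
  | whileFalse hc =>
    intro _ _ _ h
    cases h with
    | whileFalse _ => simp
    | whileTrue hc' _ _ => rw [hc] at hc'; cases hc'
  | whileTrue hc _ _ ihp ihw =>
    intro _ _ _ h
    cases h with
    | whileFalse hc' => rw [hc] at hc'; cases hc'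
    | whileTrue _ hp' hw' =>
      obtain ⟨rfl, rfl, rfl⟩ := ihp hp'
      obtain ⟨rfl, rfl, rfl⟩ := ihw hw'
      simp

/-! ### Fuller's program -/

instance : Coe Var Expr := ⟨Expr.var⟩
instance (c : ℕ) : OfNat Expr c := ⟨Expr.const c⟩
instance : Add Expr := ⟨Expr.add⟩
instance : Sub Expr := ⟨Expr.sub⟩
instance : Mul Expr := ⟨Expr.mul⟩
instance : Div Expr := ⟨Expr.div⟩

/-- The entry `i` of the block `B[e]`. -/
def block (e i : Expr) : Expr := .read .B e i

/-- `Heads[e]`. -/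
def head (e : Expr) : Expr := .read .Heads e 0

/-- Sequential composition of a list of programs. -/
def prog : List Stmt → Stmt
  | [] => .skip
  | p :: ps => .seq p (prog ps)

/-- `for v = lo, lo + 1, …` while the test `c` holds. -/
def forUp (v : Var) (lo : Expr) (c : Test) (body : List Stmt) : Stmt :=
  prog [.assign v lo, .while c (prog (body ++ [.assign v (v + 1)]))]

/-- `if c then …` without an else branch. -/
def ifThen (c : Test) (body : List Stmt) : Stmt := .ite c (prog body) .skip

/-- `⌈e / f⌉`. -/
def ceiling (e f : Expr) : Expr := (e + f - 1) / f

/-- Replace the entry `i` of `B[e]` by the value of the variable `val` if the latter is smaller. -/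
def improve (e i : Expr) : Stmt := ifThen (.lt Var.val (block e i)) [.write .B e i Var.val]

/-- `res := E(arg)`, where `E(k)` is the largest number of complexity `k`, and `E(0) = 1`. -/
def codeE (arg : Expr) (res : Var) : Stmt :=
  prog [
    .assign .x arg,
    .ite (.le Var.x 0)
      (.assign res 1)
      (prog [
        .assign res 1,
        .while (.lt 4 Var.x) (prog [.assign res (res * 3), .assign .x (Var.x - 3)]),
        .assign res (res * Var.x)])]

/-- Computes `kMax` from `n` and `target`. -/
def codeKMax : Stmt :=
  prog [
    .assign .t (Var.target / 2),
    codeE Var.t .e₁,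
    codeE (Var.target - Var.t) .e₂,
    .while (.lt (Var.e₁ + Var.e₂) Var.n) (prog [
      .assign .t (Var.t - 1),
      codeE Var.t .e₁,
      codeE (Var.target - Var.t) .e₂]),
    .assign .kMax Var.e₁]

/-- `cMax := ⌊3 log arg / log 2⌋ + 1`, the number of binary digits of the cube of `arg`; it is an
upper bound for `‖n‖`, `1 ≤ n ≤ arg`. -/
def codeCMax (arg : Expr) : Stmt :=
  prog [
    .assign .x (arg * arg * arg),
    .assign .cMax 0,
    .while (.lt 0 Var.x) (prog [.assign .x (Var.x / 2), .assign .cMax (Var.cMax + 1)])]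

/-- The fixed block `B[0]`: computes `‖n‖` for `1 ≤ n ≤ H` by the time-improved algorithm. -/
def fixedBlock : Stmt :=
  prog [
    codeCMax Var.H,
    .append .B (Var.H + 1) Var.cMax,
    .write .B 0 1 1,
    forUp .n 2 (.le Var.n Var.H) [
      -- usual best value
      .assign .val (block 0 (Var.n - 1) + 1),
      improve 0 Var.n,
      -- computing kMax
      .assign .target (block 0 (Var.n - 1)),
      codeKMax,
      -- testing the sums
      forUp .m 6 (.le Var.m Var.kMax) [
        .assign .val (block 0 Var.m + block 0 (Var.n - Var.m)),
        improve 0 Var.n],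
      -- testing the products
      forUp .k 2 (.and (.le Var.k Var.n) (.le Var.k (Var.H / Var.n))) [
        .assign .val (block 0 Var.k + block 0 Var.n),
        improve 0 (Var.k * Var.n)]]]

/-- Appends a new running block with head `H`, a copy of the last `L` entries of `B[0]`. -/
def createRunningBlock : Stmt :=
  prog [
    .append .B Var.L Var.cMax,
    forUp .k 0 (.lt Var.k Var.L) [
      .write .B (.len .B - 1) Var.k (block 0 (Var.H - Var.L + 1 + Var.k))],
    .append .Heads 1 Var.N,
    .write .Heads (.len .Heads - 1) 0 Var.H]

/-- Moves the running block `B[j]` by `ell`; the new entries are set to an upper bound. -/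
def shift : Stmt :=
  prog [
    .write .Heads Var.j 0 (head Var.j + Var.ell),
    forUp .k 0 (.lt Var.k Var.ell) [
      .write .B Var.j Var.k (block Var.j (Var.k + Var.ell)),
      .write .B Var.j (Var.k + Var.ell) Var.cMax]]

/-- `b := max(1 + ⌊(newH - ell) / a⌋, a)`. -/
def firstB : Stmt :=
  prog [
    .assign .b (1 + (Var.newH - Var.ell) / Var.a),
    ifThen (.lt Var.b Var.a) [.assign .b Var.a]]

/-- Tests all products `a * b` with `2 ≤ a ≤ b` and `newH - ell < a * b ≤ newH`. -/
def products : Stmt :=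
  prog [
    .assign .a 2,
    firstB,
    .while (.and (.le (Var.a * Var.a) Var.newH) (.le Var.a Var.b)) (prog [
      .ite (.le (Var.newH / Var.a) Var.H)
        (prog [.assign .blk 0, .assign .shB 0])
        (prog [.assign .blk (Var.a * Var.j),
          .assign .shB (head (Var.a * Var.j) - Var.L + 1)]),
      .assign .bmax (Var.newH / Var.a),
      .assign .ab (Var.a * Var.b),
      .while (.le Var.b Var.bmax) (prog [
        .assign .val (block 0 Var.a + block Var.blk (Var.b - Var.shB)),
        improve Var.j (Var.ab - Var.sh),
        .assign .b (Var.b + 1),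
        .assign .ab (Var.ab + Var.a)]),
      .assign .a (Var.a + 1),
      firstB])]

/-- Tests the sums for `newH - ell < n ≤ newH` in ascending order. -/
def sums : Stmt :=
  forUp .n (Var.newH - Var.ell + 1) (.le Var.n Var.newH) [
    .assign .val (block Var.j (Var.n - 1 - Var.sh) + 1),
    improve Var.j (Var.n - Var.sh),
    .assign .target (block Var.j (Var.n - Var.sh)),
    codeKMax,
    forUp .m 6 (.le Var.m Var.kMax) [
      .assign .val (block 0 Var.m + block Var.j (Var.n - Var.m - Var.sh)),
      improve Var.j (Var.n - Var.sh)]]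

/-- The main loop. The values of the main running block `B[1]` are output as they are computed. -/
def mainLoop : Stmt :=
  .while (.lt (head 1) Var.N) (prog [
    .assign .h (head 1 + Var.ell),
    ifThen (.lt Var.N Var.h) [.assign .h Var.N],
    .assign .j (ceiling Var.h Var.H - 1),
    .while (.le 1 Var.j) (prog [
      .assign .newH (Var.ell * ceiling Var.h (Var.j * Var.ell)),
      ifThen (.and (.lt (.len .Heads) (Var.j + 1)) (.lt Var.H Var.newH)) [createRunningBlock],
      ifThen (.lt (head Var.j) Var.newH) [
        shift,
        .assign .sh (Var.newH - Var.L + 1),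
        products,
        sums,
        ifThen (.le Var.j 1) [
          forUp .n (Var.newH - Var.ell + 1) (.le Var.n Var.newH) [
            .print (block 1 (Var.n - Var.sh))]]],
      .assign .j (Var.j - 1)])])

/-- Fuller's space-improved program. -/
def program : Stmt :=
  prog [
    .assign .L (2 * Var.ell),
    fixedBlock,
    .append .Heads 1 Var.N,
    .write .Heads 0 0 Var.H,
    forUp .n 1 (.le Var.n Var.H) [.print (block 0 Var.n)],
    codeCMax Var.N,
    createRunningBlock,
    mainLoop]

/-- The initial state with input `N`, `H`, `ell`: no arrays, no output. -/
def start (N H ell : ℕ) : State where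
  vars := fun v => match v with
    | .N => N
    | .H => H
    | .ell => ell
    | _ => 0
  arrs := fun _ => []
  out := []

/-- Fuller's program with parameters `N`, `H`, `ell` halts without an error after `T` elementary
operations, with a peak of `S` bits of storage, and outputs `‖1‖, ‖2‖, …, ‖N‖`. -/
def Computes (N H ell T S : ℕ) : Prop :=
  ∃ s : State, Exec program (start N H ell) s T S ∧
    s.out = (List.range N).map fun i => complexity (i + 1)

/-- `β = log 3 / log 2 - 1`. -/
noncomputable def beta : ℝ := Real.log 3 / Real.log 2 - 1

/-- The conditions on the limit `N`, the length `H` of the fixed block, and the step `ell`, which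
is half of the length `L = 2 * ell` of the running blocks. -/
structure Admissible (N H ell : ℕ) : Prop where
  pos : 0 < N
  le_limit : H ≤ N
  step_large : 2 * (N : ℝ) ^ beta ≤ ell
  limit_le : N ≤ ell * H
  dvd_block : ell ∣ H
  dvd_limit : ell ∣ N
  block_large : √((2 * ell : ℝ) * N) ≤ H

end Fuller

namespace Fuller

/-! ### Integer complexity -/

/-! A shortest expression for n > 1 ends in a sum or a product, so ‖n‖ is the minimum of ‖a‖ + ‖b‖
over all splittings of n. Correctness means that every splitting that can matter is tested while the
values it needs are in memory. All products are tested outright. For sums, let s be the search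
bound. Since a number of complexity u is at most E(u), a sum a + b = n with ‖a‖ + ‖b‖ ≤ s forces
E(u) + E(s - u) ≥ n when u is the complexity of either summand, and this confines the smaller
summand to kMax = E(t) (`IsCut.summand_le`). Smaller summands from 2 to 5 are covered by (n - 1) + 1
(`IsCut.eq_complexity`).

Two bounds for kMax drive the rest. From E(k)^3 ≤ 3^k and n ≤ 2 E(s - t) follows kMax · n ≤ 2 ·
3^(s/3) (`IsCut.mul_pow_le`). In the worst case 2^s ≤ n^3, and 2^(1 + β) = 3 turns this into kMax ≤
2 n^β ≤ ell, so n - m never leaves the window of length 2 ell of a running block. On average kMax is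
much smaller: the sum of 3^(‖n‖/3) / n over n ≤ N is O(N^(11/9)), by a recursion over the residue
classes modulo 36 with a numerical certificate (`weight_step`, `classSum_le`).

For the products, measure heads in units of ell. When the main head is u, the head of B_j is ⌈u/j⌉,
and ⌈⌈u/j⌉/a⌉ = ⌈u/(aj)⌉ (`cdiv_cdiv`). Hence the cofactors b of a in the new part of B_j lie in the
window of B_{aj}, or in the fixed block. As j descends, B_{aj} has already been moved
(`Run.advance`).

Running time: B_j treats O(N/j) entries, each at polylogarithmic cost plus its kMax; the harmonic
sum over j costs one more logarithm, and N^(11/9) times powers of log N is O(N^1.230175)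
(`exists_totalTime_le`). Storage: there are about N/H running blocks of length L, and L N ≤ H^2
makes all blocks together O(H) cells; each has O(log log N) bits because the values are O(log N)
(`bits_le`).

The program is verified by forward symbolic execution. `Run` establishes termination, the final
state, the exact time and the storage limit together; loops carry invariants that include the
elapsed time. -/

theorem OnesExpr.value_pos (e : OnesExpr) : 0 < e.value := by
  induction e with
  | one => exact Nat.one_pos
  | add e f he hf => exact Nat.add_pos_left he _
  | mul e f he hf => exact Nat.mul_pos he hf

theorem OnesExpr.ones_pos (e : OnesExpr) : 0 < e.ones := by
  induction e with
  | one => exact Nat.one_pos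
  | add e f he hf => exact Nat.add_pos_left he _
  | mul e f he hf => exact Nat.add_pos_left he _

theorem OnesExpr.exists_value {n : ℕ} (hn : 0 < n) : ∃ e : OnesExpr, e.value = n := by
  induction n, Nat.succ_le_of_lt hn using Nat.le_induction with
  | base => exact ⟨.one, rfl⟩
  | succ n hn' ih =>
    obtain ⟨e, he⟩ := ih hn'
    exact ⟨.add e .one, by simp [value, he]⟩

theorem complexity_le (e : OnesExpr) : complexity e.value ≤ e.ones :=
  Nat.sInf_le ⟨e, rfl, rfl⟩

theorem exists_ones_eq_complexity {n : ℕ} (hn : 0 < n) :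
    ∃ e : OnesExpr, e.value = n ∧ e.ones = complexity n := by
  obtain ⟨e, he⟩ := OnesExpr.exists_value hn
  exact Nat.sInf_mem (s := {k : ℕ | ∃ e : OnesExpr, e.value = n ∧ e.ones = k}) ⟨_, e, he, rfl⟩

theorem complexity_pos {n : ℕ} (hn : 0 < n) : 0 < complexity n := by
  obtain ⟨e, -, he⟩ := exists_ones_eq_complexity hn
  exact he ▸ e.ones_pos

theorem complexity_one : complexity 1 = 1 :=
  le_antisymm (complexity_le .one) (complexity_pos Nat.one_pos)

theorem complexity_add_le {a b : ℕ} (ha : 0 < a) (hb : 0 < b) :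
    complexity (a + b) ≤ complexity a + complexity b := by
  obtain ⟨e, rfl, he⟩ := exists_ones_eq_complexity ha
  obtain ⟨f, rfl, hf⟩ := exists_ones_eq_complexity hb
  exact (complexity_le (.add e f)).trans_eq (by rw [← he, ← hf]; rfl)

theorem complexity_mul_le {a b : ℕ} (ha : 0 < a) (hb : 0 < b) :
    complexity (a * b) ≤ complexity a + complexity b := by
  obtain ⟨e, rfl, he⟩ := exists_ones_eq_complexity ha
  obtain ⟨f, rfl, hf⟩ := exists_ones_eq_complexity hb
  exact (complexity_le (.mul e f)).trans_eq (by rw [← he, ← hf]; rfl)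

theorem complexity_succ_le {n : ℕ} (hn : 0 < n) : complexity (n + 1) ≤ complexity n + 1 :=
  (complexity_add_le hn Nat.one_pos).trans_eq (by rw [complexity_one])

theorem complexity_le_self {n : ℕ} (hn : 0 < n) : complexity n ≤ n := by
  induction n, Nat.succ_le_of_lt hn using Nat.le_induction with
  | base => exact complexity_one.le
  | succ n hpos ih => exact (complexity_succ_le hpos).trans (by simpa using ih hpos)

/-- The last operation of a shortest expression. -/
theorem complexity_split {n : ℕ} (hn : 2 ≤ n) :
    (∃ a b, 0 < a ∧ a ≤ b ∧ a + b = n ∧ complexity n = complexity a + complexity b) ∨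
      ∃ a b, 2 ≤ a ∧ a ≤ b ∧ a * b = n ∧ complexity n = complexity a + complexity b := by
  obtain ⟨e, he, ho⟩ := exists_ones_eq_complexity (n := n) (by omega)
  cases e with
  | one => simp [OnesExpr.value] at he; omega
  | add e f =>
    left
    have h1 := complexity_le e
    have h2 := complexity_le f
    have h3 := complexity_add_le e.value_pos f.value_pos
    simp only [OnesExpr.value, OnesExpr.ones] at he ho
    rw [he] at h3
    rcases le_total e.value f.value with h | h
    · exact ⟨_, _, e.value_pos, h, he, by omega⟩
    · exact ⟨_, _, f.value_pos, h, by omega, by omega⟩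
  | mul e f =>
    right
    have h1 := complexity_le e
    have h2 := complexity_le f
    have h3 := complexity_mul_le e.value_pos f.value_pos
    have h4 := e.ones_pos
    have h5 := f.ones_pos
    have h6 := e.value_pos
    have h7 := f.value_pos
    simp only [OnesExpr.value, OnesExpr.ones] at he ho
    rw [he] at h3
    -- If one factor were 1, the other would be an expression for n with fewer ones.
    have he1 : e.value ≠ 1 := by
      intro h
      rw [h, one_mul] at he
      rw [he] at h2
      omega
    have hf1 : f.value ≠ 1 := by
      intro h
      rw [h, mul_one] at he
      rw [he] at h1
      omega
    rcases le_total e.value f.value with h | h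
    · exact ⟨_, _, by omega, h, he, by omega⟩
    · exact ⟨_, _, by omega, h, by rw [mul_comm, he], by omega⟩

/-- Passing from ⌊n/2⌋ to n by a doubling and possibly + 1 costs at most three ones, and n^3 grows
by a factor of at least 8. The case n = 1 has to be excluded, so the induction starts at 2 and 3. -/
theorem two_pow_complexity_le {n : ℕ} (hn : 2 ≤ n) : 2 ^ complexity n ≤ n ^ 3 := by
  induction n using Nat.strong_induction_on with
  | _ n ih =>
    rcases Nat.lt_or_ge n 4 with h4 | h4
    · have h := complexity_le_self (n := n) (by omega)
      calc 2 ^ complexity n ≤ 2 ^ n := Nat.pow_le_pow_right (by norm_num) h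
        _ ≤ n ^ 3 := by interval_cases n <;> norm_num
    · have hk := ih (n / 2) (by omega) (by omega)
      have h2 : complexity 2 ≤ 2 := complexity_le_self (by norm_num)
      have hm : complexity (2 * (n / 2)) ≤ complexity (n / 2) + 2 := by
        have := complexity_mul_le (a := 2) (b := n / 2) (by norm_num) (by omega)
        omega
      have hc : complexity n ≤ complexity (n / 2) + 3 := by
        rcases Nat.mod_two_eq_zero_or_one n with h | h
        · rw [show 2 * (n / 2) = n by omega] at hm
          omega
        · have := complexity_succ_le (n := 2 * (n / 2)) (by omega)
          rw [show 2 * (n / 2) + 1 = n by omega] at this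
          omega
      calc 2 ^ complexity n ≤ 2 ^ (complexity (n / 2) + 3) :=
            Nat.pow_le_pow_right (by norm_num) hc
        _ = 2 ^ complexity (n / 2) * 8 := by rw [pow_add]; norm_num
        _ ≤ (n / 2) ^ 3 * 8 := Nat.mul_le_mul_right _ hk
        _ = (2 * (n / 2)) ^ 3 := by ring
        _ ≤ n ^ 3 := Nat.pow_le_pow_left (by omega) 3

/-- Thus the value with which the arrays are filled, the number of binary digits of a cube, is a
legitimate upper bound. -/
theorem complexity_le_size {n H : ℕ} (hn : 0 < n) (h : n ≤ H) :
    complexity n ≤ Nat.size (H ^ 3) := by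
  rcases Nat.lt_or_ge n 2 with h2 | h2
  · obtain rfl : n = 1 := by omega
    rw [complexity_one]
    exact Nat.size_pos.2 (Nat.pow_pos (by omega))
  · exact (Nat.lt_size.2 ((two_pow_complexity_le h2).trans (Nat.pow_le_pow_left h 3))).le

/-! ### The largest number of given complexity -/

/-- The largest number of complexity `k`, and `1` for `k = 0`. -/
def maxValue : ℕ → ℕ
  | 0 => 1
  | 1 => 1
  | 2 => 2
  | 3 => 3
  | 4 => 4
  | k + 5 => 3 * maxValue (k + 2)

/-- The restriction on k matters: E(4) = 4, whereas 3 · E(1) = 3. -/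
theorem maxValue_add_three {k : ℕ} (hk : 2 ≤ k) : maxValue (k + 3) = 3 * maxValue k := by
  obtain ⟨k, rfl⟩ := Nat.exists_eq_add_of_le hk
  rw [show 2 + k + 3 = k + 5 by ring, maxValue, add_comm 2 k]

theorem maxValue_add_five (k : ℕ) : maxValue (k + 5) = 3 * maxValue (k + 2) :=
  maxValue_add_three (by omega)

theorem maxValue_pos (k : ℕ) : 0 < maxValue k := by
  induction k using Nat.strong_induction_on with
  | _ k ih =>
    match k with
    | 0 | 1 | 2 | 3 | 4 => decide
    | k + 5 => exact Nat.mul_pos (by norm_num) (ih _ (by omega))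

theorem maxValue_lt_succ {k : ℕ} (hk : 0 < k) : maxValue k < maxValue (k + 1) := by
  induction k using Nat.strong_induction_on with
  | _ k ih =>
    match k with
    | 1 | 2 | 3 | 4 => decide
    | k + 5 =>
      have := ih (k + 2) (by omega) (by omega)
      rw [show k + 5 + 1 = (k + 1) + 5 by ring, maxValue, maxValue]
      exact Nat.mul_lt_mul_of_pos_left (by simpa [add_right_comm] using this) (by norm_num)

theorem maxValue_mono : Monotone maxValue := by
  refine monotone_nat_of_le_succ fun k => ?_
  rcases Nat.eq_zero_or_pos k with rfl | hk
  · decide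
  · exact (maxValue_lt_succ hk).le

/-- An index of at least 5 can be lowered by 3 on both sides at the price of a factor 3; what
remains is a finite table with both indices below 5. -/
theorem maxValue_mul_le {a b : ℕ} (ha : 0 < a) (hb : 0 < b) :
    maxValue a * maxValue b ≤ maxValue (a + b) := by
  induction hn : a + b using Nat.strong_induction_on generalizing a b with
  | _ n ih =>
    subst hn
    by_cases h : 5 ≤ a
    · obtain ⟨a, rfl⟩ := Nat.exists_eq_add_of_le' h
      have := ih (a + 2 + b) (by omega) (a := a + 2) (b := b) (by omega) hb rfl
      rw [show a + 5 + b = (a + 2 + b) + 3 by ring, maxValue_add_five, maxValue_add_three (by omega),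
        mul_assoc]
      exact Nat.mul_le_mul_left _ this
    by_cases h' : 5 ≤ b
    · obtain ⟨b, rfl⟩ := Nat.exists_eq_add_of_le' h'
      have := ih (a + (b + 2)) (by omega) (a := a) (b := b + 2) ha (by omega) rfl
      rw [show a + (b + 5) = (a + (b + 2)) + 3 by ring, maxValue_add_five,
        maxValue_add_three (by omega),
        mul_left_comm]
      exact Nat.mul_le_mul_left _ this
    · have h1 : a < 5 := by omega
      have h2 : b < 5 := by omega
      interval_cases a <;> interval_cases b <;> decide

/-- When both indices are at least 2, both values are at least 2, so their sum is at most their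
product. An index 1 is handled by strict growth. -/
theorem maxValue_add_le {a b : ℕ} (ha : 0 < a) (hb : 0 < b) :
    maxValue a + maxValue b ≤ maxValue (a + b) := by
  rcases Nat.lt_or_ge a 2 with h | h
  · obtain rfl : a = 1 := by omega
    have := maxValue_lt_succ hb
    rw [show maxValue 1 = 1 from rfl, add_comm 1 b]
    omega
  rcases Nat.lt_or_ge b 2 with h' | h'
  · obtain rfl : b = 1 := by omega
    exact maxValue_lt_succ ha
  · have h2 : 2 ≤ maxValue a := maxValue_mono h
    have h3 : 2 ≤ maxValue b := maxValue_mono h'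
    exact (by nlinarith : _ ≤ maxValue a * maxValue b).trans (maxValue_mul_le ha hb)

theorem OnesExpr.value_le (e : OnesExpr) : e.value ≤ maxValue e.ones := by
  induction e with
  | one => exact le_rfl
  | add e f he hf => exact (Nat.add_le_add he hf).trans (maxValue_add_le e.ones_pos f.ones_pos)
  | mul e f he hf => exact (Nat.mul_le_mul he hf).trans (maxValue_mul_le e.ones_pos f.ones_pos)

/-- Only this half of the meaning of E is ever needed; that E(k) is attained plays no role. -/
theorem le_maxValue_complexity {n : ℕ} (hn : 0 < n) : n ≤ maxValue (complexity n) := by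
  obtain ⟨e, rfl, he⟩ := exists_ones_eq_complexity hn
  exact he ▸ e.value_le

/-- This is E(k) ≤ 3^(k/3), cubed in order to stay within the natural numbers. -/
theorem maxValue_pow_le (k : ℕ) : maxValue k ^ 3 ≤ 3 ^ k := by
  induction k using Nat.strong_induction_on with
  | _ k ih =>
    match k with
    | 0 | 1 | 2 | 3 | 4 => decide
    | k + 5 =>
      have := ih (k + 2) (by omega)
      rw [maxValue, mul_pow, show k + 5 = (k + 2) + 3 by ring, pow_add]
      linarith

/-- The number `5` and everything below has no expression with fewer ones than itself. -/
theorem complexity_eq_self {n : ℕ} (hn : 0 < n) (h : n ≤ 5) : complexity n = n := by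
  refine le_antisymm (complexity_le_self hn) ?_
  by_contra! hlt
  have h1 := le_maxValue_complexity hn
  have h2 := complexity_pos hn
  have h3 : complexity n ≤ 4 := by omega
  generalize complexity n = k at *
  interval_cases k <;> simp [maxValue] at h1 <;> omega

/-- Since 3 < 4, one has 3^s ≤ (2^s)^2. This keeps the scalars in the search for kMax below the
limit N^3. -/
theorem maxValue_le_sq {s n : ℕ} (h : 2 ^ s ≤ n ^ 3) : maxValue s ≤ n ^ 2 := by
  refine le_of_pow_le_pow_left₀ (n := 3) (by norm_num) (Nat.zero_le _) ?_
  calc maxValue s ^ 3 ≤ 3 ^ s := maxValue_pow_le s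
    _ ≤ 4 ^ s := Nat.pow_le_pow_left (by norm_num) s
    _ = (2 ^ s) ^ 2 := by rw [← pow_mul, mul_comm, pow_mul]; norm_num
    _ ≤ (n ^ 3) ^ 2 := Nat.pow_le_pow_left h 2
    _ = (n ^ 2) ^ 3 := by ring

/-! ### The range of the smaller summand -/

/-- `t` is the index found by the search for `kMax n s`. -/
structure IsCut (n s t : ℕ) : Prop where
  le_half : t ≤ s / 2
  le_sum : n ≤ maxValue t + maxValue (s - t)
  sum_lt : ∀ t', t < t' → t' ≤ s / 2 → maxValue t' + maxValue (s - t') < n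

/-- If u = ‖a‖ is at most s/2 but exceeds t, then E(u) + E(s - u) < n by the choice of t, although
the left side is at least a + b. If ‖a‖ > s/2, then ‖b‖ ≤ s/2, and the same argument bounds b, hence
also a ≤ b. -/
theorem IsCut.summand_le {n s t a b : ℕ} (h : IsCut n s t) (ha : 0 < a) (hab : a ≤ b)
    (hn : a + b = n) (hs : complexity a + complexity b ≤ s) : a ≤ maxValue t := by
  have h1 := le_maxValue_complexity ha
  have h2 := le_maxValue_complexity (ha.trans_le hab)
  set u := complexity a
  set w := complexity b
  rcases Nat.lt_or_ge (s / 2) u with hu | hu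
  · refine (hab.trans h2).trans (maxValue_mono ?_)
    by_contra! hlt
    have := h.sum_lt w hlt (by omega)
    have := maxValue_mono (show u ≤ s - w by omega)
    omega
  · refine h1.trans (maxValue_mono ?_)
    by_contra! hlt
    have := h.sum_lt u hlt hu
    have := maxValue_mono (show w ≤ s - u by omega)
    omega

/-- The cut satisfies t ≤ s - t, so n ≤ 2 E(s - t), and the exponents t and s - t add up to s. -/
theorem IsCut.mul_pow_le {n s t : ℕ} (h : IsCut n s t) : (maxValue t * n) ^ 3 ≤ 8 * 3 ^ s := by
  have h0 := h.le_half
  have h1 := h.le_sum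
  have h2 := maxValue_mono (show t ≤ s - t by omega)
  calc (maxValue t * n) ^ 3 ≤ (maxValue t * (2 * maxValue (s - t))) ^ 3 :=
        Nat.pow_le_pow_left (Nat.mul_le_mul_left _ (by omega)) 3
    _ = 8 * (maxValue t ^ 3 * maxValue (s - t) ^ 3) := by ring
    _ ≤ 8 * (3 ^ t * 3 ^ (s - t)) :=
        Nat.mul_le_mul_left _ (Nat.mul_le_mul (maxValue_pow_le _) (maxValue_pow_le _))
    _ = 8 * 3 ^ s := by rw [← pow_add, show t + (s - t) = s by omega]

/-- Because t ≤ s/2, E(t)^6 ≤ 3^(2t) ≤ 3^s ≤ (2^s)^2. This crude bound is enough in the fixed block,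
where only kMax < n is needed for the indices. -/
theorem IsCut.le_of_two_pow_le {n s t k : ℕ} (h : IsCut n s t) (hs : 2 ^ s ≤ k ^ 3) :
    maxValue t ≤ k := by
  have h0 := h.le_half
  refine le_of_pow_le_pow_left₀ (n := 6) (by norm_num) (Nat.zero_le _) ?_
  calc maxValue t ^ 6 = (maxValue t ^ 3) ^ 2 := by ring
    _ ≤ (3 ^ t) ^ 2 := Nat.pow_le_pow_left (maxValue_pow_le t) 2
    _ = 3 ^ (t * 2) := by rw [pow_mul]
    _ ≤ 3 ^ s := Nat.pow_le_pow_right (by norm_num) (by omega)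
    _ ≤ 4 ^ s := Nat.pow_le_pow_left (by norm_num) s
    _ = (2 ^ s) ^ 2 := by rw [← pow_mul, mul_comm, pow_mul]; norm_num
    _ ≤ (k ^ 3) ^ 2 := Nat.pow_le_pow_left hs 2
    _ = k ^ 6 := by ring

/-- If `v` is an upper bound for `‖n‖` that takes into account all products, the sum `(n - 1) + 1`
and the sums with a smaller summand between `6` and `kMax`, then `v = ‖n‖`. -/
theorem IsCut.eq_complexity {n s t v : ℕ} (h : IsCut n s t) (hn : 2 ≤ n) (hv : complexity n ≤ v)
    (h1 : v ≤ complexity (n - 1) + 1) (hs : v ≤ s + 1)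
    (hsum : ∀ m, 6 ≤ m → m ≤ maxValue t → m < n → v ≤ complexity m + complexity (n - m))
    (hprod : ∀ a b, 2 ≤ a → a ≤ b → a * b = n → v ≤ complexity a + complexity b) :
    v = complexity n := by
  refine le_antisymm ?_ hv
  rcases complexity_split hn with ⟨a, b, ha, hab, rfl, hc⟩ | ⟨a, b, ha, hab, rfl, hc⟩
  · rw [hc]
    rcases Nat.lt_or_ge a 6 with h6 | h6
    · rw [complexity_eq_self ha (by omega)]
      -- For 2 ≤ a ≤ 5 the complexity of a is a itself, so (a - 1) + b yields n - 1 with one 1 less;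
      -- the sum (n - 1) + 1 does at least as well as a + b.
      rcases Nat.lt_or_ge 1 a with ha1 | ha1
      · have h3 := complexity_add_le (a := a - 1) (b := b) (by omega) (by omega)
        rw [complexity_eq_self (n := a - 1) (by omega) (by omega),
          show a - 1 + b = a + b - 1 by omega] at h3
        omega
      · obtain rfl : a = 1 := by omega
        rw [show 1 + b - 1 = b by omega] at h1
        omega
    -- A sum of cost at least s + 1 cannot improve on v ≤ s + 1.
    · by_cases hle : complexity a + complexity b ≤ s
      · have := hsum a h6 (h.summand_le ha hab rfl hle) (by omega)
        rwa [show a + b - a = b by omega] at this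
      · omega
  · rw [hc]
    exact hprod a b ha hab rfl

/-! ### The mean of `3 ^ (‖n‖ / 3) / n`

Writing `n = p * m + r` with `p = 2` or `p = 3`, depending on the residue of `n` modulo `36`, gives a
recursion for the sums over the residue classes, with a subsolution of exponent `11 / 9`. -/

/-- `3 ^ (‖n‖ / 3) / n`, with the value `1` at `n = 0`. -/
noncomputable def ratio (n : ℕ) : ℝ :=
  if n = 0 then 1 else 3 ^ ((complexity n : ℝ) / 3) / n

theorem ratio_zero : ratio 0 = 1 := if_pos rfl

theorem ratio_of_pos {n : ℕ} (hn : 0 < n) : ratio n = 3 ^ ((complexity n : ℝ) / 3) / n :=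
  if_neg hn.ne'

theorem ratio_nonneg (n : ℕ) : 0 ≤ ratio n := by
  unfold ratio
  split_ifs <;> positivity

theorem complexity_mul_add_le {p m r : ℕ} (hp : 0 < p) (hm : 0 < m) :
    complexity (p * m + r) ≤ complexity m + (p + r) := by
  have h1 := complexity_mul_le hp hm
  have h2 := complexity_le_self hp
  rcases Nat.eq_zero_or_pos r with rfl | hr
  · rw [add_zero]
    omega
  · have h3 := complexity_add_le (Nat.mul_pos hp hm) hr
    have h4 := complexity_le_self hr
    omega

/-- For m > 0 this combines ‖pm + r‖ ≤ ‖m‖ + p + r with pm + r ≥ pm. For m = 0 it rests on the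
convention `ratio 0 = 1` and on p ≤ 3^(p/3), which is true for p = 2 and p = 3. -/
theorem ratio_mul_add_le {p m r : ℕ} (hp : 2 ≤ p) (hp' : p ≤ 3) :
    ratio (p * m + r) ≤ 3 ^ (((p + r : ℕ) : ℝ) / 3) / p * ratio m := by
  have hp0 : (0 : ℝ) < p := by positivity
  rcases Nat.eq_zero_or_pos m with rfl | hm
  · rw [mul_zero, zero_add, ratio_zero, mul_one]
    rcases Nat.eq_zero_or_pos r with rfl | hr
    · rw [ratio_zero, le_div_iff₀ hp0, one_mul, add_zero]
      refine le_of_pow_le_pow_left₀ (n := 3) (by norm_num) (by positivity) ?_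
      rw [← Real.rpow_natCast, ← Real.rpow_natCast, ← Real.rpow_mul (by norm_num)]
      interval_cases p <;> norm_num
    · rw [ratio_of_pos hr, div_le_div_iff₀ (by positivity) hp0]
      have h1 : (3 : ℝ) ^ ((complexity r : ℝ) / 3) ≤ 3 ^ ((r : ℝ) / 3) := by
        refine Real.rpow_le_rpow_of_exponent_le (by norm_num) ?_
        have : (complexity r : ℝ) ≤ r := by exact_mod_cast complexity_le_self hr
        linarith
      have h2 : (p : ℝ) ≤ 3 ^ ((p : ℝ) / 3) * r := by
        have hr' : (1 : ℝ) ≤ r := by exact_mod_cast hr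
        have h3 : (p : ℝ) ≤ 3 ^ ((p : ℝ) / 3) := by
          refine le_of_pow_le_pow_left₀ (n := 3) (by norm_num) (by positivity) ?_
          rw [← Real.rpow_natCast (3 ^ ((p : ℝ) / 3)), ← Real.rpow_mul (by norm_num)]
          interval_cases p <;> norm_num
        nlinarith
      rw [Nat.cast_add, add_div, Real.rpow_add (by norm_num)]
      calc (3 : ℝ) ^ ((complexity r : ℝ) / 3) * p
          ≤ 3 ^ ((r : ℝ) / 3) * (3 ^ ((p : ℝ) / 3) * r) := by gcongr
        _ = _ := by ring
  · have hm' : (0 : ℝ) < m := by exact_mod_cast hm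
    rw [ratio_of_pos hm, ratio_of_pos (by positivity), div_mul_div_comm, ← Real.rpow_add (by norm_num)]
    have h : (complexity (p * m + r) : ℝ) ≤ complexity m + (p + r : ℕ) := by
      exact_mod_cast complexity_mul_add_le (by omega) hm
    gcongr
    · norm_num
    · linarith
    · push_cast
      linarith [(Nat.cast_nonneg r : (0 : ℝ) ≤ r)]

/-- The divisor used for a residue modulo `36`. -/
def divisorOf (r : ℕ) : ℕ :=
  [2, 2, 2, 3, 2, 2, 3, 2, 2, 3, 3, 3, 2, 2, 2, 3, 2, 2,
    3, 3, 2, 3, 2, 2, 2, 2, 2, 3, 2, 2, 3, 3, 2, 3, 2, 2].getD r 2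

/-- The weight of a residue modulo `36`. -/
def weight (r : ℕ) : ℕ :=
  [27, 39, 39, 39, 38, 55, 39, 56, 46, 35, 50, 73, 36, 51, 51, 51, 47, 68,
    33, 48, 45, 48, 65, 94, 40, 58, 58, 42, 50, 72, 53, 77, 60, 77, 87, 125].getD r 0

/-- An upper bound for `10 ^ 4 * 3 ^ ((p + r) / 3) / p ^ (20 / 9)`, for `r < p ≤ 3`. -/
def stepFactor (p r : ℕ) : ℕ :=
  if p = 2 then [4459, 6430].getD r 0 else [2612, 3767, 5432].getD r 0

/-- The numerical certificate. If n lies in the class r modulo 36, then ⌊n/p⌋ lies in the class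
⌊r/p⌋ modulo 36/p, which explains the range of q. The inequality says that the weights reproduce
themselves under one step of the recursion when sums grow like N^(11/9). Everything is scaled to
integers, so that it can be checked by computation. -/
theorem weight_step : ∀ r < 36,
    stepFactor (divisorOf r) (r % divisorOf r) *
      ∑ q ∈ (Finset.range 36).filter (fun q => q % (36 / divisorOf r) = r / divisorOf r), weight q
        ≤ 10 ^ 4 * weight r := by
  decide +kernel

theorem divisorOf_mem : ∀ r < 36, divisorOf r = 2 ∨ divisorOf r = 3 := by decide

theorem weight_pos : ∀ r < 36, 1 ≤ weight r := by decide

/-- Ninth powers clear all fractional exponents and leave comparisons of integers. The factor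
p^(11/9) on the right is what (N/p)^(11/9) loses against N^(11/9). -/
theorem rpow_le_stepFactor {p r : ℕ} (hp : p = 2 ∨ p = 3) (hr : r < p) :
    (3 : ℝ) ^ (((p + r : ℕ) : ℝ) / 3) / p ≤ stepFactor p r / 10 ^ 4 * (p : ℝ) ^ (11 / 9 : ℝ) := by
  have hp0 : (0 : ℝ) < p := by rcases hp with rfl | rfl <;> norm_num
  rw [div_le_iff₀ hp0]
  refine le_of_pow_le_pow_left₀ (n := 9) (by norm_num) (by positivity) ?_
  rw [mul_pow, mul_pow, ← Real.rpow_natCast (3 ^ _), ← Real.rpow_mul (by norm_num),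
    ← Real.rpow_natCast ((p : ℝ) ^ (11 / 9 : ℝ)), ← Real.rpow_mul hp0.le,
    show ((p + r : ℕ) : ℝ) / 3 * (9 : ℕ) = ((3 * (p + r) : ℕ) : ℝ) by push_cast; ring,
    show (11 / 9 : ℝ) * (9 : ℕ) = (11 : ℕ) by norm_num, Real.rpow_natCast, Real.rpow_natCast]
  rcases hp with rfl | rfl
  · interval_cases r <;> norm_num [stepFactor]
  · interval_cases r <;> norm_num [stepFactor]

/-- The sum of `ratio` over the `n ≤ N` in a residue class modulo `36`. -/
noncomputable def classSum (r N : ℕ) : ℝ :=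
  ∑ n ∈ (Finset.range (N + 1)).filter (fun n => n % 36 = r), ratio n

/-- On a residue class modulo 36 the map n ↦ ⌊n/p⌋ is injective, and its image lies in one class
modulo 36/p, which splits into p classes modulo 36. -/
theorem classSum_step {r N p : ℕ} (hr : r < 36) (hp : p = 2 ∨ p = 3) :
    classSum r N ≤ 3 ^ (((p + r % p : ℕ) : ℝ) / 3) / p *
      ∑ q ∈ (Finset.range 36).filter (fun q => q % (36 / p) = r / p), classSum q (N / p) := by
  have hp0 : 0 < p := by omega
  have hsum : ∑ q ∈ (Finset.range 36).filter (fun q => q % (36 / p) = r / p), classSum q (N / p) =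
      ∑ m ∈ (Finset.range (N / p + 1)).filter (fun m => m % (36 / p) = r / p), ratio m := by
    unfold classSum
    rw [← Finset.sum_fiberwise_of_maps_to (g := fun m => m % 36)
      (s := (Finset.range (N / p + 1)).filter (fun m => m % (36 / p) = r / p))
      (t := (Finset.range 36).filter (fun q => q % (36 / p) = r / p))]
    · refine Finset.sum_congr rfl fun q hq => Finset.sum_congr ?_ fun _ _ => rfl
      ext m
      simp only [Finset.mem_filter, Finset.mem_range] at hq ⊢
      rcases hp with rfl | rfl <;> omega
    · intro m hm
      simp only [Finset.mem_filter, Finset.mem_range] at hm ⊢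
      rcases hp with rfl | rfl <;> omega
  rw [hsum, Finset.mul_sum]
  have hinj : Set.InjOn (fun n => n / p)
      ((Finset.range (N + 1)).filter (fun n => n % 36 = r) : Set ℕ) := by
    intro a ha b hb hab
    simp only [Finset.coe_filter, Finset.mem_range, Set.mem_ofPred_eq] at ha hb
    simp only at hab
    rcases hp with rfl | rfl <;> omega
  calc classSum r N
      ≤ ∑ n ∈ (Finset.range (N + 1)).filter (fun n => n % 36 = r),
          3 ^ (((p + r % p : ℕ) : ℝ) / 3) / p * ratio (n / p) := by
        refine Finset.sum_le_sum fun n hn => ?_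
        simp only [Finset.mem_filter, Finset.mem_range] at hn
        have h : n = p * (n / p) + r % p := by
          rcases hp with rfl | rfl <;> omega
        conv_lhs => rw [h]
        exact ratio_mul_add_le (by omega) (by omega)
    _ = ∑ m ∈ ((Finset.range (N + 1)).filter (fun n => n % 36 = r)).image (fun n => n / p),
          3 ^ (((p + r % p : ℕ) : ℝ) / 3) / p * ratio m := by
        rw [Finset.sum_image hinj]
    _ ≤ _ := by
        refine Finset.sum_le_sum_of_subset_of_nonneg ?_ fun m _ _ =>
          mul_nonneg (by positivity) (ratio_nonneg m)
        intro m hm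
        simp only [Finset.mem_image, Finset.mem_filter, Finset.mem_range] at hm ⊢
        obtain ⟨n, hn, rfl⟩ := hm
        rcases hp with rfl | rfl <;> omega

/-- Strong induction: apply the recursion with the divisor chosen for r, insert the bound at ⌊N/p⌋,
and use the certificate. For N ≥ 3 the quotient ⌊N/p⌋ is positive, so only N = 1, 2 need the
constant C. -/
theorem classSum_le {N : ℕ} (hN : 0 < N) {r : ℕ} (hr : r < 36) :
    classSum r N ≤ (ratio 0 + ratio 1 + ratio 2) * weight r * (N : ℝ) ^ (11 / 9 : ℝ) := by
  set C := ratio 0 + ratio 1 + ratio 2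
  have hC : 0 ≤ C :=
    add_nonneg (add_nonneg (ratio_nonneg _) (ratio_nonneg _)) (ratio_nonneg _)
  induction N using Nat.strong_induction_on generalizing r with
  | _ N ih =>
    rcases Nat.lt_or_ge N 3 with h3 | h3
    · have h1 : classSum r N ≤ C := by
        calc classSum r N ≤ ∑ n ∈ Finset.range 3, ratio n :=
              Finset.sum_le_sum_of_subset_of_nonneg
                (fun n hn => by simp only [Finset.mem_filter, Finset.mem_range] at hn ⊢; omega)
                fun n _ _ => ratio_nonneg n
          _ = C := by simp [Finset.sum_range_succ, C]
      have h2 : (1 : ℝ) ≤ weight r := by exact_mod_cast weight_pos r hr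
      have h4 : (1 : ℝ) ≤ (N : ℝ) ^ (11 / 9 : ℝ) :=
        Real.one_le_rpow (by exact_mod_cast hN) (by norm_num)
      calc classSum r N ≤ C * 1 * 1 := by simpa using h1
        _ ≤ _ := by gcongr
    · set p := divisorOf r with hpdef
      have hp : p = 2 ∨ p = 3 := divisorOf_mem r hr
      have hp0 : (0 : ℝ) < p := by rcases hp with h | h <;> rw [h] <;> norm_num
      have hw : (stepFactor p (r % p) : ℝ) *
          ∑ q ∈ (Finset.range 36).filter (fun q => q % (36 / p) = r / p), (weight q : ℝ)
            ≤ 10 ^ 4 * weight r := by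
        exact_mod_cast weight_step r hr
      have hNp : ((N / p : ℕ) : ℝ) ^ (11 / 9 : ℝ) ≤
          (N : ℝ) ^ (11 / 9 : ℝ) / (p : ℝ) ^ (11 / 9 : ℝ) := by
        rw [← Real.div_rpow (by positivity) hp0.le]
        exact Real.rpow_le_rpow (by positivity) Nat.cast_div_le (by norm_num)
      have hsum : ∑ q ∈ (Finset.range 36).filter (fun q => q % (36 / p) = r / p),
          classSum q (N / p) ≤
          (C * ((N : ℝ) ^ (11 / 9 : ℝ) / (p : ℝ) ^ (11 / 9 : ℝ))) *
            ∑ q ∈ (Finset.range 36).filter (fun q => q % (36 / p) = r / p), (weight q : ℝ) := by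
        rw [Finset.mul_sum]
        refine Finset.sum_le_sum fun q hq => ?_
        simp only [Finset.mem_filter, Finset.mem_range] at hq
        have hlt : N / p < N := Nat.div_lt_self hN (by omega)
        have hpos : 0 < N / p := Nat.div_pos (by omega) (by omega)
        calc classSum q (N / p) ≤ C * weight q * ((N / p : ℕ) : ℝ) ^ (11 / 9 : ℝ) :=
              ih _ hlt hpos hq.1
          _ ≤ C * weight q * ((N : ℝ) ^ (11 / 9 : ℝ) / (p : ℝ) ^ (11 / 9 : ℝ)) := by gcongr
          _ = _ := by ring
      have hsum0 : 0 ≤ ∑ q ∈ (Finset.range 36).filter (fun q => q % (36 / p) = r / p),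
          classSum q (N / p) :=
        Finset.sum_nonneg fun q _ => Finset.sum_nonneg fun n _ => ratio_nonneg n
      have hpa : (0 : ℝ) < (p : ℝ) ^ (11 / 9 : ℝ) := Real.rpow_pos_of_pos hp0 _
      calc classSum r N
          ≤ 3 ^ (((p + r % p : ℕ) : ℝ) / 3) / p *
              ∑ q ∈ (Finset.range 36).filter (fun q => q % (36 / p) = r / p),
                classSum q (N / p) := classSum_step hr hp
        _ ≤ (stepFactor p (r % p) / 10 ^ 4 * (p : ℝ) ^ (11 / 9 : ℝ)) *
              ((C * ((N : ℝ) ^ (11 / 9 : ℝ) / (p : ℝ) ^ (11 / 9 : ℝ))) *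
            ∑ q ∈ (Finset.range 36).filter (fun q => q % (36 / p) = r / p), (weight q : ℝ)) :=
            mul_le_mul (rpow_le_stepFactor hp (Nat.mod_lt _ (by omega))) hsum hsum0 (by positivity)
        _ = C * (N : ℝ) ^ (11 / 9 : ℝ) / 10 ^ 4 * (stepFactor p (r % p) *
            ∑ q ∈ (Finset.range 36).filter (fun q => q % (36 / p) = r / p), (weight q : ℝ)) := by
            field_simp
        _ ≤ C * (N : ℝ) ^ (11 / 9 : ℝ) / 10 ^ 4 * (10 ^ 4 * weight r) := by gcongr
        _ = _ := by ring

/-- The exponent 11/9 = 1.222… is deliberately smaller than 1.230175: the difference will absorb all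
logarithmic factors. -/
theorem exists_sum_ratio_le : ∃ C : ℝ, 0 ≤ C ∧ ∀ N : ℕ, 0 < N →
    ∑ n ∈ Finset.range (N + 1), ratio n ≤ C * (N : ℝ) ^ (11 / 9 : ℝ) := by
  refine ⟨∑ r ∈ Finset.range 36, (ratio 0 + ratio 1 + ratio 2) * weight r,
    Finset.sum_nonneg fun r _ => mul_nonneg
      (add_nonneg (add_nonneg (ratio_nonneg _) (ratio_nonneg _)) (ratio_nonneg _)) (by positivity),
    fun N hN => ?_⟩
  rw [← Finset.sum_fiberwise_of_maps_to (g := fun n => n % 36) (t := Finset.range 36)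
    fun n _ => Finset.mem_range.2 (Nat.mod_lt _ (by norm_num)), Finset.sum_mul]
  exact Finset.sum_le_sum fun r hr => classSum_le hN (Finset.mem_range.1 hr)

/-! ### Arrays as functions -/

namespace State

/-- The number of arrays in the list `r`. -/
def count (s : State) (r : Arr) : ℕ := (s.arrs r).length

/-- The number of cells of the array `r[i]`. -/
def size (s : State) (r : Arr) (i : ℕ) : ℕ := ((s.arrs r)[i]?).elim 0 fun c => c.cells.length

/-- The width of the cells of the array `r[i]`. -/
def width (s : State) (r : Arr) (i : ℕ) : ℕ := ((s.arrs r)[i]?).elim 0 Cells.width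

/-- The content of the cell `r[i][k]`. -/
def get (s : State) (r : Arr) (i k : ℕ) : ℕ := (s.read r i k).getD 0

/-- Store `x` in the cell `r[i][k]`. -/
def put (s : State) (r : Arr) (i k x : ℕ) : State :=
  { s with arrs := Function.update s.arrs r
                    ((s.arrs r).modify i fun c => { c with cells := c.cells.set k x }) }

/-- The number of bits of all arrays. -/
def arrBits (s : State) : ℕ := ∑ r : Arr, ((s.arrs r).map Cells.bits).sum

variable {s : State} {r r' : Arr} {i i' k k' x : ℕ} {v w : Var}

theorem read_eq (h : k < s.size r i) : s.read r i k = some (s.get r i k) := by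
  unfold size at h
  unfold get read
  cases hc : (s.arrs r)[i]? with
  | none => simp [hc] at h
  | some c =>
    simp only [hc, Option.elim_some] at h
    simp [h]

theorem write_eq (h : k < s.size r i) (hx : Nat.size x ≤ s.width r i) :
    s.write r i k x = some (s.put r i k x) := by
  unfold size at h
  unfold width at hx
  unfold write put
  cases hc : (s.arrs r)[i]? with
  | none => simp [hc] at h
  | some c =>
    simp only [hc, Option.elim_some] at h hx
    simp only [Option.bind_some, h, hx, and_self, if_true, Option.some.injEq, State.mk.injEq,
      and_true, true_and]
    congr 1
    rw [List.modify_eq_set_getElem?, hc]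
    rfl

/-! ### Effect of the elementary operations on scalars, cells and array shapes -/

@[simp] theorem vars_set : (s.set v x).vars w = if w = v then x else s.vars w := by
  simp [set, Function.update_apply]

@[simp] theorem arrs_set : (s.set v x).arrs = s.arrs := rfl

@[simp] theorem out_set : (s.set v x).out = s.out := rfl

@[simp] theorem get_set : (s.set v x).get = s.get := rfl

@[simp] theorem size_set : (s.set v x).size = s.size := rfl

@[simp] theorem arrBits_set : (s.set v x).arrBits = s.arrBits := rfl

@[simp] theorem vars_put : (s.put r i k x).vars = s.vars := rfl

@[simp] theorem out_put : (s.put r i k x).out = s.out := rfl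

@[simp] theorem size_put : (s.put r i k x).size r' i' = s.size r' i' := by
  unfold size put
  by_cases hr : r' = r
  · subst hr
    simp only [Function.update_self, List.getElem?_modify]
    by_cases hi : i = i'
    · subst hi
      cases (s.arrs r')[i]? <;> simp
    · simp [hi]
  · simp [Function.update_of_ne hr]

@[simp] theorem width_put : (s.put r i k x).width r' i' = s.width r' i' := by
  unfold width put
  by_cases hr : r' = r
  · subst hr
    simp only [Function.update_self, List.getElem?_modify]
    by_cases hi : i = i'
    · subst hi
      cases (s.arrs r')[i]? <;> simp
    · simp [hi]
  · simp [Function.update_of_ne hr]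

@[simp] theorem count_put : (s.put r i k x).count r' = s.count r' := by
  unfold count put
  by_cases hr : r' = r
  · subst hr
    simp
  · simp [Function.update_of_ne hr]

theorem get_put (h : k < s.size r i) : (s.put r i k x).get r' i' k' =
    if r' = r ∧ i' = i ∧ k' = k then x else s.get r' i' k' := by
  unfold size at h
  unfold get read put
  by_cases hr : r' = r
  · subst hr
    simp only [Function.update_self, List.getElem?_modify, true_and]
    by_cases hi : i = i'
    · subst hi
      cases hc : (s.arrs r')[i]? with
      | none => simp [hc] at h
      | some c =>
        simp only [hc, Option.elim_some] at h
        by_cases hk : k = k'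
        · subst hk
          simp [h]
        · simp [List.getElem?_set_ne hk, Ne.symm hk]
    · simp [hi, Ne.symm hi]
  · simp [hr]

/-- With the storage expressed through number, length and width of the arrays, any operation that
keeps these leaves the storage unchanged. -/
theorem arrBits_eq : s.arrBits = ∑ r, ∑ i ∈ Finset.range (s.count r), s.size r i * s.width r i := by
  unfold arrBits
  refine Finset.sum_congr rfl fun r _ => ?_
  have key : ∀ l : List Cells, (l.map Cells.bits).sum = ∑ i ∈ Finset.range l.length,
      (l[i]?).elim 0 (fun c => c.cells.length) * (l[i]?).elim 0 Cells.width := by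
    intro l
    induction l with
    | nil => simp
    | cons c l ih =>
      rw [List.map_cons, List.sum_cons, ih, List.length_cons, Finset.sum_range_succ']
      simp [Cells.bits, add_comm]
  exact key _

@[simp] theorem arrBits_put : (s.put r i k x).arrBits = s.arrBits := by
  simp [arrBits_eq]

@[simp] theorem vars_append : (s.append r k x).vars = s.vars := rfl

@[simp] theorem out_append : (s.append r k x).out = s.out := rfl

theorem size_append : (s.append r k x).size r' i' =
    if r' = r ∧ i' = s.count r then k else s.size r' i' := by
  unfold size append count
  by_cases hr : r' = r
  · subst hr
    simp only [Function.update_self, true_and]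
    rcases lt_trichotomy i' (s.arrs r').length with h | h | h
    · simp [List.getElem?_append_left h, h.ne]
    · simp [h]
    · rw [List.getElem?_eq_none (by simp; omega), List.getElem?_eq_none (by omega)]
      simp [h.ne']
  · simp [hr]

theorem width_append : (s.append r k x).width r' i' =
    if r' = r ∧ i' = s.count r then Nat.size x else s.width r' i' := by
  unfold width append count
  by_cases hr : r' = r
  · subst hr
    simp only [Function.update_self, true_and]
    rcases lt_trichotomy i' (s.arrs r').length with h | h | h
    · simp [List.getElem?_append_left h, h.ne]
    · simp [h]
    · rw [List.getElem?_eq_none (by simp; omega), List.getElem?_eq_none (by omega)]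
      simp [h.ne']
  · simp [hr]

theorem get_append : (s.append r k x).get r' i' k' =
    if r' = r ∧ i' = s.count r then (if k' < k then x else 0) else s.get r' i' k' := by
  unfold get read append count
  by_cases hr : r' = r
  · subst hr
    simp only [Function.update_self, true_and]
    rcases lt_trichotomy i' (s.arrs r').length with h | h | h
    · simp [List.getElem?_append_left h, h.ne]
    · by_cases hk : k' < k
      · simp [h, hk]
      · simp [h, hk]
    · rw [List.getElem?_eq_none (by simp; omega), List.getElem?_eq_none (by omega)]
      simp [h.ne']
  · simp [hr]

theorem count_append : (s.append r k x).count r' = s.count r' + if r' = r then 1 else 0 := by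
  unfold count append
  by_cases hr : r' = r
  · subst hr
    simp
  · simp [hr]

theorem arrBits_append : (s.append r k x).arrBits = s.arrBits + k * Nat.size x := by
  unfold arrBits append
  rw [← Finset.add_sum_erase _ _ (Finset.mem_univ r), ← Finset.add_sum_erase _ _ (Finset.mem_univ r),
    Finset.sum_congr rfl fun r' hr' =>
      congrArg (fun l => (List.map Cells.bits l).sum)
        (Function.update_of_ne (Finset.ne_of_mem_erase hr') _ _)]
  simp [Cells.bits]
  ring

@[simp] theorem vars_print : (s.print x).vars = s.vars := rfl

@[simp] theorem out_print : (s.print x).out = s.out ++ [x] := rfl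

@[simp] theorem arrs_print : (s.print x).arrs = s.arrs := rfl

theorem get_eq_of_arrs_eq {s' : State} (h : s'.arrs = s.arrs) : s'.get = s.get := by
  unfold get read
  rw [h]

theorem size_eq_of_arrs_eq {s' : State} (h : s'.arrs = s.arrs) : s'.size = s.size := by
  unfold size
  rw [h]

theorem width_eq_of_arrs_eq {s' : State} (h : s'.arrs = s.arrs) : s'.width = s.width := by
  unfold width
  rw [h]

theorem count_eq_of_arrs_eq {s' : State} (h : s'.arrs = s.arrs) : s'.count = s.count := by
  unfold count
  rw [h]

end State

/-! ### Total evaluation -/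

/-- The value of an expression, with the value `0` for cells that do not exist. -/
def Expr.val (s : State) : Expr → ℕ
  | .const c => c
  | .var v => s.vars v
  | .add e f => e.val s + f.val s
  | .sub e f => e.val s - f.val s
  | .mul e f => e.val s * f.val s
  | .div e f => e.val s / f.val s
  | .read r e f => s.get r (e.val s) (f.val s)
  | .len r => s.count r

/-- All cells read by an expression exist. -/
def Expr.ok (s : State) : Expr → Prop
  | .const _ => True
  | .var _ => True
  | .add e f => e.ok s ∧ f.ok s
  | .sub e f => e.ok s ∧ f.ok s
  | .mul e f => e.ok s ∧ f.ok s
  | .div e f => e.ok s ∧ f.ok s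
  | .read r e f => e.ok s ∧ f.ok s ∧ f.val s < s.size r (e.val s)
  | .len _ => True

theorem Expr.eval_eq {s : State} {e : Expr} (h : e.ok s) : e.eval s = some (e.val s) := by
  induction e with
  | const c => rfl
  | var v => rfl
  | add e f he hf => simp [eval, val, he h.1, hf h.2]
  | sub e f he hf => simp [eval, val, he h.1, hf h.2]
  | mul e f he hf => simp [eval, val, he h.1, hf h.2]
  | div e f he hf => simp [eval, val, he h.1, hf h.2]
  | read r e f he hf => simp [eval, val, he h.1, hf h.2.1, State.read_eq h.2.2]
  | len r => rfl

/-- The test is true. -/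
def Test.holds (s : State) : Test → Prop
  | .lt e f => e.val s < f.val s
  | .le e f => e.val s ≤ f.val s
  | .and c d => c.holds s ∧ d.holds s

/-- All cells read by a test exist. -/
def Test.ok (s : State) : Test → Prop
  | .lt e f => e.ok s ∧ f.ok s
  | .le e f => e.ok s ∧ f.ok s
  | .and c d => c.ok s ∧ d.ok s

open Classical in
theorem Test.eval_eq {s : State} {c : Test} (h : c.ok s) :
    c.eval s = some (decide (c.holds s)) := by
  induction c with
  | lt e f =>
    simp only [eval, holds, Expr.eval_eq h.1, Expr.eval_eq h.2, Option.bind_some]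
    congr
  | le e f =>
    simp only [eval, holds, Expr.eval_eq h.1, Expr.eval_eq h.2, Option.bind_some]
    congr
  | and c d hc hd =>
    simp only [eval, holds, hc h.1, hd h.2, Option.bind_some, Option.some.injEq]
    by_cases h1 : c.holds s <;> by_cases h2 : d.holds s <;> simp [h1, h2]

/-! ### Simplification rules for values, definedness and costs -/

section
variable (s : State) (e f : Expr) (c d : Test) (v : Var) (r : Arr)

@[simp] theorem val_var : (Expr.var v).val s = s.vars v := rfl
@[simp] theorem val_zero : (0 : Expr).val s = 0 := rfl
@[simp] theorem val_one : (1 : Expr).val s = 1 := rfl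
@[simp] theorem val_two : (2 : Expr).val s = 2 := rfl
@[simp] theorem val_three : (3 : Expr).val s = 3 := rfl
@[simp] theorem val_four : (4 : Expr).val s = 4 := rfl
@[simp] theorem val_six : (6 : Expr).val s = 6 := rfl
@[simp] theorem val_add : (e + f).val s = e.val s + f.val s := rfl
@[simp] theorem val_sub : (e - f).val s = e.val s - f.val s := rfl
@[simp] theorem val_mul : (e * f).val s = e.val s * f.val s := rfl
@[simp] theorem val_div : (e / f).val s = e.val s / f.val s := rfl
@[simp] theorem val_block : (block e f).val s = s.get .B (e.val s) (f.val s) := rfl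
@[simp] theorem val_head : (head e).val s = s.get .Heads (e.val s) 0 := rfl
@[simp] theorem val_len : (Expr.len r).val s = s.count r := rfl
@[simp] theorem val_ceiling :
    (ceiling e f).val s = (e.val s + f.val s - 1) / f.val s := rfl

@[simp] theorem ok_var : (Expr.var v).ok s := trivial
@[simp] theorem ok_zero : (0 : Expr).ok s := trivial
@[simp] theorem ok_one : (1 : Expr).ok s := trivial
@[simp] theorem ok_two : (2 : Expr).ok s := trivial
@[simp] theorem ok_three : (3 : Expr).ok s := trivial
@[simp] theorem ok_four : (4 : Expr).ok s := trivial
@[simp] theorem ok_six : (6 : Expr).ok s := trivial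
@[simp] theorem ok_add : (e + f).ok s ↔ e.ok s ∧ f.ok s := Iff.rfl
@[simp] theorem ok_sub : (e - f).ok s ↔ e.ok s ∧ f.ok s := Iff.rfl
@[simp] theorem ok_mul : (e * f).ok s ↔ e.ok s ∧ f.ok s := Iff.rfl
@[simp] theorem ok_div : (e / f).ok s ↔ e.ok s ∧ f.ok s := Iff.rfl
@[simp] theorem ok_block :
    (block e f).ok s ↔ e.ok s ∧ f.ok s ∧ f.val s < s.size .B (e.val s) := Iff.rfl
@[simp] theorem ok_head :
    (head e).ok s ↔ e.ok s ∧ 0 < s.size .Heads (e.val s) := by simp [head, Expr.ok]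
@[simp] theorem ok_len : (Expr.len r).ok s := trivial
@[simp] theorem ok_ceiling : (ceiling e f).ok s ↔ e.ok s ∧ f.ok s := by
  unfold ceiling
  simp only [ok_div, ok_sub, ok_add]
  tauto

@[simp] theorem cost_var : (Expr.var v).cost = 1 := rfl
@[simp] theorem cost_zero : (0 : Expr).cost = 1 := rfl
@[simp] theorem cost_one : (1 : Expr).cost = 1 := rfl
@[simp] theorem cost_two : (2 : Expr).cost = 1 := rfl
@[simp] theorem cost_three : (3 : Expr).cost = 1 := rfl
@[simp] theorem cost_four : (4 : Expr).cost = 1 := rfl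
@[simp] theorem cost_six : (6 : Expr).cost = 1 := rfl
@[simp] theorem cost_add : (e + f).cost = e.cost + f.cost + 1 := rfl
@[simp] theorem cost_sub : (e - f).cost = e.cost + f.cost + 1 := rfl
@[simp] theorem cost_mul : (e * f).cost = e.cost + f.cost + 1 := rfl
@[simp] theorem cost_div : (e / f).cost = e.cost + f.cost + 1 := rfl
@[simp] theorem cost_block : (block e f).cost = e.cost + f.cost + 1 := rfl
@[simp] theorem cost_head : (head e).cost = e.cost + 2 := rfl
@[simp] theorem cost_len : (Expr.len r).cost = 1 := rfl
@[simp] theorem cost_ceiling : (ceiling e f).cost = e.cost + 2 * f.cost + 4 := by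
  simp [ceiling]
  ring

@[simp] theorem holds_lt : (Test.lt e f).holds s ↔ e.val s < f.val s := Iff.rfl
@[simp] theorem holds_le : (Test.le e f).holds s ↔ e.val s ≤ f.val s := Iff.rfl
@[simp] theorem holds_and : (Test.and c d).holds s ↔ c.holds s ∧ d.holds s := Iff.rfl
@[simp] theorem ok_lt : (Test.lt e f).ok s ↔ e.ok s ∧ f.ok s := Iff.rfl
@[simp] theorem ok_le : (Test.le e f).ok s ↔ e.ok s ∧ f.ok s := Iff.rfl
@[simp] theorem ok_and : (Test.and c d).ok s ↔ c.ok s ∧ d.ok s := Iff.rfl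
@[simp] theorem cost_lt : (Test.lt e f).cost = e.cost + f.cost + 1 := rfl
@[simp] theorem cost_le : (Test.le e f).cost = e.cost + f.cost + 1 := rfl
@[simp] theorem cost_and : (Test.and c d).cost = c.cost + d.cost + 1 := rfl

end

/-! ### Runs within given limits -/

/-- Limits for the values of the scalars and for the number of bits of the arrays. -/
structure Limits : Type where
  scalar : ℕ
  array : ℕ

/-- A bound for the storage of the states within the limits. -/
def Limits.bits (M : Limits) : ℕ := 25 * Nat.size M.scalar + M.array

/-- The state is within the limits, and the contents of all cells fit into the cells. -/
structure Small (M : Limits) (s : State) : Prop where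
  vars_le (v : Var) : s.vars v ≤ M.scalar
  arrBits_le : s.arrBits ≤ M.array
  fits (r : Arr) (i k : ℕ) : Nat.size (s.get r i k) ≤ s.width r i

/-- Started in `s`, the program halts without an error in a state `s'` after `T` operations such
that `Q s' T`, and never leaves the limits `M`. -/
def Run (M : Limits) (p : Stmt) (s : State) (Q : State → ℕ → Prop) : Prop :=
  Small M s → ∃ s' T S, Exec p s s' T S ∧ S ≤ M.bits ∧ Small M s' ∧ Q s' T

variable {M : Limits} {s : State} {Q : State → ℕ → Prop} {p q : Stmt} {c : Test}

/-- The factor 25 in `Limits.bits` is the number of scalar variables. -/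
theorem Small.bits_le (h : Small M s) : s.bits ≤ M.bits := by
  refine Nat.add_le_add ?_ h.arrBits_le
  calc ∑ v, Nat.size (s.vars v) ≤ ∑ _v : Var, Nat.size M.scalar :=
        Finset.sum_le_sum fun v _ => Nat.size_le_size (h.vars_le v)
    _ = 25 * Nat.size M.scalar := by
        rw [Finset.sum_const, smul_eq_mul]
        rfl

theorem Small.set {v : Var} {x : ℕ} (h : Small M s) (hx : x ≤ M.scalar) : Small M (s.set v x) where
  vars_le w := by
    rw [State.vars_set]
    split_ifs
    exacts [hx, h.vars_le w]
  arrBits_le := h.arrBits_le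
  fits := h.fits

theorem Small.put {r : Arr} {i k x : ℕ} (h : Small M s) (hk : k < s.size r i)
    (hx : Nat.size x ≤ s.width r i) : Small M (s.put r i k x) where
  vars_le := h.vars_le
  arrBits_le := by simpa using h.arrBits_le
  fits r' i' k' := by
    rw [State.get_put hk, State.width_put]
    split_ifs with h'
    · rw [h'.1, h'.2.1]
      exact hx
    · exact h.fits _ _ _

theorem Small.append {r : Arr} {k x : ℕ} (h : Small M s)
    (hx : s.arrBits + k * Nat.size x ≤ M.array) : Small M (s.append r k x) where
  vars_le := h.vars_le
  arrBits_le := by rwa [State.arrBits_append]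
  fits r' i' k' := by
    rw [State.get_append, State.width_append]
    split_ifs <;> simp [h.fits]

theorem Small.print {x : ℕ} (h : Small M s) : Small M (s.print x) where
  vars_le := h.vars_le
  arrBits_le := h.arrBits_le
  fits := h.fits

/-- Makes the invariant `Small` of the initial state available while a run is being constructed. -/
theorem Run.of_small (h : Small M s → Run M p s Q) : Run M p s Q := fun hs => h hs hs

theorem Run.mono {Q' : State → ℕ → Prop} (h : Run M p s Q')
    (hQ : ∀ s' t, Small M s' → Q' s' t → Q s' t) : Run M p s Q := by
  intro hs
  obtain ⟨s', T, S, h1, h2, h3, h4⟩ := h hs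
  exact ⟨s', T, S, h1, h2, h3, hQ _ _ h3 h4⟩

theorem Run.skip (h : Q s 1) : Run M .skip s Q := fun hs =>
  ⟨s, 1, _, .skip s, hs.bits_le, hs, h⟩

theorem Run.assign {v : Var} {e : Expr} (he : e.ok s) (hx : e.val s ≤ M.scalar)
    (h : Q (s.set v (e.val s)) (e.cost + 1)) : Run M (.assign v e) s Q := fun hs =>
  ⟨_, _, _, .assign (Expr.eval_eq he), max_le hs.bits_le (hs.set hx).bits_le, hs.set hx, h⟩

theorem Run.write {r : Arr} {ei ek e : Expr} (hi : ei.ok s) (hk : ek.ok s) (he : e.ok s)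
    (hlt : ek.val s < s.size r (ei.val s)) (hx : Nat.size (e.val s) ≤ s.width r (ei.val s))
    (h : Q (s.put r (ei.val s) (ek.val s) (e.val s)) (ei.cost + ek.cost + e.cost + 1)) :
    Run M (.write r ei ek e) s Q := fun hs =>
  ⟨_, _, _, .write (Expr.eval_eq hi) (Expr.eval_eq hk) (Expr.eval_eq he) (State.write_eq hlt hx),
    max_le hs.bits_le (hs.put hlt hx).bits_le, hs.put hlt hx, h⟩

theorem Run.append {r : Arr} {el e : Expr} (hl : el.ok s) (he : e.ok s)
    (hx : s.arrBits + el.val s * Nat.size (e.val s) ≤ M.array)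
    (h : Q (s.append r (el.val s) (e.val s)) (el.cost + e.cost + el.val s + 1)) :
    Run M (.append r el e) s Q := fun hs =>
  ⟨_, _, _, .append (Expr.eval_eq hl) (Expr.eval_eq he),
    max_le hs.bits_le (hs.append hx).bits_le, hs.append hx, h⟩

theorem Run.print {e : Expr} (he : e.ok s) (h : Q (s.print (e.val s)) (e.cost + 1)) :
    Run M (.print e) s Q := fun hs =>
  ⟨_, _, _, .print (Expr.eval_eq he), hs.bits_le, hs.print, h⟩

/-- The run of q is the postcondition of the run of p, so a program is verified by walking through
it from front to back with the times adding up. -/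
theorem Run.seq (h : Run M p s fun s' t => Run M q s' fun s'' t' => Q s'' (t + t')) :
    Run M (.seq p q) s Q := by
  intro hs
  obtain ⟨s', T, S, h1, h2, h3, h4⟩ := h hs
  obtain ⟨s'', T', S', h1', h2', h3', h4'⟩ := h4 h3
  exact ⟨s'', _, _, .seq h1 h1', max_le h2 h2', h3', h4'⟩

theorem Run.ite (hc : c.ok s) (hp : c.holds s → Run M p s fun s' t => Q s' (c.cost + t))
    (hq : ¬ c.holds s → Run M q s fun s' t => Q s' (c.cost + t)) : Run M (.ite c p q) s Q := by
  intro hs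
  by_cases h : c.holds s
  · obtain ⟨s', T, S, h1, h2, h3, h4⟩ := hp h hs
    exact ⟨s', _, _, .iteTrue (by simp [Test.eval_eq hc, h]) h1, h2, h3, h4⟩
  · obtain ⟨s', T, S, h1, h2, h3, h4⟩ := hq h hs
    exact ⟨s', _, _, .iteFalse (by simp [Test.eval_eq hc, h]) h1, h2, h3, h4⟩

/-- A loop with an invariant `I` that involves the elapsed time, and a decreasing measure. -/
theorem Run.while (I : State → ℕ → Prop) (μ : State → ℕ) (h0 : I s 0)
    (h : ∀ s t, Small M s → I s t → c.ok s ∧ (¬ c.holds s → Q s (t + c.cost)) ∧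
      (c.holds s → Run M p s fun s' t' => I s' (t + c.cost + t') ∧ μ s' < μ s)) :
    Run M (.while c p) s Q := by
  -- The time t already elapsed has to be generalised, since the invariant refers to the total time
  -- since the loop was entered.
  have key : ∀ n s t, μ s ≤ n → I s t → Run M (.while c p) s fun s' t' => Q s' (t + t') := by
    intro n
    induction n with
    | zero =>
      intro s t hn hI hs
      obtain ⟨hc, hf, ht⟩ := h s t hs hI
      by_cases hh : c.holds s
      · obtain ⟨_, _, _, -, -, -, -, hlt⟩ := ht hh hs
        omega
      · exact ⟨s, _, _, .whileFalse (by simp [Test.eval_eq hc, hh]), hs.bits_le, hs, hf hh⟩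
    | succ n ih =>
      intro s t hn hI hs
      obtain ⟨hc, hf, ht⟩ := h s t hs hI
      by_cases hh : c.holds s
      · obtain ⟨s', T, S, h1, h2, h3, h4, hlt⟩ := ht hh hs
        obtain ⟨s'', T', S', h1', h2', h3', h4'⟩ := ih s' _ (by omega) h4 h3
        refine ⟨s'', _, _, .whileTrue (by simp [Test.eval_eq hc, hh]) h1 h1', max_le h2 h2', h3', ?_⟩
        simpa only [add_assoc] using h4'
      · exact ⟨s, _, _, .whileFalse (by simp [Test.eval_eq hc, hh]), hs.bits_le, hs, hf hh⟩
  exact (key _ s 0 le_rfl h0).mono fun s' t _ h => by simpa using h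

/-! ### Rules for lists of statements and counting loops -/

theorem Run.nil (h : Q s 1) : Run M (prog []) s Q := Run.skip h

theorem Run.cons {ps : List Stmt}
    (h : Run M p s fun s' t => Run M (prog ps) s' fun s'' t' => Q s'' (t + t')) :
    Run M (prog (p :: ps)) s Q := Run.seq h

theorem Run.ifThen {ps : List Stmt} (hc : c.ok s)
    (hp : c.holds s → Run M (prog ps) s fun s' t => Q s' (c.cost + t))
    (hq : ¬ c.holds s → Q s (c.cost + 1)) : Run M (ifThen c ps) s Q :=
  Run.ite hc hp fun h => Run.skip (hq h)

/-- Each list ends with a `skip`. Joining two lists drops the one in the middle, so the times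
satisfy an inequality rather than an equality. -/
theorem Exec.concat {ps qs : List Stmt} {s' s'' : State} {T T' S S' : ℕ}
    (h : Exec (prog ps) s s' T S) (h' : Exec (prog qs) s' s'' T' S') :
    ∃ T'' S'', Exec (prog (ps ++ qs)) s s'' T'' S'' ∧ T'' ≤ T + T' ∧ S'' ≤ max S S' := by
  induction ps generalizing s T S with
  | nil =>
    cases h
    exact ⟨T', S', h', by omega, le_max_right _ _⟩
  | cons p ps ih =>
    cases h with
    | seq hp hps =>
      obtain ⟨T'', S'', h1, h2, h3⟩ := ih hps
      exact ⟨_, _, .seq hp h1, by omega, by omega⟩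

theorem Run.concat {ps qs : List Stmt}
    (h : Run M (prog ps) s fun s' t => Run M (prog qs) s' fun s'' t' => ∀ t'' ≤ t + t', Q s'' t'') :
    Run M (prog (ps ++ qs)) s Q := by
  intro hs
  obtain ⟨s', T, S, h1, h2, h3, h4⟩ := h hs
  obtain ⟨s'', T', S', h1', h2', h3', h4'⟩ := h4 h3
  obtain ⟨T'', S'', h5, h6, h7⟩ := h1.concat h1'
  exact ⟨s'', T'', S'', h5, h7.trans (max_le h2 h2'), h3', h4' _ h6⟩

/-- A loop over `v = l, …, hi - 1` with an invariant and a bound for the time of each step. -/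
theorem Run.forUp {v : Var} {lo : Expr} {body : List Stmt} (I : ℕ → State → Prop) (cost : ℕ → ℕ)
    (l hi : ℕ) (hlo : lo.ok s) (hl : lo.val s = l) (hle : l ≤ hi) (hhi : hi ≤ M.scalar)
    (hI : I l (s.set v l))
    (htest : ∀ i s, l ≤ i → i ≤ hi → I i s → s.vars v = i → c.ok s ∧ (c.holds s ↔ i < hi))
    (hbody : ∀ i s, l ≤ i → i < hi → I i s → s.vars v = i → Run M (prog body) s fun s' t =>
      s'.vars v = i ∧ I (i + 1) (s'.set v (i + 1)) ∧ t ≤ cost i)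
    (hQ : ∀ s' t, I hi s' → s'.vars v = hi →
      t ≤ lo.cost + c.cost + 2 + ∑ i ∈ Finset.Ico l hi, (cost i + c.cost + 5) → Q s' t) :
    Run M (forUp v lo c body) s Q := by
  refine Run.cons (Run.assign hlo (hl ▸ hle.trans hhi) (Run.cons ?_))
  rw [hl]
  refine Run.while (fun s t => l ≤ s.vars v ∧ s.vars v ≤ hi ∧ I (s.vars v) s ∧
    t ≤ ∑ i ∈ Finset.Ico l (s.vars v), (cost i + c.cost + 5)) (fun s => hi - s.vars v) ?_ ?_
  · simpa [hle] using hI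
  · rintro s t - ⟨h1, h2, h3, h4⟩
    obtain ⟨hc, hiff⟩ := htest _ s h1 h2 h3 rfl
    refine ⟨hc, fun h => ?_, fun h => ?_⟩
    · have heq : s.vars v = hi := by
        rw [hiff] at h
        omega
      refine Run.nil (hQ _ _ (heq ▸ h3) heq ?_)
      rw [heq] at h4
      omega
    · have hlt := hiff.1 h
      refine Run.concat ((hbody _ s h1 hlt h3 rfl).mono fun s' t' _ h5 => ?_)
      obtain ⟨h5, h6, h7⟩ := h5
      -- The increment takes 4 operations and the closing `skip` takes 1; this is the 5 in the
      -- bound.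
      refine Run.cons (Run.assign (by simp) ?_ (Run.nil fun t'' ht'' => ?_))
      · simp only [val_add, val_var, val_one]
        omega
      · simp only [val_add, val_var, val_one, h5, State.vars_set, if_true]
        refine ⟨⟨by omega, by omega, h6, ?_⟩, by omega⟩
        rw [Finset.sum_Ico_succ_top h1]
        simp only [cost_add, cost_var, cost_one] at ht''
        omega

/-! ### Scalar subroutines -/

/-- The loop preserves res · E(x) = E(k), since E(x) = 3 E(x - 3) for x > 4; it stops with 1 ≤ x ≤
4, where E(x) = x. -/
theorem Run.codeE {arg : Expr} {res : Var} {k : ℕ} (hres : res ≠ .x) (hok : arg.ok s)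
    (hk : arg.val s = k) (hle : k ≤ M.scalar) (hmax : maxValue k ≤ M.scalar) :
    Run M (codeE arg res) s fun s' t => s'.arrs = s.arrs ∧ s'.out = s.out ∧
      s'.vars res = maxValue k ∧ (∀ v, v ≠ res → v ≠ .x → s'.vars v = s.vars v) ∧
      t ≤ arg.cost + 20 * k + 20 := by
  have h1 : 1 ≤ M.scalar := (maxValue_pos k).trans_le hmax
  refine Run.cons (Run.assign hok (hk ▸ hle) (Run.cons (Run.ite (by simp) ?_ ?_)))
  · intro h
    have hk0 : k = 0 := by simpa [hk] using h
    subst hk0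
    refine Run.assign (by simp) (by simpa using h1) (Run.nil ?_)
    simp +contextual [maxValue]
  · intro h
    have hk0 : 0 < k := by simpa [hk, Nat.pos_iff_ne_zero] using h
    refine Run.cons (Run.assign (by simp) (by simpa using h1) (Run.cons ?_))
    refine Run.while (fun s' t => s'.arrs = s.arrs ∧ s'.out = s.out ∧ 0 < s'.vars .x ∧
      s'.vars .x ≤ k ∧ s'.vars res * maxValue (s'.vars .x) = maxValue k ∧
      (∀ v, v ≠ res → v ≠ .x → s'.vars v = s.vars v) ∧ t + 20 * s'.vars .x ≤ 20 * k)
      (fun s' => s'.vars .x) ?_ ?_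
    · simp +contextual [hk, hk0, hres.symm]
    · rintro s' t - ⟨ha, ho, hx0, hxk, hm, hv, ht⟩
      refine ⟨by simp, fun hc => ?_, fun hc => ?_⟩
      · have hx : s'.vars .x ≤ 4 := by simpa using hc
        have hmx : maxValue (s'.vars .x) = s'.vars .x := by
          generalize s'.vars .x = y at hx0 hx
          interval_cases y <;> rfl
        rw [hmx] at hm
        refine Run.cons (Run.assign (by simp) (by simpa [hm] using hmax) (Run.nil (Run.nil ?_)))
        simp +contextual [ha, ho, hm, hv]
        omega
      · have hx : 4 < s'.vars .x := by simpa using hc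
        have hmx : maxValue (s'.vars .x) = 3 * maxValue (s'.vars .x - 3) := by
          rw [← maxValue_add_three (by omega), Nat.sub_add_cancel (by omega)]
        have hm' : s'.vars res * 3 * maxValue (s'.vars .x - 3) = maxValue k := by
          rw [← hm, hmx]
          ring
        refine Run.cons (Run.assign (by simp) ?_ (Run.cons (Run.assign (by simp) ?_ (Run.nil ?_))))
        · simp only [val_mul, val_var, val_three]
          exact (Nat.le_mul_of_pos_right _ (maxValue_pos _)).trans (hm'.le.trans hmax)
        · simp [hres.symm]
          omega
        · simp +contextual [ha, ho, hres, hres.symm, hm', hv]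
          omega

/-- The scalars that are changed by the computation of `kMax`. -/
def kMaxVars : List Var := [.x, .e₁, .e₂, .t, .kMax]

/-- At most S/2 steps are made, each evaluating E twice in linear time, hence a quadratic bound. The
hypothesis n ≤ E(S) + 1 makes the search succeed at t = 0 at the latest, because E(0) = 1. -/
theorem Run.codeKMax {n S : ℕ} (hn : s.vars .n = n) (hS : s.vars .target = S)
    (hle : n ≤ maxValue S + 1) (hSM : S ≤ M.scalar) (hmax : maxValue S ≤ M.scalar) :
    Run M codeKMax s fun s' t => s'.arrs = s.arrs ∧ s'.out = s.out ∧
      (∃ u, IsCut n S u ∧ s'.vars .kMax = maxValue u) ∧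
      (∀ v, v ∉ kMaxVars → s'.vars v = s.vars v) ∧ t ≤ 100 * (S + 1) ^ 2 := by
  have hE : ∀ i ≤ S, maxValue i ≤ M.scalar := fun i hi => (maxValue_mono hi).trans hmax
  refine Run.cons (Run.assign (by simp) ?_ (Run.cons ?_))
  · simp [hS]
    omega
  refine (Run.codeE (k := S / 2) (by decide) (by simp) (by simp [hS]) (by omega)
    (hE _ (by omega))).mono ?_
  rintro s₁ t₁ - ⟨ha₁, ho₁, he₁, hv₁, ht₁⟩
  refine Run.cons ((Run.codeE (k := S - S / 2) (by decide) (by simp)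
    (by simp [hS, hv₁]) (by omega) (hE _ (by omega))).mono ?_)
  rintro s₂ t₂ - ⟨ha₂, ho₂, he₂, hv₂, ht₂⟩
  refine Run.cons (Run.while (fun s' t => s'.arrs = s.arrs ∧ s'.out = s.out ∧
    s'.vars .t ≤ S / 2 ∧ s'.vars .e₁ = maxValue (s'.vars .t) ∧
    s'.vars .e₂ = maxValue (S - s'.vars .t) ∧
    (∀ u, s'.vars .t < u → u ≤ S / 2 → maxValue u + maxValue (S - u) < n) ∧
    (∀ v, v ∉ kMaxVars → s'.vars v = s.vars v) ∧
    t + s'.vars .t * (40 * S + 80) ≤ S / 2 * (40 * S + 80)) (fun s' => s'.vars .t) ?_ ?_)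
  · refine ⟨by simp [ha₂, ha₁], by simp [ho₂, ho₁], ?_, ?_, ?_, ?_, ?_, ?_⟩
    · simp [hv₂, hv₁, hS]
    · simp [hv₂, hv₁, hS, he₁]
    · simp [hv₂, hv₁, hS, he₂]
    · intro u h1 h2
      simp [hv₂, hv₁, hS] at h1
      omega
    · intro v hv
      simp only [kMaxVars, List.mem_cons, List.not_mem_nil, not_or] at hv
      rw [hv₂ v hv.2.2.1 hv.1, hv₁ v hv.2.1 hv.1]
      simp [hv]
    · simp [hv₂, hv₁, hS]
  · rintro s' t - ⟨ha, ho, hth, h1, h2, hgt, hv, ht⟩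
    have hn' : s'.vars .n = n := by rw [hv _ (by decide), hn]
    have hS' : s'.vars .target = S := by rw [hv _ (by decide), hS]
    refine ⟨by simp, fun hc => ?_, fun hc => ?_⟩
    · simp only [holds_lt, val_add, val_var, h1, h2, hn', not_lt] at hc
      refine Run.cons (Run.assign (by simp) ?_ (Run.nil ?_))
      · simpa [h1] using hE _ (by omega)
      · refine ⟨by simp [ha], by simp [ho], ⟨_, ⟨hth, hc, hgt⟩, by simp [h1]⟩, fun v hv' => ?_, ?_⟩
        · have : v ≠ .kMax := by rintro rfl; exact hv' (by decide)
          simp [this, hv v hv']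
        · simp only [cost_var, cost_lt, cost_add, cost_sub, cost_div, cost_two] at *
          have h3 : S / 2 * (40 * S + 80) ≤ S * (20 * S + 40) := by
            rw [show 40 * S + 80 = 2 * (20 * S + 40) by ring, ← mul_assoc]
            exact Nat.mul_le_mul_right _ (by omega)
          have h4 : S * (20 * S + 40) = 20 * (S * S) + 40 * S := by ring
          have h5 : 100 * (S + 1) ^ 2 = 100 * (S * S) + 200 * S + 100 := by ring
          omega
    · simp only [holds_lt, val_add, val_var, h1, h2, hn'] at hc
      -- At t = 0 the loop test would read 1 + E(S) < n.
      have htpos : 0 < s'.vars .t := by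
        rw [Nat.pos_iff_ne_zero]
        intro h
        rw [h, Nat.sub_zero, maxValue] at hc
        omega
      refine Run.cons (Run.assign (by simp) ?_ (Run.cons ?_))
      · simp
        omega
      refine (Run.codeE (k := s'.vars .t - 1) (by decide) (by simp) (by simp) (by omega)
        (hE _ (by omega))).mono ?_
      rintro s₃ t₃ - ⟨ha₃, ho₃, he₃, hv₃, ht₃⟩
      refine Run.cons ((Run.codeE (k := S - (s'.vars .t - 1)) (by decide) (by simp)
        (by simp [hS', hv₃]) (by omega) (hE _ (by omega))).mono ?_)
      rintro s₄ t₄ - ⟨ha₄, ho₄, he₄, hv₄, ht₄⟩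
      have ht' : s₄.vars .t = s'.vars .t - 1 := by simp [hv₄, hv₃]
      refine Run.nil ⟨⟨by simp [ha₄, ha₃, ha], by simp [ho₄, ho₃, ho], ?_, ?_, ?_, ?_, ?_, ?_⟩, ?_⟩
      · omega
      · simp [ht', hv₄, he₃]
      · simp [ht', he₄]
      · intro u hu1 hu2
        rcases Nat.lt_or_ge (s'.vars .t) u with h | h
        · exact hgt u h hu2
        · obtain rfl : u = s'.vars .t := by omega
          exact hc
      · intro v hv'
        have hv'' := hv'
        simp only [kMaxVars, List.mem_cons, List.not_mem_nil, not_or] at hv''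
        rw [hv₄ v hv''.2.2.1 hv''.1, hv₃ v hv''.2.1 hv''.1]
        simp [hv'', hv v hv']
      · rw [ht']
        obtain ⟨u, hu⟩ : ∃ u, s'.vars .t = u + 1 := ⟨_, (Nat.sub_add_cancel htpos).symm⟩
        rw [hu] at ht ht₃ ht₄ hth ⊢
        simp only [cost_var, cost_lt, cost_add, cost_sub, cost_one, Nat.add_sub_cancel] at *
        have h5 : (u + 1) * (40 * S + 80) = u * (40 * S + 80) + (40 * S + 80) := by ring
        rw [h5] at ht
        have : S - u ≤ S := Nat.sub_le _ _
        omega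
      · omega

theorem size_eq_size_half_add_one {x : ℕ} (hx : 0 < x) : Nat.size x = Nat.size (x / 2) + 1 := by
  refine le_antisymm (Nat.size_le.2 ?_) ?_
  · have := Nat.lt_size_self (x / 2)
    rw [pow_succ]
    omega
  · refine Nat.lt_size.2 ?_
    rcases Nat.eq_zero_or_pos (x / 2) with h | h
    · simp [h]
      omega
    · have : 2 ^ (Nat.size (x / 2) - 1) ≤ x / 2 :=
        Nat.lt_size.1 (Nat.sub_lt (Nat.size_pos.2 h) Nat.one_pos)
      obtain ⟨u, hu⟩ : ∃ u, Nat.size (x / 2) = u + 1 :=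
        ⟨_, (Nat.sub_add_cancel (Nat.size_pos.2 h)).symm⟩
      rw [hu, Nat.add_sub_cancel] at this
      rw [hu, pow_succ]
      omega

/-- The counter plus the number of binary digits of x is constant, as halving removes one digit. -/
theorem Run.codeCMax {arg : Expr} {k : ℕ} (hok : arg.ok s) (hk : arg.val s = k)
    (hle : k ^ 3 ≤ M.scalar) :
    Run M (codeCMax arg) s fun s' t => s'.arrs = s.arrs ∧ s'.out = s.out ∧
      s'.vars .cMax = Nat.size (k ^ 3) ∧ (∀ v, v ≠ .cMax → v ≠ .x → s'.vars v = s.vars v) ∧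
      t ≤ 3 * arg.cost + 20 * Nat.size (k ^ 3) + 20 := by
  have hsz : Nat.size (k ^ 3) ≤ M.scalar := (Nat.size_le.2 Nat.lt_two_pow_self).trans hle
  refine Run.cons (Run.assign (by simpa using hok) ?_ (Run.cons (Run.assign (by simp)
    (by simp) (Run.cons ?_))))
  · simp only [val_mul, hk]
    exact (by ring : k * k * k = k ^ 3).trans_le hle
  refine Run.while (fun s' t => s'.arrs = s.arrs ∧ s'.out = s.out ∧ s'.vars .x ≤ k ^ 3 ∧
    s'.vars .cMax + Nat.size (s'.vars .x) = Nat.size (k ^ 3) ∧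
    (∀ v, v ≠ .cMax → v ≠ .x → s'.vars v = s.vars v) ∧ t ≤ 20 * s'.vars .cMax)
    (fun s' => s'.vars .x) ?_ ?_
  · simp +contextual [hk, show k * k * k = k ^ 3 by ring]
  · rintro s' t - ⟨ha, ho, hx, hm, hv, ht⟩
    refine ⟨by simp, fun hc => ?_, fun hc => ?_⟩
    · have hx0 : s'.vars .x = 0 := by simpa using hc
      refine Run.nil ⟨ha, ho, by simpa [hx0] using hm, hv, ?_⟩
      simp [hx0] at hm ⊢
      omega
    · have hx0 : 0 < s'.vars .x := by simpa using hc
      have := size_eq_size_half_add_one hx0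
      refine Run.cons (Run.assign (by simp) ?_ (Run.cons (Run.assign (by simp) ?_ (Run.nil ?_))))
      · simp
        omega
      · simp
        omega
      · simp +contextual [ha, ho, hv]
        omega

/-! ### Improving an entry -/

/-- Replace the entry `k` of `B[i]` by `x` if `x` is smaller. -/
def State.improve (s : State) (i k x : ℕ) : State :=
  if x < s.get .B i k then s.put .B i k x else s

namespace State

variable {i k x : ℕ}

@[simp] theorem vars_improve : (s.improve i k x).vars = s.vars := by
  unfold improve; split_ifs <;> simp

@[simp] theorem out_improve : (s.improve i k x).out = s.out := by
  unfold improve; split_ifs <;> simp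

@[simp] theorem size_improve : (s.improve i k x).size = s.size := by
  funext r' i'; unfold improve; split_ifs <;> simp

@[simp] theorem width_improve : (s.improve i k x).width = s.width := by
  funext r' i'; unfold improve; split_ifs <;> simp

@[simp] theorem count_improve : (s.improve i k x).count = s.count := by
  funext r'; unfold improve; split_ifs <;> simp

theorem get_improve {r' : Arr} {i' k' : ℕ} (h : k < s.size .B i) : (s.improve i k x).get r' i' k' =
    if r' = .B ∧ i' = i ∧ k' = k then min x (s.get .B i k) else s.get r' i' k' := by
  unfold improve
  split_ifs with h1 h2 h2
  · rw [get_put h, if_pos h2, min_eq_left h1.le]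
  · rw [get_put h, if_neg h2]
  · rw [h2.1, h2.2.1, h2.2.2, min_eq_right (not_lt.1 h1)]
  · rfl

end State

/-- No hypothesis on the cell width is needed: a value is written only if it is smaller than the old
content, which fits by `Small`. -/
theorem Run.improve {e f : Expr} (he : e.ok s) (hf : f.ok s)
    (hlt : f.val s < s.size .B (e.val s))
    (h : ∀ t ≤ 2 * (e.cost + f.cost) + 10, Q (s.improve (e.val s) (f.val s) (s.vars .val)) t) :
    Run M (improve e f) s Q := by
  refine Run.of_small fun hs => Run.ifThen (by simp [he, hf, hlt]) (fun hc => ?_) fun hc => ?_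
  · simp only [holds_lt, val_var, val_block] at hc
    refine Run.cons (Run.write he hf (by simp) hlt ?_ (Run.nil ?_))
    · exact (Nat.size_le_size hc.le).trans (hs.fits _ _ _)
    · rw [State.improve, if_pos hc] at h
      refine h _ ?_
      simp
      omega
  · simp only [holds_lt, val_var, val_block] at hc
    rw [State.improve, if_neg hc] at h
    refine h _ ?_
    simp
    omega

/-! ### What a program changes -/

/-- Only the scalars in `vs` and the entries of the blocks in `cells` differ. -/
structure Changes (vs : List Var) (cells : ℕ → ℕ → Prop) (s s' : State) : Prop where
  vars : ∀ v, v ∉ vs → s'.vars v = s.vars v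
  size : s'.size = s.size
  width : s'.width = s.width
  count : s'.count = s.count
  out : s'.out = s.out
  get : ∀ r i k, ¬ (r = .B ∧ cells i k) → s'.get r i k = s.get r i k

namespace Changes

variable {vs vs' : List Var} {cells cells' : ℕ → ℕ → Prop} {s' s'' : State}

theorem refl : Changes vs cells s s :=
  ⟨fun _ _ => rfl, rfl, rfl, rfl, rfl, fun _ _ _ _ => rfl⟩

theorem mono (h : Changes vs cells s s') (hvs : vs ⊆ vs') (hc : ∀ i k, cells i k → cells' i k) :
    Changes vs' cells' s s' :=
  ⟨fun v hv => h.vars v fun hv' => hv (hvs hv'), h.size, h.width, h.count, h.out,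
    fun r i k hn => h.get r i k fun hh => hn ⟨hh.1, hc _ _ hh.2⟩⟩

theorem trans (h : Changes vs cells s s') (h' : Changes vs cells s' s'') :
    Changes vs cells s s'' :=
  ⟨fun v hv => (h'.vars v hv).trans (h.vars v hv), h'.size.trans h.size, h'.width.trans h.width,
    h'.count.trans h.count, h'.out.trans h.out,
    fun r i k hn => (h'.get r i k hn).trans (h.get r i k hn)⟩

theorem set (h : Changes vs cells s s') {v : Var} {x : ℕ} (hv : v ∈ vs) :
    Changes vs cells s (s'.set v x) where
  vars w hw := by
    rw [State.vars_set, if_neg (by rintro rfl; exact hw hv), h.vars w hw]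
  size := h.size
  width := h.width
  count := h.count
  out := h.out
  get := h.get

theorem improve (h : Changes vs cells s s') {i k x : ℕ} (hk : k < s'.size .B i) (hc : cells i k) :
    Changes vs cells s (s'.improve i k x) where
  vars w hw := by rw [State.vars_improve, h.vars w hw]
  size := by rw [State.size_improve, h.size]
  width := by rw [State.width_improve, h.width]
  count := by rw [State.count_improve, h.count]
  out := by rw [State.out_improve, h.out]
  get r' i' k' hn := by
    rw [State.get_improve hk, if_neg, h.get _ _ _ hn]
    rintro ⟨rfl, rfl, rfl⟩
    exact hn ⟨rfl, hc⟩

theorem put (h : Changes vs cells s s') {i k x : ℕ} (hk : k < s'.size .B i) (hc : cells i k) :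
    Changes vs cells s (s'.put .B i k x) where
  vars w hw := by rw [State.vars_put, h.vars w hw]
  size := by funext; rw [State.size_put, h.size]
  width := by funext; rw [State.width_put, h.width]
  count := by funext; rw [State.count_put, h.count]
  out := by rw [State.out_put, h.out]
  get r' i' k' hn := by
    rw [State.get_put hk, if_neg, h.get _ _ _ hn]
    rintro ⟨rfl, rfl, rfl⟩
    exact hn ⟨rfl, hc⟩

theorem of_arrs (ha : s'.arrs = s.arrs) (ho : s'.out = s.out)
    (hv : ∀ v, v ∉ vs → s'.vars v = s.vars v) : Changes vs cells s s' :=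
  ⟨hv, State.size_eq_of_arrs_eq ha, State.width_eq_of_arrs_eq ha, State.count_eq_of_arrs_eq ha, ho,
    fun r i k _ => by rw [State.get_eq_of_arrs_eq ha]⟩

end Changes

/-! ### The loop over the sums -/

/-- An upper bound for the number of summands that are tested for `n`. -/
noncomputable def summandBound (n : ℕ) : ℕ := ⌊3 * ratio (n - 1)⌋₊

/-- The search bound S is controlled through ‖n - 1‖ + 1, so the ratio is taken at n - 1. The factor
3 comes from 8 · 3^(‖n - 1‖ + 1) ≤ 27 · 3^‖n - 1‖ after taking cube roots. -/
theorem IsCut.le_summandBound {n S u : ℕ} (h : IsCut n S u) (hn : 2 ≤ n)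
    (hS : S ≤ complexity (n - 1) + 1) : maxValue u ≤ summandBound n := by
  have hn1 : (0 : ℝ) < ((n - 1 : ℕ) : ℝ) := by exact_mod_cast (by omega : 0 < n - 1)
  rw [summandBound, Nat.le_floor_iff (mul_nonneg (by norm_num) (ratio_nonneg _)),
    ratio_of_pos (by omega), ← mul_div_assoc, le_div_iff₀ hn1]
  refine le_of_pow_le_pow_left₀ (n := 3) (by norm_num) (by positivity) ?_
  rw [mul_pow 3, ← Real.rpow_natCast (3 ^ _), ← Real.rpow_mul (by norm_num),
    show (complexity (n - 1) : ℝ) / 3 * (3 : ℕ) = (complexity (n - 1) : ℝ) by push_cast; ring,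
    Real.rpow_natCast]
  have h1 : (maxValue u * (n - 1)) ^ 3 ≤ 27 * 3 ^ complexity (n - 1) := by
    calc (maxValue u * (n - 1)) ^ 3 ≤ (maxValue u * n) ^ 3 :=
          Nat.pow_le_pow_left (Nat.mul_le_mul_left _ (by omega)) 3
      _ ≤ 8 * 3 ^ S := h.mul_pow_le
      _ ≤ 8 * 3 ^ (complexity (n - 1) + 1) :=
          Nat.mul_le_mul_left _ (Nat.pow_le_pow_right (by norm_num) hS)
      _ ≤ 27 * 3 ^ complexity (n - 1) := by
          rw [pow_succ]
          omega
  have h2 : ((maxValue u * (n - 1) : ℕ) : ℝ) ^ 3 ≤ 27 * 3 ^ complexity (n - 1) := by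
    exact_mod_cast h1
  push_cast at h2
  norm_num at h2 ⊢
  exact h2

/-- The loop over the sums `m + (n - m)`, `6 ≤ m ≤ kMax`. The entry `q` of the block `jb` belongs to
`n`, and the entry `f m` belongs to `n - m`. -/
theorem Run.sumLoop {eb ei ej : Expr} {jb q n K : ℕ} {f : ℕ → ℕ}
    (hK : s.vars .kMax = K) (hKn : K < n) (hnM : n + 6 ≤ M.scalar)
    (he : ∀ s', (∀ v, v ∉ [Var.val, Var.m] → s'.vars v = s.vars v) → eb.ok s' ∧ ei.ok s' ∧ ej.ok s' ∧
      eb.val s' = jb ∧ ej.val s' = q ∧ ei.val s' = f (s'.vars .m))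
    (hq : q < s.size .B jb)
    (hm : ∀ m, 6 ≤ m → m ≤ K → m < s.size .B 0 ∧ f m < s.size .B jb ∧ f m ≠ q ∧ (jb = 0 → m ≠ q) ∧
      s.get .B 0 m = complexity m ∧ s.get .B jb (f m) = complexity (n - m))
    (hlow : complexity n ≤ s.get .B jb q) :
    Run M (Fuller.forUp .m 6 (.le Var.m Var.kMax) [
        .assign .val (block 0 Var.m + block eb ei),
        Fuller.improve eb ej]) s fun s' t =>
      Changes [.val, .m] (fun i k => i = jb ∧ k = q) s s' ∧ complexity n ≤ s'.get .B jb q ∧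
      s'.get .B jb q ≤ s.get .B jb q ∧
      (∀ m, 6 ≤ m → m ≤ K → s'.get .B jb q ≤ complexity m + complexity (n - m)) ∧
      t ≤ 10 + (3 * eb.cost + ei.cost + 2 * ej.cost + 30) * K := by
  refine Run.forUp (fun i s' => Changes [.val, .m] (fun i k => i = jb ∧ k = q) s s' ∧
      complexity n ≤ s'.get .B jb q ∧ s'.get .B jb q ≤ s.get .B jb q ∧
      (∀ m, 6 ≤ m → m < i → s'.get .B jb q ≤ complexity m + complexity (n - m)))
    -- For K < 6 the loop is empty and ends with m = 6, hence the maximum.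
    (fun _ => 3 * eb.cost + ei.cost + 2 * ej.cost + 20) 6 (max 6 (K + 1)) (by simp) (by simp)
    (by simp) (by omega) ?_ ?_ ?_ ?_
  · refine ⟨Changes.refl.set (by simp), hlow, le_rfl, fun m h1 h2 => by omega⟩
  · rintro i s' h1 h2 ⟨hch, -⟩ hi
    have : s'.vars .kMax = K := by rw [hch.vars _ (by simp), hK]
    refine ⟨by simp, ?_⟩
    simp only [holds_le, val_var, hi, this]
    omega
  · rintro i s' h1 h2 ⟨hch, hlow', hup, hall⟩ hi
    have hiK : i ≤ K := by omega
    obtain ⟨hm1, hm2, hm3, hm4, hm5, hm6⟩ := hm i h1 hiK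
    obtain ⟨o1, o2, o3, v1, v2, v3⟩ := he s' hch.vars
    rw [hi] at v3
    have g1 : s'.get .B 0 i = complexity i := by
      rw [hch.get _ _ _ (by rintro ⟨-, h, h'⟩; exact hm4 h.symm h'), hm5]
    have g2 : s'.get .B jb (f i) = complexity (n - i) := by
      rw [hch.get _ _ _ (by rintro ⟨-, -, h⟩; exact hm3 h), hm6]
    have hval : (block 0 Var.m + block eb ei).val s' = complexity i + complexity (n - i) := by
      simp [hi, v1, v3, g1, g2]
    refine Run.cons (Run.assign (by simp [o1, o2, v1, v3, hi, hch.size, hm1, hm2]) ?_ ?_)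
    · rw [hval]
      have := complexity_le_self (n := i) (by omega)
      have := complexity_le_self (n := n - i) (by omega)
      omega
    rw [hval]
    obtain ⟨o1', o2', o3', v1', v2', v3'⟩ := he (s'.set .val (complexity i + complexity (n - i)))
      (hch.set (by simp)).vars
    have hq' : q < (s'.set .val (complexity i + complexity (n - i))).size .B jb := by
      simpa [hch.size] using hq
    refine Run.cons (Run.improve o1' o3' (by rw [v1', v2']; exact hq') fun t' ht' => Run.nil ?_)
    rw [v1', v2']
    have hnew := State.get_improve (x := complexity i + complexity (n - i)) (r' := .B) (i' := jb)
      (k' := q) hq'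
    simp only [and_self, if_true, State.get_set] at hnew
    refine ⟨by simp [hi], ⟨?_, ?_, ?_, ?_⟩, ?_⟩
    · exact ((hch.set (by simp)).improve (by simpa using hq') ⟨rfl, rfl⟩).set (by simp)
    · simp only [State.get_set, State.vars_set, if_true, hnew]
      have := complexity_add_le (a := i) (b := n - i) (by omega) (by omega)
      rw [show i + (n - i) = n by omega] at this
      omega
    · simp only [State.get_set, State.vars_set, if_true, hnew]
      omega
    · intro m h3 h4
      simp only [State.get_set, State.vars_set, if_true, hnew]
      rcases Nat.lt_or_ge m i with h5 | h5
      · have := hall m h3 h5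
        omega
      · obtain rfl : m = i := by omega
        omega
    · simp only [cost_add, cost_block, cost_var, cost_zero]
      omega
  · rintro s' t ⟨hch, h1, h2, h3⟩ - ht
    refine ⟨hch, h1, h2, fun m h4 h5 => h3 m h4 (by omega), ht.trans ?_⟩
    simp only [Finset.sum_const, Nat.card_Ico, smul_eq_mul, cost_six, cost_le, cost_var]
    have h6 : max 6 (K + 1) - 6 ≤ K := by omega
    calc _ ≤ 1 + (1 + 1 + 1) + 2 + K * (3 * eb.cost + ei.cost + 2 * ej.cost + 20 + (1 + 1 + 1) + 5) := by
          gcongr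
      _ ≤ _ := by nlinarith

/-! ### The fixed block -/

/-- The contents `g` of the fixed block: exact below `e`, and all products `a * b` with `b < n`, or
`b = n` and `a < k`, have been tested. -/
structure Table (H e n k : ℕ) (g : ℕ → ℕ) : Prop where
  exact : ∀ i, 1 ≤ i → i < e → i ≤ H → g i = complexity i
  lower : ∀ i, 1 ≤ i → i ≤ H → complexity i ≤ g i
  prod : ∀ a b, 2 ≤ a → a ≤ b → (b < n ∨ b = n ∧ a < k) → a * b ≤ H →
    g (a * b) ≤ complexity a + complexity b

/-- The case n = 2 is separate because ‖1‖ violates the cubic bound at 1. -/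
theorem two_pow_complexity_pred_le {n : ℕ} (hn : 2 ≤ n) : 2 ^ complexity (n - 1) ≤ n ^ 3 := by
  rcases Nat.lt_or_ge n 3 with h | h
  · obtain rfl : n = 2 := by omega
    norm_num [complexity_one]
  · exact (two_pow_complexity_le (by omega)).trans (Nat.pow_le_pow_left (by omega) 3)

/-- Ensures that n - m is a valid positive index for every summand m tested in the fixed block. -/
theorem IsCut.lt_of_eq_complexity_pred {n u : ℕ} (h : IsCut n (complexity (n - 1)) u)
    (hn : 2 ≤ n) : maxValue u < n := by
  rcases Nat.lt_or_ge n 3 with h3 | h3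
  · obtain rfl : n = 2 := by omega
    have h1 : complexity (2 - 1) = 1 := complexity_one
    have := h.le_half
    rw [h1] at this
    obtain rfl : u = 0 := by omega
    decide
  · have := h.le_of_two_pow_le (two_pow_complexity_le (n := n - 1) (by omega))
    omega

/-- The scalars that are changed by the computation of the fixed block. -/
def fixedVars : List Var := [.cMax, .n, .val, .target, .m, .k, .x, .e₁, .e₂, .t, .kMax]

/-- A bound for the time of the step `n` of the computation of the fixed block. -/
noncomputable def fixedStepTime (H n : ℕ) : ℕ :=
  200 + 100 * (Nat.size (H ^ 3) + 1) ^ 2 + 50 * summandBound n + 50 * (H / n)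

/-- The factors k ≤ n are read from exact entries, and the product kn with k ≥ 2 lies strictly above
n, so exact entries are never touched. -/
theorem Run.fixedProducts {H n : ℕ} (hH : s.vars .H = H) (hn : s.vars .n = n) (hn2 : 2 ≤ n)
    (hnH : n ≤ H) (hM : H + 6 ≤ M.scalar) (hsize : s.size .B 0 = H + 1)
    (htab : Table H (n + 1) n 2 (s.get .B 0)) :
    Run M (Fuller.forUp .k 2 (.and (.le Var.k Var.n) (.le Var.k (Var.H / Var.n))) [
        .assign .val (block 0 Var.k + block 0 Var.n),
        Fuller.improve 0 (Var.k * Var.n)]) s fun s' t =>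
      Changes [.val, .k] (fun i _ => i = 0) s s' ∧ Table H (n + 1) (n + 1) 2 (s'.get .B 0) ∧
      t ≤ 20 + 50 * (H / n) := by
  refine Run.forUp (fun i s' => Changes [.val, .k] (fun i _ => i = 0) s s' ∧
      Table H (n + 1) n i (s'.get .B 0)) (fun _ => 34) 2 (max 2 (min n (H / n) + 1))
    (by simp) (by simp) (by simp) (by omega) ?_ ?_ ?_ ?_
  · exact ⟨Changes.refl.set (by simp), htab⟩
  · rintro i s' h1 h2 ⟨hch, -⟩ hi
    refine ⟨by simp, ?_⟩
    simp only [holds_and, holds_le, val_var, val_div, hi, hch.vars .n (by simp), hn,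
      hch.vars .H (by simp), hH]
    omega
  · rintro i s' h1 h2 ⟨hch, ht⟩ hi
    have hin : i ≤ n := by omega
    have hiH : i ≤ H / n := by omega
    have hmul : i * n ≤ H := (Nat.le_div_iff_mul_le (by omega)).1 hiH
    have hn' : s'.vars .n = n := by rw [hch.vars .n (by simp), hn]
    have hsize' : s'.size .B 0 = H + 1 := by rw [hch.size, hsize]
    have hval : (block 0 Var.k + block 0 Var.n).val s' = complexity i + complexity n := by
      simp [hi, hn', ht.exact i (by omega) (by omega) (by omega),
        ht.exact n (by omega) (by omega) (by omega)]
    have hci := complexity_le_self (n := i) (by omega)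
    have hcn := complexity_le_self (n := n) (by omega)
    have hadd : i + n ≤ i * n := Nat.add_le_mul h1 hn2
    refine Run.cons (Run.assign ?_ (by rw [hval]; omega) ?_)
    · simp [hi, hn', hsize']
      omega
    rw [hval]
    have hlt : i * n < (s'.set .val (complexity i + complexity n)).size .B 0 := by
      simp [hsize']
      omega
    have hidx : (Var.k * Var.n : Expr).val (s'.set .val (complexity i + complexity n)) = i * n := by
      simp [hi, hn']
    refine Run.cons (Run.improve (by simp) (by simp) (by rw [hidx]; exact hlt)
      fun t' ht' => Run.nil ?_)
    rw [hidx]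
    have hg : ∀ k', ((s'.set .val (complexity i + complexity n)).improve 0 (i * n)
        (complexity i + complexity n)).get .B 0 k' =
        if k' = i * n then min (complexity i + complexity n) (s'.get .B 0 (i * n))
          else s'.get .B 0 k' := by
      intro k'
      rw [State.get_improve hlt]
      simp
    refine ⟨by simp [hi], ⟨?_, ?_⟩, ?_⟩
    · exact ((hch.set (by simp)).improve hlt rfl).set (by simp)
    · simp only [State.get_set, State.vars_set, if_true, val_zero]
      refine ⟨fun j h3 h4 h5 => ?_, fun j h3 h4 => ?_, fun a b ha hab hlt' hle => ?_⟩
      · rw [hg, if_neg (by omega)]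
        exact ht.exact j h3 h4 h5
      · rw [hg]
        split_ifs with h5
        · subst h5
          have := ht.lower (i * n) h3 h4
          have := complexity_mul_le (a := i) (b := n) (by omega) (by omega)
          omega
        · exact ht.lower j h3 h4
      · rw [hg]
        by_cases hnew : b = n ∧ a = i
        · rw [hnew.1, hnew.2, if_pos rfl]
          exact min_le_left _ _
        · have := ht.prod a b ha hab (by omega) hle
          split_ifs with h5
          · rw [← h5]
            exact (min_le_right _ _).trans this
          · exact this
    · simp at ht' ⊢
      omega
  · rintro s' t ⟨hch, ht⟩ - hT
    -- On exit k has passed min(n, ⌊H/n⌋), so each pair (a, n) with a ≤ n and an ≤ H has been met.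
    refine ⟨hch, ⟨ht.exact, ht.lower, fun a b ha hab hlt hle => ht.prod a b ha hab ?_ hle⟩, ?_⟩
    · rcases Nat.lt_or_ge b n with h | h
      · exact Or.inl h
      · obtain rfl : b = n := by omega
        have : a ≤ H / b := (Nat.le_div_iff_mul_le (by omega)).2 hle
        exact Or.inr ⟨rfl, by omega⟩
    · simp only [Finset.sum_const, Nat.card_Ico, smul_eq_mul, cost_two, cost_le, cost_var,
        cost_and, cost_div] at hT
      generalize H / n = d at hT ⊢
      omega

/-- Here s is ‖n - 1‖, one less than the first value tried for n; `IsCut.eq_complexity` allows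
exactly this slack. -/
theorem Run.fixedStep {H n : ℕ} (hH : s.vars .H = H) (hn : s.vars .n = n) (hn2 : 2 ≤ n)
    (hnH : n ≤ H) (hM : H + 6 ≤ M.scalar) (hM3 : H ^ 3 ≤ M.scalar) (hsize : s.size .B 0 = H + 1)
    (htab : Table H n n 2 (s.get .B 0)) :
    Run M (prog [
      .assign .val (block 0 (Var.n - 1) + 1),
      Fuller.improve 0 Var.n,
      .assign .target (block 0 (Var.n - 1)),
      Fuller.codeKMax,
      Fuller.forUp .m 6 (.le Var.m Var.kMax) [
        .assign .val (block 0 Var.m + block 0 (Var.n - Var.m)),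
        Fuller.improve 0 Var.n],
      Fuller.forUp .k 2 (.and (.le Var.k Var.n) (.le Var.k (Var.H / Var.n))) [
        .assign .val (block 0 Var.k + block 0 Var.n),
        Fuller.improve 0 (Var.k * Var.n)]]) s fun s' t =>
      Changes ([.val, .target, .m, .k] ++ kMaxVars) (fun i _ => i = 0) s s' ∧
      Table H (n + 1) (n + 1) 2 (s'.get .B 0) ∧ t ≤ fixedStepTime H n := by
  have hpred : s.get .B 0 (n - 1) = complexity (n - 1) :=
    htab.exact _ (by omega) (by omega) (by omega)
  have hcn := complexity_le_self (n := n - 1) (by omega)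
  have hval : (block 0 (Var.n - 1) + 1 : Expr).val s = complexity (n - 1) + 1 := by
    simp [hn, hpred]
  refine Run.cons (Run.assign (by simp [hn, hsize]; omega) (by rw [hval]; omega) ?_)
  rw [hval]
  refine Run.cons (Run.improve (by simp) (by simp) (by simp [hn, hsize]; omega) fun t₁ ht₁ => ?_)
  have hlt₁ : n < (s.set .val (complexity (n - 1) + 1)).size .B 0 := by
    simp [hsize]
    omega
  simp only [val_zero, val_var, State.vars_set, reduceCtorEq, if_false, if_true, hn]
  set s₁ := (s.set .val (complexity (n - 1) + 1)).improve 0 n (complexity (n - 1) + 1) with hs₁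
  have hg₁ : ∀ k', s₁.get .B 0 k' =
      if k' = n then min (complexity (n - 1) + 1) (s.get .B 0 n) else s.get .B 0 k' := by
    intro k'
    rw [hs₁, State.get_improve hlt₁]
    simp
  have hch₁ : Changes ([.val, .target, .m, .k] ++ kMaxVars) (fun i _ => i = 0) s s₁ :=
    (Changes.refl.set (by simp)).improve hlt₁ rfl
  have hn₁ : s₁.vars .n = n := by rw [hch₁.vars _ (by decide), hn]
  have hpred₁ : s₁.get .B 0 (n - 1) = complexity (n - 1) := by
    rw [hg₁, if_neg (by omega), hpred]
  have htv : (block 0 (Var.n - 1) : Expr).val s₁ = complexity (n - 1) := by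
    simp [hn₁, hpred₁]
  refine Run.cons (Run.assign (by simp [hn₁, hch₁.size, hsize]; omega) (by rw [htv]; omega) ?_)
  rw [htv]
  have h2p := two_pow_complexity_pred_le hn2
  have hsq := maxValue_le_sq h2p
  have hsqM : n ^ 2 ≤ M.scalar :=
    (Nat.pow_le_pow_left hnH 2).trans ((Nat.pow_le_pow_right (by omega) (by norm_num)).trans hM3)
  refine Run.cons ((Run.codeKMax (n := n) (S := complexity (n - 1)) (by simp [hn₁]) (by simp)
    (by have := le_maxValue_complexity (n := n - 1) (by omega); omega)
    (by omega) (hsq.trans hsqM)).mono ?_)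
  rintro s₂ t₂ - ⟨ha₂, ho₂, ⟨u, hu, hK⟩, hv₂, ht₂⟩
  have hch₂ : Changes ([.val, .target, .m, .k] ++ kMaxVars) (fun i _ => i = 0) s s₂ :=
    (hch₁.set (v := .target) (x := complexity (n - 1)) (by simp)).trans
      (Changes.of_arrs ha₂ ho₂ fun v hv => hv₂ v fun h => hv (by simp [h]))
  have hg₂ : s₂.get = s₁.get := (State.get_eq_of_arrs_eq ha₂).trans State.get_set
  have hn₂ : s₂.vars .n = n := by rw [hch₂.vars _ (by decide), hn]
  have hKn := hu.lt_of_eq_complexity_pred hn2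
  refine Run.cons ((Run.sumLoop (jb := 0) (q := n) (n := n) (f := fun m => n - m) hK hKn (by omega)
    (fun s' hs' => ?_) (by simp [hch₂.size, hsize]; omega) ?_ ?_).mono ?_)
  · refine ⟨by simp, by simp, by simp, by simp, ?_, ?_⟩
    · simp [hs' .n (by decide), hn₂]
    · simp [hs' .n (by decide), hn₂]
  · intro m h6 hmK
    have h3 : s₂.size .B 0 = H + 1 := by rw [hch₂.size, hsize]
    refine ⟨by omega, by omega, by omega, by omega, ?_, ?_⟩
    · rw [hg₂, hg₁, if_neg (by omega)]
      exact htab.exact m (by omega) (by omega) (by omega)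
    · rw [hg₂, hg₁, if_neg (by omega)]
      exact htab.exact _ (by omega) (by omega) (by omega)
  · rw [hg₂, hg₁, if_pos rfl]
    have h1 := htab.lower n (by omega) hnH
    have h2 := complexity_succ_le (n := n - 1) (by omega)
    rw [show n - 1 + 1 = n by omega] at h2
    omega
  rintro s₃ t₃ - ⟨hch₃, hlow₃, hup₃, hall₃, ht₃⟩
  rw [hg₂, hg₁, if_pos rfl] at hup₃
  have hch : Changes ([.val, .target, .m, .k] ++ kMaxVars) (fun i _ => i = 0) s s₃ :=
    hch₂.trans (hch₃.mono (by simp) fun i k h => h.1)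
  -- For ab = n with a ≥ 2 the cofactor satisfies b < n, so this product was entered in the earlier
  -- step b.
  have hex : s₃.get .B 0 n = complexity n := by
    refine hu.eq_complexity hn2 hlow₃ (by omega) (by omega) (fun m h6 hm _ => hall₃ m h6 hm)
      fun a b ha hab hmul => ?_
    have h1 := htab.prod a b ha hab (Or.inl (by have := Nat.mul_le_mul_right b ha; omega))
      (by omega)
    rw [hmul] at h1
    omega
  have hg₃ : ∀ k', k' ≠ n → s₃.get .B 0 k' = s.get .B 0 k' := by
    intro k' hk'
    rw [hch₃.get _ _ _ (by simp [hk']), hg₂, hg₁, if_neg hk']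
  refine Run.cons ((Run.fixedProducts (H := H) (n := n) ?_ ?_ hn2 hnH hM ?_ ?_).mono ?_)
  · rw [hch.vars _ (by decide), hH]
  · rw [hch.vars _ (by decide), hn]
  · rw [hch.size, hsize]
  · refine ⟨fun i h1 h2 h3 => ?_, fun i h1 h2 => ?_, fun a b ha hab hlt hle => ?_⟩
    · rcases eq_or_ne i n with rfl | hi
      · exact hex
      · rw [hg₃ i hi]
        exact htab.exact i h1 (by omega) h3
    · rcases eq_or_ne i n with rfl | hi
      · exact hex.ge
      · rw [hg₃ i hi]
        exact htab.lower i h1 h2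
    · rcases eq_or_ne (a * b) n with h | h
      · rw [h, hex, ← h]
        exact complexity_mul_le (by omega) (by omega)
      · rw [hg₃ _ h]
        exact htab.prod a b ha hab hlt hle
  rintro s₄ t₄ - ⟨hch₄, htab₄, ht₄⟩
  refine Run.nil ⟨hch.trans (hch₄.mono (by simp) fun i k h => h), htab₄, ?_⟩
  have h1 := hu.le_summandBound hn2 (by omega)
  have h2 : complexity (n - 1) ≤ Nat.size (H ^ 3) := complexity_le_size (by omega) (by omega)
  have h3 : 100 * (complexity (n - 1) + 1) ^ 2 ≤ 100 * (Nat.size (H ^ 3) + 1) ^ 2 := by gcongr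
  simp only [cost_add, cost_sub, cost_block, cost_var, cost_zero, cost_one] at *
  have h4 := Nat.mul_le_mul_left 50 h1
  have h5 : (3 * 1 + (1 + 1 + 1) + 2 * 1 + 30) * maxValue u ≤ 50 * maxValue u :=
    Nat.mul_le_mul_right _ (by norm_num)
  unfold fixedStepTime
  omega

/-- A bound for the time of the computation of the fixed block. -/
noncomputable def fixedTime (H : ℕ) : ℕ :=
  100 + H + 20 * Nat.size (H ^ 3) + ∑ n ∈ Finset.Ico 2 (H + 1), (fixedStepTime H n + 8)

theorem Run.fixedBlock {H : ℕ} (hH : s.vars .H = H) (hH2 : 2 ≤ H) (hM3 : H ^ 3 ≤ M.scalar)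
    (hcount : s.count .B = 0)
    (hbits : s.arrBits + (H + 1) * Nat.size (Nat.size (H ^ 3)) ≤ M.array) :
    Run M fixedBlock s fun s' t => (∀ v, v ∉ fixedVars → s'.vars v = s.vars v) ∧ s'.out = s.out ∧
      s'.count .B = 1 ∧ s'.count .Heads = s.count .Heads ∧ s'.size .B 0 = H + 1 ∧
      s'.width .B 0 = Nat.size (Nat.size (H ^ 3)) ∧
      (∀ n, 1 ≤ n → n ≤ H → s'.get .B 0 n = complexity n) ∧ t ≤ fixedTime H := by
  have hM : H + 6 ≤ M.scalar := by
    have h1 : 2 * 2 ≤ H * H := Nat.mul_le_mul hH2 hH2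
    have h2 := Nat.mul_le_mul_right H h1
    rw [show H ^ 3 = H * H * H by ring] at hM3
    omega
  refine Run.cons ((Run.codeCMax (k := H) (by simp) (by simp [hH]) hM3).mono ?_)
  rintro s₁ t₁ - ⟨ha₁, ho₁, hc₁, hv₁, ht₁⟩
  have hH₁ : s₁.vars .H = H := by rw [hv₁ _ (by decide) (by decide), hH]
  have hcount₁ : s₁.count .B = 0 := by rw [State.count_eq_of_arrs_eq ha₁, hcount]
  have hpos : 0 < Nat.size (H ^ 3) := Nat.size_pos.2 (Nat.pow_pos (by omega))
  refine Run.cons (Run.append (by simp) (by simp) ?_ (Run.cons ?_))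
  · rw [show s₁.arrBits = s.arrBits by unfold State.arrBits; rw [ha₁]]
    simpa [hH₁, hc₁] using hbits
  simp only [val_add, val_var, val_one, hH₁, hc₁]
  have hlt : 1 < (s₁.append .B (H + 1) (Nat.size (H ^ 3))).size .B 0 := by
    simp [State.size_append, hcount₁]
    omega
  refine Run.write (by simp) (by simp) (by simp) hlt ?_ (Run.cons ?_)
  · simp only [val_one, val_zero, State.width_append, hcount₁, and_self, if_true]
    exact Nat.size_le_size hpos
  simp only [val_zero, val_one]
  set s₂ := (s₁.append .B (H + 1) (Nat.size (H ^ 3))).put .B 0 1 1 with hs₂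
  have hg₂ : ∀ k, k ≤ H → s₂.get .B 0 k = if k = 1 then 1 else Nat.size (H ^ 3) := by
    intro k hk
    rw [hs₂, State.get_put hlt]
    simp [State.get_append, hcount₁, Nat.lt_succ_of_le hk]
  have hsize₂ : s₂.size .B 0 = H + 1 := by
    simp [hs₂, State.size_append, hcount₁]
  refine Run.forUp (fun n s' => Changes (.n :: ([.val, .target, .m, .k] ++ kMaxVars))
      (fun i _ => i = 0) s₂ s' ∧ Table H n n 2 (s'.get .B 0)) (fixedStepTime H) 2 (H + 1)
    (by simp) (by simp) (by omega) (by omega) ?_ ?_ ?_ ?_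
  · refine ⟨Changes.refl.set (by simp), fun i h1 h2 h3 => ?_, fun i h1 h2 => ?_,
      fun a b ha hab hlt hle => by omega⟩
    · obtain rfl : i = 1 := by omega
      simp [hg₂ 1 h3, complexity_one]
    · simp only [State.get_set, hg₂ i h2]
      split_ifs with h
      · rw [h, complexity_one]
      · exact complexity_le_size h1 h2
  · rintro i s' h1 h2 ⟨hch, -⟩ hi
    refine ⟨by simp, ?_⟩
    simp only [holds_le, val_var, hi, hch.vars .H (by decide), hs₂, State.vars_put,
      State.vars_append, hH₁]
    omega
  · rintro i s' h1 h2 ⟨hch, ht⟩ hi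
    refine (Run.fixedStep (H := H) (n := i) ?_ hi h1 (by omega) hM hM3 ?_ ht).mono ?_
    · simp [hch.vars .H (by decide), hs₂, hH₁]
    · rw [hch.size, hsize₂]
    · rintro s'' t - ⟨hch', htab, ht'⟩
      exact ⟨by rw [hch'.vars _ (by decide), hi],
        ⟨(hch.trans (hch'.mono (by simp) fun _ _ h => h)).set (by simp), htab⟩, ht'⟩
  · rintro s' t ⟨hch, htab⟩ - hT
    refine Run.nil ⟨fun v hv => ?_, ?_, ?_, ?_, ?_, ?_, fun n h1 h2 =>
      htab.exact n h1 (by omega) h2, ?_⟩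
    · simp only [fixedVars, List.mem_cons, List.not_mem_nil, not_or] at hv
      rw [hch.vars _ (by simp [kMaxVars]; tauto)]
      simp only [hs₂, State.vars_put, State.vars_append]
      exact hv₁ v (by tauto) (by tauto)
    · rw [hch.out]
      simp [hs₂, ho₁]
    · rw [hch.count]
      simp [hs₂, State.count_append, hcount₁]
    · rw [hch.count]
      simp [hs₂, State.count_append, State.count_eq_of_arrs_eq ha₁]
    · rw [hch.size, hsize₂]
    · rw [hch.width]
      simp [hs₂, State.width_append, hcount₁]
    · unfold fixedTime
      simp only [cost_le, cost_var, cost_two, cost_add, cost_one, cost_zero] at ht₁ hT ⊢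
      have hsum : ∑ i ∈ Finset.Ico 2 (H + 1), (fixedStepTime H i + (1 + 1 + 1) + 5) =
        ∑ i ∈ Finset.Ico 2 (H + 1), (fixedStepTime H i + 8) := rfl
      omega

/-! ### The memory of the main loop -/

/-- The consequences of admissibility that are needed for correctness. -/
structure Good (N H ell : ℕ) : Prop where
  two_le : 2 ≤ ell
  two_mul_le : 2 * ell ≤ H
  le_limit : H ≤ N
  limit_le : N ≤ ell * H
  cut_le : ∀ n S u, n ≤ N → IsCut n S u → 2 ^ S ≤ n ^ 3 → maxValue u ≤ ell

theorem Good.ell_pos {N H ell : ℕ} (hg : Good N H ell) : 0 < ell := by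
  have := hg.two_le
  omega

/-- The scalars that are constant in the main loop, the shape of the arrays, and the contents of the
fixed block. There are `J` blocks, including the fixed one. -/
structure Mem (N H ell J : ℕ) (s : State) : Prop where
  vN : s.vars .N = N
  vH : s.vars .H = H
  vell : s.vars .ell = ell
  vL : s.vars .L = 2 * ell
  vcMax : s.vars .cMax = Nat.size (N ^ 3)
  count_block : s.count .B = J
  count_head : s.count .Heads = J
  size_fixed : s.size .B 0 = H + 1
  -- Only an inequality, as the fixed block is created with the digit count for H instead of N.
  width_fixed : s.width .B 0 ≤ Nat.size (Nat.size (N ^ 3))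
  get_fixed : ∀ n, 1 ≤ n → n ≤ H → s.get .B 0 n = complexity n
  size_head : ∀ i < J, s.size .Heads i = 1
  width_head : ∀ i < J, s.width .Heads i = Nat.size N
  size_block : ∀ i, 1 ≤ i → i < J → s.size .B i = 2 * ell
  width_block : ∀ i, 1 ≤ i → i < J → s.width .B i = Nat.size (Nat.size (N ^ 3))

/-- The running block `i` has head `h`, and its contents are correct. -/
structure Block (ell i h : ℕ) (s : State) : Prop where
  head : s.get .Heads i 0 = h
  le_head : 2 * ell ≤ h
  get : ∀ n, h < n + 2 * ell → n ≤ h → s.get .B i (n - (h - 2 * ell + 1)) = complexity n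

/-- The scalars that are constant in the main loop. -/
def constVars : List Var := [.N, .H, .ell, .L, .cMax]

theorem Mem.of_changes {N H ell J : ℕ} {vs : List Var} {cells : ℕ → ℕ → Prop} {s' : State}
    (hm : Mem N H ell J s) (hc : Changes vs cells s s') (hvs : ∀ v ∈ constVars, v ∉ vs)
    (hcells : ∀ k, ¬ cells 0 k) : Mem N H ell J s' where
  vN := by rw [hc.vars _ (hvs _ (by decide)), hm.vN]
  vH := by rw [hc.vars _ (hvs _ (by decide)), hm.vH]
  vell := by rw [hc.vars _ (hvs _ (by decide)), hm.vell]
  vL := by rw [hc.vars _ (hvs _ (by decide)), hm.vL]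
  vcMax := by rw [hc.vars _ (hvs _ (by decide)), hm.vcMax]
  count_block := by rw [hc.count, hm.count_block]
  count_head := by rw [hc.count, hm.count_head]
  size_fixed := by rw [hc.size, hm.size_fixed]
  width_fixed := by rw [hc.width]; exact hm.width_fixed
  get_fixed n h1 h2 := by rw [hc.get _ _ _ (fun h => hcells _ h.2), hm.get_fixed n h1 h2]
  size_head := by rw [hc.size]; exact hm.size_head
  width_head := by rw [hc.width]; exact hm.width_head
  size_block := by rw [hc.size]; exact hm.size_block
  width_block := by rw [hc.width]; exact hm.width_block

theorem Block.of_changes {ell i h : ℕ} {vs : List Var} {cells : ℕ → ℕ → Prop} {s' : State}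
    (hb : Block ell i h s) (hc : Changes vs cells s s') (hcells : ∀ k, ¬ cells i k) :
    Block ell i h s' where
  head := by rw [hc.get _ _ _ (by simp), hb.head]
  le_head := hb.le_head
  get n h1 h2 := by rw [hc.get _ _ _ (fun h => hcells _ h.2), hb.get n h1 h2]

theorem Mem.arrBits_le {N H ell J : ℕ} (hm : Mem N H ell J s) (hJ : 1 ≤ J) :
    s.arrBits ≤ (H + 1) * Nat.size (Nat.size (N ^ 3)) +
      (J - 1) * (2 * ell * Nat.size (Nat.size (N ^ 3))) + J * Nat.size N := by
  rw [State.arrBits_eq]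
  have huniv : (Finset.univ : Finset Arr) = {.B, .Heads} := rfl
  rw [huniv, Finset.sum_pair (by decide), hm.count_block, hm.count_head]
  refine Nat.add_le_add ?_ ?_
  · obtain ⟨J, rfl⟩ := Nat.exists_eq_add_of_le' hJ
    rw [Finset.sum_range_succ', add_comm, hm.size_fixed, Nat.add_sub_cancel]
    refine Nat.add_le_add (Nat.mul_le_mul_left _ hm.width_fixed) ?_
    refine (Finset.sum_le_card_nsmul _ _ (2 * ell * Nat.size (Nat.size (N ^ 3))) ?_).trans ?_
    · intro i hi
      rw [Finset.mem_range] at hi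
      rw [hm.size_block _ (by omega) (by omega), hm.width_block _ (by omega) (by omega)]
    · simp
  · refine (Finset.sum_le_card_nsmul _ _ (Nat.size N) ?_).trans ?_
    · intro i hi
      rw [Finset.mem_range] at hi
      rw [hm.size_head _ hi, hm.width_head _ hi, one_mul]
    · simp

theorem Run.createRunningBlock {N H ell J : ℕ} (hg : Good N H ell) (hm : Mem N H ell J s)
    (hJ : 1 ≤ J) (hM : N ≤ M.scalar)
    (hbits : (H + 1) * Nat.size (Nat.size (N ^ 3)) +
      J * (2 * ell * Nat.size (Nat.size (N ^ 3))) + (J + 1) * Nat.size N ≤ M.array) :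
    Run M createRunningBlock s fun s' t => Mem N H ell (J + 1) s' ∧ Block ell J H s' ∧
      (∀ i h, i < J → Block ell i h s → Block ell i h s') ∧
      (∀ v, v ≠ .k → s'.vars v = s.vars v) ∧ s'.out = s.out ∧ t ≤ 100 * ell + 50 := by
  have h2 := hg.two_mul_le
  have hHN := hg.le_limit
  have hep := hg.ell_pos
  have harr := hm.arrBits_le hJ
  obtain ⟨J', rfl⟩ := Nat.exists_eq_add_of_le' hJ
  have hexp : (J' + 1) * (2 * ell * Nat.size (Nat.size (N ^ 3))) =
    J' * (2 * ell * Nat.size (Nat.size (N ^ 3))) + 2 * ell * Nat.size (Nat.size (N ^ 3)) := by ring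
  have hexp' : (J' + 1 + 1) * Nat.size N = (J' + 1) * Nat.size N + Nat.size N := by ring
  rw [Nat.add_sub_cancel] at harr
  set J := J' + 1
  refine Run.cons (Run.append (by simp) (by simp) ?_ (Run.cons ?_))
  · simp only [val_var, hm.vL, hm.vcMax]
    omega
  simp only [val_var, hm.vL, hm.vcMax]
  set s₁ := s.append .B (2 * ell) (Nat.size (N ^ 3)) with hs₁
  have hsize₁ : s₁.size .B J = 2 * ell := by simp [hs₁, State.size_append, hm.count_block]
  have hwidth₁ : s₁.width .B J = Nat.size (Nat.size (N ^ 3)) := by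
    simp [hs₁, State.width_append, hm.count_block]
  have hcount₁ : s₁.count .B = J + 1 := by simp [hs₁, State.count_append, hm.count_block]
  have hsize₁' : s₁.size .B 0 = H + 1 := by
    rw [hs₁, State.size_append, if_neg (by simp [hm.count_block, J]), hm.size_fixed]
  have hfix₁ : ∀ n, 1 ≤ n → n ≤ H → s₁.get .B 0 n = complexity n := by
    intro n h3 h4
    rw [hs₁, State.get_append, if_neg (by simp [hm.count_block, J]), hm.get_fixed n h3 h4]
  refine Run.forUp (fun i s' => Changes [.k] (fun i _ => i = J) s₁ s' ∧
      ∀ k < i, s'.get .B J k = complexity (H - 2 * ell + 1 + k)) (fun _ => 20) 0 (2 * ell) (by simp)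
    (by simp) (by omega) (by omega) ⟨Changes.refl.set (by simp), by simp⟩ ?_ ?_ ?_
  · rintro i s' - h2 ⟨hch, -⟩ hi
    refine ⟨by simp, ?_⟩
    simp only [holds_lt, val_var, hi, hch.vars .L (by decide), hs₁, State.vars_append, hm.vL]
  · rintro i s' - h3 ⟨hch, hget⟩ hi
    have hL : s'.vars .L = 2 * ell := by
      rw [hch.vars .L (by decide), hs₁, State.vars_append, hm.vL]
    have hH : s'.vars .H = H := by
      rw [hch.vars .H (by decide), hs₁, State.vars_append, hm.vH]
    have hval : (block 0 (Var.H - Var.L + 1 + Var.k)).val s' = complexity (H - 2 * ell + 1 + i) := by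
      simp only [val_block, val_zero, val_add, val_sub, val_var, val_one, hL, hH, hi]
      rw [hch.get _ _ _ (by simp [J]), hfix₁ _ (by omega) (by omega)]
    have hlt : i < s'.size .B J := by rw [hch.size, hsize₁]; exact h3
    refine Run.cons (Run.write (by simp) (by simp) ?_ ?_ ?_ (Run.nil ?_))
    · simp [hL, hH, hi, hch.size, hsize₁']
      omega
    · simpa [hch.count, hcount₁, hi] using hlt
    · rw [hval]
      simp only [val_sub, val_len, val_one, hch.count, hcount₁, Nat.add_sub_cancel, hch.width,
        hwidth₁]
      exact Nat.size_le_size (complexity_le_size (by omega) (by omega))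
    · rw [hval]
      simp only [val_sub, val_len, val_one, hch.count, hcount₁, Nat.add_sub_cancel, val_var, hi,
        State.vars_put, true_and]
      refine ⟨⟨(hch.put hlt rfl).set (by simp), fun k hk => ?_⟩, by simp⟩
      rw [State.get_set, State.get_put hlt]
      by_cases hki : k = i
      · simp [hki]
      · rw [if_neg (by simp [hki]), hget k (by omega)]
  · rintro s₂ t₂ ⟨hch, hget⟩ - ht₂
    have hv₂ : ∀ v, v ≠ .k → s₂.vars v = s.vars v := fun v hv => by
      rw [hch.vars _ (by simpa using hv), hs₁, State.vars_append]
    have hcount₂ : s₂.count .Heads = J := by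
      rw [hch.count]
      simp [hs₁, State.count_append, hm.count_head]
    have harr₂ : s₂.arrBits = s.arrBits + 2 * ell * Nat.size (Nat.size (N ^ 3)) := by
      rw [State.arrBits_eq, hch.count, hch.size, hch.width, ← State.arrBits_eq, hs₁,
        State.arrBits_append]
    refine Run.cons (Run.append (by simp) (by simp) ?_ (Run.cons ?_))
    · simp only [val_var, val_one, hv₂ .N (by decide), hm.vN, harr₂]
      omega
    simp only [val_var, val_one, hv₂ .N (by decide), hm.vN]
    set s₃ := s₂.append .Heads 1 N with hs₃
    have hlt₃ : 0 < s₃.size .Heads J := by simp [hs₃, State.size_append, hcount₂]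
    have hidx : (Expr.len .Heads - 1 : Expr).val s₃ = J := by
      simp [hs₃, State.count_append, hcount₂]
    have hHv : s₃.vars .H = H := by rw [hs₃, State.vars_append, hv₂ _ (by decide), hm.vH]
    refine Run.write (by simp) (by simp) (by simp) ?_ ?_ (Run.nil ?_)
    · rw [hidx]
      exact hlt₃
    · rw [hidx, val_var, hHv]
      simp only [hs₃, State.width_append, hcount₂, and_self, if_true]
      exact Nat.size_le_size hHN
    rw [hidx, val_var, hHv, val_zero]
    have hgB : ∀ i k, (s₃.put .Heads J 0 H).get .B i k = s₂.get .B i k := by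
      intro i k
      rw [State.get_put hlt₃]
      simp [hs₃, State.get_append]
    have hgH : ∀ i, i < J → (s₃.put .Heads J 0 H).get .Heads i 0 = s.get .Heads i 0 := by
      intro i hi
      rw [State.get_put hlt₃, if_neg (by simp; omega), hs₃, State.get_append,
        if_neg (by simp [hcount₂]; omega), hch.get _ _ _ (by simp), hs₁, State.get_append,
        if_neg (by simp)]
    have hgB' : ∀ i, i < J → ∀ k, s₂.get .B i k = s.get .B i k := by
      intro i hi k
      rw [hch.get _ _ _ (by simp; omega), hs₁, State.get_append,
        if_neg (by simp [hm.count_block]; omega)]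
    refine ⟨⟨?_, ?_, ?_, ?_, ?_, ?_, ?_, ?_, ?_, ?_, ?_, ?_, ?_, ?_⟩, ⟨?_, h2, ?_⟩, ?_, ?_, ?_, ?_⟩
    · simp [hs₃, hv₂, hm.vN]
    · simp [hs₃, hv₂, hm.vH]
    · simp [hs₃, hv₂, hm.vell]
    · simp [hs₃, hv₂, hm.vL]
    · simp [hs₃, hv₂, hm.vcMax]
    · simp [hs₃, State.count_append, hch.count, hcount₁]
    · simp [hs₃, State.count_append, hcount₂]
    · simp [hs₃, State.size_append, hch.size, hsize₁']
    · simp only [hs₃, State.width_put, State.width_append, hch.width, hs₁]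
      simpa [hm.count_block, J] using hm.width_fixed
    · intro n h3 h4
      rw [hgB, hgB' 0 (by omega), hm.get_fixed n h3 h4]
    · intro i hi
      simp only [hs₃, State.size_put, State.size_append, hcount₂, hch.size, hs₁]
      split_ifs with h3 h4
      · rfl
      · simp at h4
      · exact hm.size_head i (by simp at h3; omega)
    · intro i hi
      simp only [hs₃, State.width_put, State.width_append, hcount₂, hch.width, hs₁]
      split_ifs with h3 h4
      · rfl
      · simp at h4
      · exact hm.width_head i (by simp at h3; omega)
    · intro i hi1 hi
      simp only [hs₃, State.size_put, State.size_append, hm.count_block, hch.size, hs₁]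
      simp only [reduceCtorEq, false_and, if_false, true_and]
      split_ifs with h3
      · rfl
      · exact hm.size_block i hi1 (by omega)
    · intro i hi1 hi
      simp only [hs₃, State.width_put, State.width_append, hm.count_block, hch.width, hs₁]
      simp only [reduceCtorEq, false_and, if_false, true_and]
      split_ifs with h3
      · rfl
      · exact hm.width_block i hi1 (by omega)
    · rw [State.get_put hlt₃]
      simp
    · intro n h3 h4
      rw [hgB, hget _ (by omega)]
      congr 1
      omega
    · intro i h hi hb
      refine ⟨by rw [hgH i hi, hb.head], hb.le_head, fun n h3 h4 => ?_⟩
      rw [hgB, hgB' i hi, hb.get n h3 h4]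
    · intro v hv
      simp [hs₃, hv₂ v hv]
    · simp [hs₃, hch.out, hs₁]
    · simp only [Finset.sum_const, Nat.card_Ico, smul_eq_mul, cost_sub, cost_lt, cost_var, cost_zero,
        cost_one, cost_len] at ht₂ ⊢
      omega

/-- After a shift of the block `j` to the head `h`: the lower half is correct, the upper half
consists of upper bounds. -/
structure Shifted (ell j h : ℕ) (s : State) : Prop where
  head : s.get .Heads j 0 = h
  lower : ∀ n, h < n + 2 * ell → n + ell ≤ h → s.get .B j (n - (h - 2 * ell + 1)) = complexity n
  upper : ∀ n, h < n + ell → n ≤ h → complexity n ≤ s.get .B j (n - (h - 2 * ell + 1))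

theorem Run.shift {N H ell J j h : ℕ} (hg : Good N H ell) (hm : Mem N H ell J s)
    (hj : s.vars .j = j) (hj1 : 1 ≤ j) (hjJ : j < J) (hM : N ≤ M.scalar)
    (hb : Block ell j h s) (hN : h + ell ≤ N) :
    Run M shift s fun s' t => Mem N H ell J s' ∧ Shifted ell j (h + ell) s' ∧
      (∀ i h', i ≠ j → Block ell i h' s → Block ell i h' s') ∧
      (∀ v, v ≠ .k → s'.vars v = s.vars v) ∧ s'.out = s.out ∧ t ≤ 100 * ell + 50 := by
  have h2 := hg.two_mul_le
  have hHN := hg.le_limit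
  have hep := hg.ell_pos
  have hle := hb.le_head
  have hlt₀ : 0 < s.size .Heads j := by rw [hm.size_head j hjJ]; exact Nat.one_pos
  refine Run.cons (Run.write (by simp) (by simp) (by simp [hj, hlt₀]) (by simpa [hj] using hlt₀) ?_
    (Run.cons ?_))
  · simp only [val_add, val_head, val_var, hj, hb.head, hm.vell, hm.width_head j hjJ]
    exact Nat.size_le_size hN
  simp only [val_add, val_head, val_var, hj, hb.head, hm.vell, val_zero]
  set s₁ := s.put .Heads j 0 (h + ell) with hs₁
  have hgB : ∀ i k, s₁.get .B i k = s.get .B i k := fun i k => by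
    rw [hs₁, State.get_put hlt₀]
    simp
  have hm₁ : Mem N H ell J s₁ := by
    refine ⟨hm.vN, hm.vH, hm.vell, hm.vL, hm.vcMax, ?_, ?_, ?_, ?_, ?_, ?_, ?_, ?_, ?_⟩
    · simpa [hs₁] using hm.count_block
    · simpa [hs₁] using hm.count_head
    · simpa [hs₁] using hm.size_fixed
    · simpa [hs₁] using hm.width_fixed
    · intro n h3 h4
      rw [hgB, hm.get_fixed n h3 h4]
    · simpa [hs₁] using hm.size_head
    · simpa [hs₁] using hm.width_head
    · simpa [hs₁] using hm.size_block
    · simpa [hs₁] using hm.width_block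
  have hsize₁ := hm₁.size_block j hj1 hjJ
  have hwidth₁ := hm₁.width_block j hj1 hjJ
  -- The last clause records that the upper cells from position i on are still the old ones: each is
  -- copied down before it is overwritten.
  refine Run.forUp (fun i s' => Changes [.k] (fun i _ => i = j) s₁ s' ∧
      (∀ k < i, s'.get .B j k = s₁.get .B j (k + ell)) ∧
      (∀ k < i, s'.get .B j (k + ell) = Nat.size (N ^ 3)) ∧
      ∀ k, i ≤ k → k < ell → s'.get .B j (k + ell) = s₁.get .B j (k + ell))
    (fun _ => 30) 0 ell (by simp) (by simp) (by omega) (by omega)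
    ⟨Changes.refl.set (by simp), by simp, by simp, by simp⟩ ?_ ?_ ?_
  · rintro i s' - h2 ⟨hch, -⟩ hi
    refine ⟨by simp, ?_⟩
    simp only [holds_lt, val_var, hi, hch.vars .ell (by decide), hm₁.vell]
  · rintro i s' - h3 ⟨hch, hlo, hup, hrest⟩ hi
    have hm' := hm₁.of_changes hch (by decide) (by omega)
    have hj' : s'.vars .j = j := by rw [hch.vars .j (by decide), hs₁, State.vars_put, hj]
    have hlt : i < s'.size .B j := by rw [hch.size, hsize₁]; omega
    have hlt' : i + ell < s'.size .B j := by rw [hch.size, hsize₁]; omega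
    have hcell : s'.get .B j (i + ell) = s.get .B j (i + ell) := by
      rw [hrest i le_rfl h3, hgB]
    refine Run.cons (Run.write (by simp) (by simp) ?_ ?_ ?_ (Run.cons ?_))
    · simpa [hj', hi, hm'.vell] using hlt'
    · simpa [hj', hi] using hlt
    · simp only [val_block, val_add, val_var, hj', hi, hm'.vell, hcell, hch.width, hwidth₁]
      rw [show i + ell = (h - 2 * ell + 1 + i + ell) - (h - 2 * ell + 1) by omega,
        hb.get _ (by omega) (by omega)]
      exact Nat.size_le_size (complexity_le_size (by omega) (by omega))
    simp only [val_block, val_add, val_var, hj', hi, hm'.vell]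
    refine Run.write (by simp) (by simp) (by simp) ?_ ?_ (Run.nil ?_)
    · simpa [hj', hi, hm'.vell] using hlt'
    · simp [hj', hm'.vcMax, hch.width, hwidth₁]
    simp only [val_add, val_var, State.vars_put, hj', hi, hm'.vell, hm'.vcMax]
    set s'' := s'.put .B j i (s'.get .B j (i + ell))
    have hlt'' : i + ell < s''.size .B j := by simpa [s''] using hlt'
    have hgg : ∀ k, ((s''.put .B j (i + ell) (Nat.size (N ^ 3))).set .k (i + 1)).get .B j k =
        if k = i + ell then Nat.size (N ^ 3) else
          if k = i then s'.get .B j (i + ell) else s'.get .B j k := by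
      intro k
      rw [State.get_set, State.get_put hlt'', State.get_put hlt]
      simp
    refine ⟨trivial, ⟨((hch.put hlt rfl).put hlt'' rfl).set (by simp), fun k hk => ?_,
      fun k hk => ?_, fun k hk hk' => ?_⟩, by simp⟩
    · rw [hgg, if_neg (by omega)]
      split_ifs with h4
      · rw [h4, hrest i le_rfl h3]
      · exact hlo k (by omega)
    · rw [hgg]
      split_ifs with h4 h5
      · rfl
      · omega
      · exact hup k (by omega)
    · rw [hgg, if_neg (by omega), if_neg (by omega)]
      exact hrest k (by omega) hk'
  · rintro s' t' ⟨hch, hlo, hup, -⟩ - ht'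
    refine Run.nil ⟨hm₁.of_changes hch (by decide) (by omega), ⟨?_, fun n h3 h4 => ?_,
      fun n h3 h4 => ?_⟩, fun i h' hi hb' => ?_, fun v hv => ?_, ?_, ?_⟩
    · rw [hch.get _ _ _ (by simp), hs₁, State.get_put hlt₀]
      simp
    · rw [hlo _ (by omega), hgB, ← hb.get n (by omega) (by omega)]
      congr 1
      omega
    · rw [show n - (h + ell - 2 * ell + 1) = (n - (h + 1)) + ell by omega, hup _ (by omega)]
      exact complexity_le_size (by omega) (by omega)
    · refine Block.of_changes ⟨?_, hb'.le_head, fun n h3 h4 => ?_⟩ hch (by simpa using hi)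
      · rw [hs₁, State.get_put hlt₀, if_neg (by simpa using hi), hb'.head]
      · rw [hgB, hb'.get n h3 h4]
    · rw [hch.vars _ (by simpa using hv), hs₁, State.vars_put]
    · rw [hch.out, hs₁, State.out_put]
    · simp only [Finset.sum_const, Nat.card_Ico, smul_eq_mul, cost_add, cost_lt, cost_var, cost_zero,
        cost_head] at ht' ⊢
      omega

/-! ### The products -/

theorem Shifted.of_changes {ell j h : ℕ} {vs : List Var} {s' : State}
    (hb : Shifted ell j h s) (hc : Changes vs (fun _ _ => False) s s') :
    Shifted ell j h s' where
  head := by rw [hc.get _ _ _ (by simp), hb.head]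
  lower n h1 h2 := by rw [hc.get _ _ _ (by simp), hb.lower n h1 h2]
  upper n h1 h2 := by rw [hc.get _ _ _ (by simp)]; exact hb.upper n h1 h2

/-- Within the window the index n - (h - 2 ell + 1) is injective in n in spite of truncated
subtraction. -/
theorem get_improve_entry {ell j h n x : ℕ} (hsize : s.size .B j = 2 * ell)
    (h1 : h < n + 2 * ell) (h2 : n ≤ h) (hle : 2 * ell ≤ h) {n' : ℕ} (h1' : h < n' + 2 * ell) :
    (s.improve j (n - (h - 2 * ell + 1)) x).get .B j (n' - (h - 2 * ell + 1)) =
      if n' = n then min x (s.get .B j (n - (h - 2 * ell + 1)))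
        else s.get .B j (n' - (h - 2 * ell + 1)) := by
  rw [State.get_improve (by omega)]
  refine if_congr ?_ rfl rfl
  simp only [true_and]
  omega

theorem Shifted.improve {ell j h n x : ℕ} (hS : Shifted ell j h s)
    (hsize : s.size .B j = 2 * ell) (hle : 2 * ell ≤ h) (h1 : h < n + ell) (h2 : n ≤ h)
    (hx : complexity n ≤ x) : Shifted ell j h (s.improve j (n - (h - 2 * ell + 1)) x) where
  head := by rw [State.get_improve (by omega), if_neg (by simp), hS.head]
  lower n' h3 h4 := by
    rw [get_improve_entry hsize (by omega) h2 hle h3, if_neg (by omega), hS.lower n' h3 h4]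
  upper n' h3 h4 := by
    rw [get_improve_entry hsize (by omega) h2 hle (by omega)]
    split_ifs with h
    · rw [h]
      exact le_min hx (hS.upper n h1 h2)
    · exact hS.upper n' h3 h4

theorem Run.firstB {h ell a : ℕ} (hh : s.vars .newH = h) (hell : s.vars .ell = ell)
    (ha : s.vars .a = a) (hM : 1 + (h - ell) / a ≤ M.scalar) (hM' : a ≤ M.scalar) :
    Run M firstB s fun s' t => Changes [.b] (fun _ _ => False) s s' ∧
      s'.vars .b = max (1 + (h - ell) / a) a ∧ t ≤ 30 := by
  refine Run.cons (Run.assign (by simp) (by simpa [hh, hell, ha] using hM) (Run.cons ?_))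
  simp only [val_add, val_one, val_div, val_sub, val_var, hh, hell, ha]
  refine Run.ifThen (by simp) (fun hc => ?_) fun hc => ?_
  · simp [ha] at hc
    refine Run.cons (Run.assign (by simp) (by simpa [ha] using hM') (Run.nil (Run.nil ?_)))
    refine ⟨(Changes.refl.set (by simp)).set (by simp), ?_, by simp⟩
    simp [ha]
    omega
  · simp [ha] at hc
    refine Run.nil ⟨Changes.refl.set (by simp), ?_, by simp⟩
    simp
    omega

/-- The loop over `b` for fixed `a`. -/
theorem Run.productLoop {H N ell J j h a b₀ bl sb : ℕ} (hg : Good N H ell) (hm : Mem N H ell J s)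
    (hj : s.vars .j = j) (hj1 : 1 ≤ j) (hjJ : j < J) (hh : 2 * ell ≤ h) (hhN : h ≤ N)
    (hM : 2 * N + 1 ≤ M.scalar) (hsh : s.vars .sh = h - 2 * ell + 1)
    (ha : s.vars .a = a) (ha2 : 2 ≤ a) (haH : a ≤ H) (hb : s.vars .b = b₀)
    (hb₀ : h - ell < a * b₀) (hb₀pos : 0 < b₀)
    (hab : s.vars .ab = a * b₀) (hbmax : s.vars .bmax = h / a)
    (hbl : s.vars .blk = bl) (hsb : s.vars .shB = sb) (hblj : bl ≠ j)
    (hread : ∀ b, b₀ ≤ b → b ≤ h / a → b - sb < s.size .B bl ∧ s.get .B bl (b - sb) = complexity b)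
    (hS : Shifted ell j h s) :
    Run M (.while (.le Var.b Var.bmax) (prog [
        .assign .val (block 0 Var.a + block Var.blk (Var.b - Var.shB)),
        Fuller.improve Var.j (Var.ab - Var.sh),
        .assign .b (Var.b + 1),
        .assign .ab (Var.ab + Var.a)])) s fun s' t =>
      Changes [.val, .b, .ab] (fun i _ => i = j) s s' ∧ Shifted ell j h s' ∧
      (∀ n, h < n + 2 * ell → s'.get .B j (n - (h - 2 * ell + 1)) ≤
        s.get .B j (n - (h - 2 * ell + 1))) ∧
      (∀ b, b₀ ≤ b → b ≤ h / a → s'.get .B j (a * b - (h - 2 * ell + 1)) ≤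
        complexity a + complexity b) ∧ t ≤ 10 + 60 * (h / a + 1 - b₀) := by
  have h2e := hg.two_mul_le
  have hHN := hg.le_limit
  have hep := hg.ell_pos
  have hda : h / a ≤ h := Nat.div_le_self _ _
  refine Run.while (fun s' t => Changes [.val, .b, .ab] (fun i _ => i = j) s s' ∧
      Shifted ell j h s' ∧
      (∀ n, h < n + 2 * ell → s'.get .B j (n - (h - 2 * ell + 1)) ≤
        s.get .B j (n - (h - 2 * ell + 1))) ∧
      (∀ b, b₀ ≤ b → b < s'.vars .b → s'.get .B j (a * b - (h - 2 * ell + 1)) ≤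
        complexity a + complexity b) ∧ s'.vars .ab = a * s'.vars .b ∧ b₀ ≤ s'.vars .b ∧
      s'.vars .b ≤ max b₀ (h / a + 1) ∧ t ≤ 60 * (s'.vars .b - b₀))
    (fun s' => h / a + 1 - s'.vars .b) ?_ ?_
  · refine ⟨Changes.refl, hS, fun n _ => le_rfl, fun b h1 h2 => by omega, by rw [hab, hb],
      hb.ge, by omega, by omega⟩
  · rintro s' t - ⟨hch, hS', hmono, htest, hab', hb1, hb2, ht⟩
    have hbm : s'.vars .bmax = h / a := by rw [hch.vars _ (by decide), hbmax]
    refine ⟨by simp, fun hc => ?_, fun hc => ?_⟩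
    · simp only [holds_le, val_var, hbm, not_le] at hc
      refine ⟨hch, hS', hmono, fun b h1 h2 => htest b h1 (by omega), ?_⟩
      simp only [cost_le, cost_var]
      omega
    · simp only [holds_le, val_var, hbm] at hc
      generalize hbv : s'.vars .b = b at *
      have hm' := hm.of_changes hch (by decide) (by omega)
      have hmul : a * b ≤ h := by
        rw [mul_comm]
        exact (Nat.le_div_iff_mul_le (by omega)).1 hc
      have hmul' : h - ell < a * b := hb₀.trans_le (Nat.mul_le_mul_left _ hb1)
      obtain ⟨hr1, hr2⟩ := hread b hb1 hc
      have hj' : s'.vars .j = j := by rw [hch.vars _ (by decide), hj]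
      have ha' : s'.vars .a = a := by rw [hch.vars _ (by decide), ha]
      have hbl' : s'.vars .blk = bl := by rw [hch.vars _ (by decide), hbl]
      have hsb' : s'.vars .shB = sb := by rw [hch.vars _ (by decide), hsb]
      have hsh' : s'.vars .sh = h - 2 * ell + 1 := by rw [hch.vars _ (by decide), hsh]
      -- The loop writes to block j only, and the source block is a different one.
      have hr2' : s'.get .B bl (b - sb) = complexity b := by
        rw [hch.get _ _ _ (by simpa using hblj), hr2]
      have hsize := hm'.size_block j hj1 hjJ
      have hval : (block 0 Var.a + block Var.blk (Var.b - Var.shB)).val s' =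
          complexity a + complexity b := by
        simp [ha', hbl', hbv, hsb', hr2', hm'.get_fixed a (by omega) haH]
      have hca := complexity_le_self (n := a) (by omega)
      have hcb := complexity_le_self (n := b) (by omega)
      refine Run.cons (Run.assign ?_ (by rw [hval]; omega) ?_)
      · simp [ha', hbl', hbv, hsb', hm'.size_fixed, hch.size, hr1]
        omega
      rw [hval]
      have hidx : (Var.ab - Var.sh : Expr).val (s'.set .val (complexity a + complexity b)) =
          a * b - (h - 2 * ell + 1) := by
        simp [hab', hsh']
      refine Run.cons (Run.improve (by simp) (by simp) ?_ fun t₁ ht₁ => ?_)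
      · rw [hidx]
        simp [hj', hsize]
        omega
      rw [hidx]
      simp only [val_var, State.vars_set, reduceCtorEq, if_false, if_true, hj']
      set s₁ := (s'.set .val (complexity a + complexity b)).improve j
        (a * b - (h - 2 * ell + 1)) (complexity a + complexity b) with hs₁
      have hget : ∀ n', h < n' + 2 * ell → s₁.get .B j (n' - (h - 2 * ell + 1)) =
          if n' = a * b then min (complexity a + complexity b)
            (s'.get .B j (a * b - (h - 2 * ell + 1)))
          else s'.get .B j (n' - (h - 2 * ell + 1)) := fun n' hn' =>
        get_improve_entry (by simpa using hsize) (by omega) hmul hh hn'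
      have hch₁ : Changes [.val, .b, .ab] (fun i _ => i = j) s s₁ :=
        (hch.set (by simp)).improve (by simp [hsize]; omega) rfl
      have hS₁ : Shifted ell j h s₁ :=
        (hS'.of_changes (Changes.refl.set (vs := [.val]) (by simp))).improve (by simpa using hsize)
          hh (by omega) hmul (complexity_mul_le (by omega) (by omega))
      have hb' : s₁.vars .b = b := by simp [hs₁, hbv]
      have hab₁ : s₁.vars .ab = a * b := by simp [hs₁, hab']
      have ha₁ : s₁.vars .a = a := by simp [hs₁, ha']
      refine Run.cons (Run.assign (by simp) (by simp [hb']; omega)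
        (Run.cons (Run.assign (by simp) (by simp [hab₁, ha₁]; omega) (Run.nil ?_))))
      simp only [val_add, val_var, val_one, hb', State.vars_set, reduceCtorEq, if_false, if_true,
        hab₁, ha₁, State.get_set]
      refine ⟨⟨(hch₁.set (by simp)).set (by simp),
        hS₁.of_changes ((Changes.refl.set (vs := [.b, .ab]) (by simp)).set (by simp)),
        fun n hn => ?_, fun b' hb1' hb2' => ?_, by ring, by omega, by omega, ?_⟩, by omega⟩
      · rw [hget n hn]
        split_ifs with hnn
        · rw [hnn]
          exact (min_le_right _ _).trans (hmono _ (by omega))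
        · exact hmono n hn
      · have hgt : h - ell < a * b' := hb₀.trans_le (Nat.mul_le_mul_left _ hb1')
        rw [hget _ (by omega)]
        by_cases hbb : b' = b
        · rw [hbb, if_pos rfl]
          exact min_le_left _ _
        · have hlt := htest b' hb1' (by omega)
          split_ifs with hnn
          · rw [← hnn]
            exact (min_le_right _ _).trans hlt
          · exact hlt
      · simp only [cost_le, cost_var, cost_add, cost_sub, cost_block, cost_zero, cost_one] at *
        omega

/-- The scalars that are changed by the loop over the products. -/
def productVars : List Var := [.a, .b, .blk, .shB, .bmax, .ab, .val]

/-- A bound for the time of the loop over the products. -/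
def productTime (ell h : ℕ) : ℕ := 100 + ∑ a ∈ Finset.Ico 2 (Nat.sqrt h + 1), (200 + 60 * (ell / a))

/-- For fixed a this limits the number of cofactors b to at most ell/a + 1. -/
theorem div_le_sub_div_add {h ell a : ℕ} (ha : 0 < a) : h / a ≤ (h - ell) / a + ell / a + 1 := by
  rw [← Nat.lt_succ_iff, Nat.div_lt_iff_lt_mul ha]
  have h1 := Nat.lt_mul_div_succ (h - ell) ha
  have h2 := Nat.lt_mul_div_succ ell ha
  have h3 : ((h - ell) / a + ell / a + 1).succ * a = a * ((h - ell) / a + 1) + a * (ell / a + 1) := by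
    rw [Nat.succ_eq_add_one]
    ring
  omega

/-- For fixed a the cofactors lie between (h - ell)/a and h/a. If h/a ≤ H they are in the fixed
block; otherwise `hsrc` says that the window of B_{aj} contains them. Since aj > j, that block is
not the one being written. -/
theorem Run.products {N H ell J j h : ℕ} (hg : Good N H ell) (hm : Mem N H ell J s)
    (hj : s.vars .j = j) (hj1 : 1 ≤ j) (hjJ : j < J) (hh : H + ell ≤ h) (hhN : h ≤ N)
    (hM : 2 * N + 1 ≤ M.scalar) (hJM : J ≤ M.scalar)
    (hnew : s.vars .newH = h) (hsh : s.vars .sh = h - 2 * ell + 1)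
    (hsrc : ∀ a, 2 ≤ a → a * a ≤ h → H < h / a → a * j < J ∧ ∃ h', Block ell (a * j) h' s ∧
      h / a ≤ h' ∧ h' ≤ (h - ell) / a + 2 * ell)
    (hS : Shifted ell j h s) :
    Run M products s fun s' t => Changes productVars (fun i _ => i = j) s s' ∧ Shifted ell j h s' ∧
      (∀ a b, 2 ≤ a → a ≤ b → h < a * b + ell → a * b ≤ h →
        s'.get .B j (a * b - (h - 2 * ell + 1)) ≤ complexity a + complexity b) ∧
      t ≤ productTime ell h := by
  have h2e := hg.two_mul_le
  have hHN := hg.le_limit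
  have hep := hg.ell_pos
  refine Run.cons (Run.assign (by simp) (by simp; omega) (Run.cons ?_))
  simp only [val_two]
  have hd2 : ∀ a, (h - ell) / a ≤ h := fun a => (Nat.div_le_self _ _).trans (Nat.sub_le _ _)
  refine (Run.firstB (h := h) (ell := ell) (a := 2) (by simp [hnew]) (by simp [hm.vell]) (by simp)
    (by have := hd2 2; omega) (by omega)).mono ?_
  rintro s₁ t₁ - ⟨hch₁, hb₁, ht₁⟩
  refine Run.cons (Run.while (fun s' t => Changes productVars (fun i _ => i = j) s s' ∧
      Shifted ell j h s' ∧ 2 ≤ s'.vars .a ∧ s'.vars .a ≤ Nat.sqrt h + 1 ∧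
      s'.vars .b = max (1 + (h - ell) / s'.vars .a) (s'.vars .a) ∧
      (∀ a b, 2 ≤ a → a < s'.vars .a → a ≤ b → h < a * b + ell → a * b ≤ h →
        s'.get .B j (a * b - (h - 2 * ell + 1)) ≤ complexity a + complexity b) ∧
      t ≤ ∑ a ∈ Finset.Ico 2 (s'.vars .a), (200 + 60 * (ell / a)))
    (fun s' => Nat.sqrt h + 1 - s'.vars .a) ?_ ?_)
  · have ha₁ : s₁.vars .a = 2 := by rw [hch₁.vars _ (by decide)]; simp
    have hch : Changes productVars (fun i _ => i = j) s s₁ :=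
      (Changes.refl.set (by decide)).trans (hch₁.mono (by decide) (by simp))
    have hsq : 1 ≤ Nat.sqrt h := Nat.le_sqrt.2 (by omega)
    refine ⟨hch, ?_, by rw [ha₁], by omega, by rw [hb₁, ha₁], fun a b h1 h2 => by omega, by simp⟩
    exact (hS.of_changes (Changes.refl.set (vs := [.a]) (by decide))).of_changes hch₁
  · rintro s' t - ⟨hch, hS', ha2, hasq, hb, htest, ht⟩
    have hm' := hm.of_changes hch (by decide) (by omega)
    have hnew' : s'.vars .newH = h := by rw [hch.vars _ (by decide), hnew]
    have hj' : s'.vars .j = j := by rw [hch.vars _ (by decide), hj]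
    have hsh' : s'.vars .sh = h - 2 * ell + 1 := by rw [hch.vars _ (by decide), hsh]
    generalize hav : s'.vars .a = a at *
    refine ⟨by simp, fun hc => ?_, fun hc => ?_⟩
    -- The part a ≤ b of the test always holds, b being a maximum with a; hence the loop ends only
    -- when a² > h.
    · simp only [holds_and, holds_le, val_mul, val_var, hav, hnew', hb, le_max_right,
        and_true, not_le] at hc
      refine Run.nil ⟨hch, hS', fun a' b' h1 h2 h3 h4 => htest a' b' h1 ?_ h2 h3 h4, ?_⟩
      · by_contra! hle
        have := Nat.mul_le_mul hle (hle.trans h2)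
        omega
      · have hsub : ∑ a' ∈ Finset.Ico 2 a, (200 + 60 * (ell / a')) ≤
            ∑ a' ∈ Finset.Ico 2 (Nat.sqrt h + 1), (200 + 60 * (ell / a')) :=
          Finset.sum_le_sum_of_subset (Finset.Ico_subset_Ico le_rfl hasq)
        unfold productTime
        simp only [cost_and, cost_le, cost_mul, cost_var, cost_two]
        omega
    · simp only [holds_and, holds_le, val_mul, val_var, hav, hnew', hb, le_max_right, and_true] at hc
      have haa : a ≤ Nat.sqrt h := Nat.le_sqrt.2 hc
      -- This uses a² ≤ h ≤ N ≤ ell · H ≤ H², so ‖a‖ can always be read from the fixed block.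
      have haH : a ≤ H := by
        by_contra! hlt
        have h1 := Nat.mul_le_mul hlt hlt
        have h2 : ell * H ≤ H * H := Nat.mul_le_mul_right _ (by omega)
        have h3 := hg.limit_le
        rw [Nat.succ_eq_add_one, show (H + 1) * (H + 1) = H * H + 2 * H + 1 by ring] at h1
        omega
      have hha : h / a ≤ h := Nat.div_le_self _ _
      have ham : a ≤ h := (Nat.le_mul_self a).trans hc
      set b₀ := max (1 + (h - ell) / a) a with hb₀def
      have hb₀ : h - ell < a * b₀ := by
        have h1 := Nat.lt_mul_div_succ (h - ell) (show 0 < a by omega)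
        have h2 : a * ((h - ell) / a + 1) ≤ a * b₀ := Nat.mul_le_mul_left _ (by omega)
        omega
      have hd := hd2 a
      have hsel : Run M (.ite (.le (Var.newH / Var.a) Var.H)
          (prog [.assign .blk 0, .assign .shB 0])
          (prog [.assign .blk (Var.a * Var.j),
            .assign .shB (Fuller.head (Var.a * Var.j) - Var.L + 1)])) s' fun s'' t =>
          Changes [.blk, .shB] (fun _ _ => False) s' s'' ∧ s''.vars .blk ≠ j ∧
          (∀ b, b₀ ≤ b → b ≤ h / a → b - s''.vars .shB < s''.size .B (s''.vars .blk) ∧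
            s''.get .B (s''.vars .blk) (b - s''.vars .shB) = complexity b) ∧ t ≤ 40 := by
        refine Run.ite (by simp) (fun hc' => ?_) fun hc' => ?_
        · simp only [holds_le, val_div, val_var, hnew', hav, hm'.vH] at hc'
          refine Run.cons (Run.assign (by simp) (by simp)
            (Run.cons (Run.assign (by simp) (by simp) (Run.nil ?_))))
          refine ⟨(Changes.refl.set (by simp)).set (by simp), by simp; omega, fun b h1 h2 => ?_, by simp⟩
          simp only [val_zero, State.vars_set, reduceCtorEq, if_true, if_false, State.size_set,
            State.get_set, Nat.sub_zero, hm'.size_fixed]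
          exact ⟨by omega, hm'.get_fixed b (by omega) (by omega)⟩
        · simp only [holds_le, val_div, val_var, hnew', hav, hm'.vH, not_le] at hc'
          obtain ⟨haj, h', hbk, hh1, hh2⟩ := hsrc a ha2 hc hc'
          have haj1 : j < a * j := by
            have := Nat.mul_le_mul_right j ha2
            omega
          have hbk' := hbk.of_changes hch (by omega)
          have hle' := hbk'.le_head
          have hh'N : h' ≤ 2 * N := by omega
          refine Run.cons (Run.assign (by simp) (by simp [hav, hj']; omega)
            (Run.cons (Run.assign ?_ ?_ (Run.nil ?_))))
          · simp [hav, hj', hm'.size_head _ haj]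
          · simp [hav, hj', hbk'.head, hm'.vL]
            omega
          refine ⟨(Changes.refl.set (by simp)).set (by simp), ?_, fun b h1 h2 => ?_, by simp⟩
          · simp [hav, hj']
            omega
          · simp only [val_mul, val_var, hav, hj', val_add, val_sub, val_head, val_one,
              State.vars_set, reduceCtorEq, if_true, if_false, State.size_set,
              State.get_set, hbk'.head, hm'.vL, hm'.size_block _ (by omega) haj]
            exact ⟨by omega, hbk'.get b (by omega) (by omega)⟩
      refine Run.cons (hsel.mono ?_)
      rintro s₂ t₂ - ⟨hch₂, hblj, hread, ht₂⟩
      have hnew₂ : s₂.vars .newH = h := by rw [hch₂.vars _ (by decide), hnew']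
      have hav₂ : s₂.vars .a = a := by rw [hch₂.vars _ (by decide), hav]
      have hb₂ : s₂.vars .b = b₀ := by rw [hch₂.vars _ (by decide), hb]
      refine Run.cons (Run.assign (by simp) (by simp [hnew₂, hav₂]; omega)
        (Run.cons (Run.assign (by simp) ?_ (Run.cons ?_))))
      · simp only [val_mul, val_var, State.vars_set, reduceCtorEq, if_false, hav₂, hb₂]
        rcases max_choice (1 + (h - ell) / a) a with h1 | h1
        · rw [hb₀def, h1, mul_add, mul_one]
          have := Nat.mul_div_le (h - ell) a
          omega
        · rw [hb₀def, h1]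
          omega
      simp only [val_mul, val_div, val_var, State.vars_set, reduceCtorEq, if_false, hav₂, hb₂, hnew₂]
      set s₃ := (s₂.set .bmax (h / a)).set .ab (a * b₀) with hs₃
      have hch₃ : Changes productVars (fun _ _ => False) s' s₃ :=
        ((hch₂.mono (by decide) (by simp)).set (by decide)).set (by decide)
      refine (Run.productLoop (a := a) (b₀ := b₀) (bl := s₂.vars .blk) (sb := s₂.vars .shB) hg
        (hm'.of_changes hch₃ (by decide) (by simp)) ?_ hj1 hjJ (by omega) hhN hM ?_ ?_ ha2 haH ?_ hb₀
        (by omega) ?_ ?_ ?_ ?_ hblj ?_ (hS'.of_changes hch₃)).mono ?_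
      · rw [hch₃.vars _ (by decide), hj']
      · rw [hch₃.vars _ (by decide), hsh']
      · simp [hs₃, hav₂]
      · simp [hs₃, hb₂]
      · simp [hs₃]
      · simp [hs₃]
      · simp [hs₃]
      · simp [hs₃]
      · exact hread
      rintro s₄ t₄ - ⟨hch₄, hS₄, hmono, htest₄, ht₄⟩
      have hch₄' : Changes productVars (fun i _ => i = j) s' s₄ :=
        (hch₃.mono (List.Subset.refl _) (by simp)).trans (hch₄.mono (by decide) fun _ _ h => h)
      have hav₄ : s₄.vars .a = a := by rw [hch₄.vars _ (by decide)]; simp [hs₃, hav₂]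
      have hget₃ : s₃.get = s'.get := by
        funext r i k
        rw [hch₃.get _ _ _ (by simp)]
      refine Run.cons (Run.assign (by simp) (by simp [hav₄]; omega) (Run.cons ?_))
      simp only [val_add, val_var, val_one, hav₄]
      have hd' := hd2 (a + 1)
      refine (Run.firstB (h := h) (ell := ell) (a := a + 1) ?_ ?_ (by simp) (by omega)
        (by omega)).mono ?_
      · simp [hch₄'.vars .newH (by decide), hnew']
      · simp [hch₄'.vars .ell (by decide), hm'.vell]
      rintro s₅ t₅ - ⟨hch₅, hb₅, ht₅⟩
      have hch₅' : Changes [.a, .b] (fun _ _ => False) s₄ s₅ :=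
        (Changes.refl.set (by simp)).trans (hch₅.mono (by simp) (by simp))
      have hav₅ : s₅.vars .a = a + 1 := by rw [hch₅.vars _ (by decide)]; simp
      refine Run.nil ⟨⟨(hch.trans hch₄').trans (hch₅'.mono (by decide) (by simp)),
        hS₄.of_changes hch₅', by omega, by omega, by rw [hb₅, hav₅], ?_, ?_⟩, by omega⟩
      · intro a' b' h1 h2 h3 h4 h5
        rw [hav₅] at h2
        rw [hch₅'.get _ _ _ (by simp)]
        rcases Nat.lt_or_ge a' a with h6 | h6
        · refine (hmono _ (by omega)).trans ?_
          rw [hget₃]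
          exact htest a' b' h1 h6 h3 h4 h5
        · obtain rfl : a' = a := by omega
          refine htest₄ b' ?_ ?_
          · refine max_le ?_ h3
            rw [add_comm]
            exact (Nat.div_lt_iff_lt_mul (by omega)).2 (by rw [mul_comm]; omega)
          · exact (Nat.le_div_iff_mul_le (by omega)).2 (by rw [mul_comm]; exact h5)
      · rw [hav₅, Finset.sum_Ico_succ_top ha2]
        have h1 := div_le_sub_div_add (h := h) (ell := ell) (show 0 < a by omega)
        have h0 := Nat.zero_le (ell / a)
        have h2 : h / a + 1 - b₀ ≤ ell / a + 1 := by omega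
        simp only [cost_and, cost_le, cost_mul, cost_var, cost_div, cost_add, cost_one]
        omega

/-! ### The sums -/

/-- The bound kMax ≤ ell requires 2^S ≤ n^3 for the value S stored before any further sums are
tested, not just for ‖n‖. Two tests already provide it: 2 · (n/2) for even n, and (n - 1) + 1 for
odd n, both giving S ≤ ‖⌊n/2⌋‖ + 3. -/
theorem two_pow_le_of_le {n S : ℕ} (hn : 4 ≤ n) (h1 : S ≤ complexity (n - 1) + 1)
    (h2 : ∀ b, 2 * b = n → S ≤ complexity 2 + complexity b) : 2 ^ S ≤ n ^ 3 := by
  have hk := two_pow_complexity_le (n := n / 2) (by omega)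
  have hc2 : complexity 2 ≤ 2 := complexity_le_self (by norm_num)
  have hS : S ≤ complexity (n / 2) + 3 := by
    rcases Nat.mod_two_eq_zero_or_one n with h | h
    · have := h2 (n / 2) (by omega)
      omega
    · have h3 := complexity_mul_le (a := 2) (b := n / 2) (by norm_num) (by omega)
      rw [show 2 * (n / 2) = n - 1 by omega] at h3
      omega
  calc 2 ^ S ≤ 2 ^ (complexity (n / 2) + 3) := Nat.pow_le_pow_right (by norm_num) hS
    _ = 2 ^ complexity (n / 2) * 8 := by rw [pow_add]; norm_num
    _ ≤ (n / 2) ^ 3 * 8 := Nat.mul_le_mul_right _ hk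
    _ = (2 * (n / 2)) ^ 3 := by ring
    _ ≤ n ^ 3 := Nat.pow_le_pow_left (by omega) 3

/-- The scalars that are changed by the loop over the sums, except for `n`. -/
def sumVars : List Var := [.val, .target, .m] ++ kMaxVars

/-- A bound for the time of the step `n` of the loop over the sums. -/
noncomputable def sumStepTime (N n : ℕ) : ℕ :=
  200 + 100 * (Nat.size (N ^ 3) + 1) ^ 2 + 60 * summandBound n

/-- The state of the block `j` with head `h` in the loop over the sums: the entries below `e` are
correct, and all products have been tested. -/
structure Partial (ell j h e : ℕ) (s : State) : Prop where
  head : s.get .Heads j 0 = h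
  exact : ∀ n, h < n + 2 * ell → n < e → n ≤ h → s.get .B j (n - (h - 2 * ell + 1)) = complexity n
  lower : ∀ n, h < n + ell → n ≤ h → complexity n ≤ s.get .B j (n - (h - 2 * ell + 1))
  prod : ∀ a b, 2 ≤ a → a ≤ b → h < a * b + ell → a * b ≤ h →
    s.get .B j (a * b - (h - 2 * ell + 1)) ≤ complexity a + complexity b

theorem Run.sumStep {N H ell J j h n : ℕ} (hg : Good N H ell) (hm : Mem N H ell J s)
    (hj : s.vars .j = j) (hj1 : 1 ≤ j) (hjJ : j < J) (hh : H + ell ≤ h) (hhN : h ≤ N)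
    (hM : N + 6 ≤ M.scalar) (hM3 : N ^ 3 ≤ M.scalar)
    (hsh : s.vars .sh = h - 2 * ell + 1) (hn : s.vars .n = n) (hn1 : h < n + ell) (hn2 : n ≤ h)
    (hP : Partial ell j h n s) :
    Run M (prog [
      .assign .val (block Var.j (Var.n - 1 - Var.sh) + 1),
      Fuller.improve Var.j (Var.n - Var.sh),
      .assign .target (block Var.j (Var.n - Var.sh)),
      Fuller.codeKMax,
      Fuller.forUp .m 6 (.le Var.m Var.kMax) [
        .assign .val (block 0 Var.m + block Var.j (Var.n - Var.m - Var.sh)),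
        Fuller.improve Var.j (Var.n - Var.sh)]]) s fun s' t =>
      Changes sumVars (fun i _ => i = j) s s' ∧ Partial ell j h (n + 1) s' ∧
      t ≤ sumStepTime N n := by
  have h2e := hg.two_mul_le
  have hHN := hg.le_limit
  have hep := hg.two_le
  have hsize := hm.size_block j hj1 hjJ
  have hpred : s.get .B j (n - 1 - (h - 2 * ell + 1)) = complexity (n - 1) :=
    hP.exact _ (by omega) (by omega) (by omega)
  have hcn := complexity_le_self (n := n - 1) (by omega)
  have hval : (block Var.j (Var.n - 1 - Var.sh) + 1 : Expr).val s = complexity (n - 1) + 1 := by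
    simp [hn, hsh, hj, hpred]
  refine Run.cons (Run.assign (by simp [hn, hsh, hj, hsize]; omega) (by rw [hval]; omega) ?_)
  rw [hval]
  have hlt₁ : n - (h - 2 * ell + 1) < (s.set .val (complexity (n - 1) + 1)).size .B j := by
    simp [hsize]
    omega
  refine Run.cons (Run.improve (by simp) (by simp) (by simpa [hn, hsh, hj] using hlt₁)
    fun t₁ ht₁ => ?_)
  simp only [val_sub, val_var, State.vars_set, reduceCtorEq, if_false, if_true, hn, hsh, hj]
  set s₁ := (s.set .val (complexity (n - 1) + 1)).improve j (n - (h - 2 * ell + 1))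
    (complexity (n - 1) + 1) with hs₁
  set S := min (complexity (n - 1) + 1) (s.get .B j (n - (h - 2 * ell + 1))) with hSdef
  have hg₁ : ∀ n', h < n' + 2 * ell → s₁.get .B j (n' - (h - 2 * ell + 1)) =
      if n' = n then S else s.get .B j (n' - (h - 2 * ell + 1)) := fun n' hn' =>
    get_improve_entry (by simpa using hsize) (by omega) hn2 (by omega) hn'
  have hch₁ : Changes sumVars (fun i _ => i = j) s s₁ :=
    (Changes.refl.set (by decide)).improve hlt₁ rfl
  have hm₁ := hm.of_changes hch₁ (by decide) (by omega)
  have hn₁ : s₁.vars .n = n := by rw [hch₁.vars _ (by decide), hn]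
  have hj₁ : s₁.vars .j = j := by rw [hch₁.vars _ (by decide), hj]
  have hsh₁ : s₁.vars .sh = h - 2 * ell + 1 := by rw [hch₁.vars _ (by decide), hsh]
  have htv : (block Var.j (Var.n - Var.sh) : Expr).val s₁ = S := by
    simp [hn₁, hj₁, hsh₁, hg₁ n (by omega)]
  have hSle : S ≤ complexity (n - 1) + 1 := min_le_left _ _
  have hcS : complexity n ≤ S := by
    refine le_min ?_ (hP.lower n hn1 hn2)
    have h2 := complexity_succ_le (n := n - 1) (by omega)
    rwa [show n - 1 + 1 = n by omega] at h2
  refine Run.cons (Run.assign ?_ (by rw [htv]; omega) ?_)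
  · simp only [ok_block, ok_var, ok_sub, val_sub, val_var, hn₁, hj₁, hsh₁, hch₁.size, hsize, true_and,
      and_self]
    omega
  rw [htv]
  -- The product with factor 2 has been tested, because the products precede the sums.
  have h2p : 2 ^ S ≤ n ^ 3 := by
    refine two_pow_le_of_le (by omega) hSle fun b hb => ?_
    have := hP.prod 2 b le_rfl (by omega) (by omega) (by omega)
    rw [hb] at this
    exact (min_le_right _ _).trans this
  have hsq := maxValue_le_sq h2p
  have hsqM : n ^ 2 ≤ M.scalar := (Nat.pow_le_pow_left (hn2.trans hhN) 2).trans
    ((Nat.pow_le_pow_right (by omega) (by norm_num)).trans hM3)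
  refine Run.cons ((Run.codeKMax (n := n) (S := S) (by simp [hn₁]) (by simp)
    (by have := le_maxValue_complexity (n := n) (by omega); have := maxValue_mono hcS; omega)
    (by omega) (hsq.trans hsqM)).mono ?_)
  rintro s₂ t₂ - ⟨ha₂, ho₂, ⟨u, hu, hK⟩, hv₂, ht₂⟩
  have hch₂ : Changes sumVars (fun i _ => i = j) s s₂ :=
    (hch₁.set (v := .target) (x := S) (by decide)).trans
      (Changes.of_arrs ha₂ ho₂ fun v hv => hv₂ v fun h => hv (by simp [sumVars, h]))
  have hg₂ : s₂.get = s₁.get := (State.get_eq_of_arrs_eq ha₂).trans State.get_set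
  have hn₂ : s₂.vars .n = n := by rw [hch₂.vars _ (by decide), hn]
  have hj₂ : s₂.vars .j = j := by rw [hch₂.vars _ (by decide), hj]
  have hsh₂ : s₂.vars .sh = h - 2 * ell + 1 := by rw [hch₂.vars _ (by decide), hsh]
  have hm₂ := hm.of_changes hch₂ (by decide) (by omega)
  -- As n lies in the upper half of the window and m ≤ ell, the entry for n - m is still inside the
  -- window.
  have hKl : maxValue u ≤ ell := hg.cut_le n S u (by omega) hu h2p
  refine Run.cons ((Run.sumLoop (jb := j) (q := n - (h - 2 * ell + 1)) (n := n)
    (f := fun m => n - m - (h - 2 * ell + 1)) hK (by omega) (by omega)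
    (fun s' hs' => ?_) (by rw [hm₂.size_block j hj1 hjJ]; omega) ?_ ?_).mono ?_)
  · refine ⟨by simp, by simp, by simp, ?_, ?_, ?_⟩
    · simp [hs' .j (by decide), hj₂]
    · simp [hs' .n (by decide), hn₂, hs' .sh (by decide), hsh₂]
    · simp [hs' .n (by decide), hn₂, hs' .sh (by decide), hsh₂]
  · intro m h6 hmK
    rw [hm₂.size_block j hj1 hjJ, hm₂.size_fixed]
    refine ⟨by omega, by omega, by omega, by omega, hm₂.get_fixed m (by omega) (by omega), ?_⟩
    rw [hg₂, hg₁ _ (by omega), if_neg (by omega)]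
    exact hP.exact _ (by omega) (by omega) (by omega)
  · rw [hg₂, hg₁ n (by omega), if_pos rfl]
    exact hcS
  rintro s₃ t₃ - ⟨hch₃, hlow₃, hup₃, hall₃, ht₃⟩
  rw [hg₂, hg₁ n (by omega), if_pos rfl] at hup₃
  have hch : Changes sumVars (fun i _ => i = j) s s₃ :=
    hch₂.trans (hch₃.mono (by decide) fun i k h => h.1)
  have hold : S ≤ s.get .B j (n - (h - 2 * ell + 1)) := min_le_right _ _
  have hex : s₃.get .B j (n - (h - 2 * ell + 1)) = complexity n := by
    refine hu.eq_complexity (by omega) hlow₃ (hup₃.trans hSle) (by omega)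
      (fun m h6 hm _ => hall₃ m h6 hm) fun a b ha hab hmul => ?_
    have h1 := hP.prod a b ha hab (by omega) (by omega)
    rw [hmul] at h1
    omega
  have hg₃ : ∀ n', h < n' + 2 * ell → n' ≠ n →
      s₃.get .B j (n' - (h - 2 * ell + 1)) = s.get .B j (n' - (h - 2 * ell + 1)) := by
    intro n' h1 h2
    rw [hch₃.get _ _ _ (by simp; omega), hg₂, hg₁ n' h1, if_neg h2]
  refine Run.nil ⟨hch, ⟨?_, fun n' h1 h2 h3 => ?_, fun n' h1 h2 => ?_,
    fun a b ha hab h1 h2 => ?_⟩, ?_⟩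
  · rw [hch.get _ _ _ (by simp), hP.head]
  · rcases eq_or_ne n' n with rfl | hne
    · exact hex
    · rw [hg₃ n' h1 hne]
      exact hP.exact n' h1 (by omega) h3
  · rcases eq_or_ne n' n with rfl | hne
    · exact hex.ge
    · rw [hg₃ n' (by omega) hne]
      exact hP.lower n' h1 h2
  · rcases eq_or_ne (a * b) n with heq | hne
    · rw [heq, hex, ← heq]
      exact complexity_mul_le (by omega) (by omega)
    · rw [hg₃ _ (by omega) hne]
      exact hP.prod a b ha hab h1 h2
  · have h1 := hu.le_summandBound (by omega) hSle
    have h2 : S ≤ Nat.size (N ^ 3) := by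
      have h3 : 2 ^ S ≤ N ^ 3 := h2p.trans (Nat.pow_le_pow_left (by omega) 3)
      exact (Nat.lt_size.2 h3).le
    have h3 : 100 * (S + 1) ^ 2 ≤ 100 * (Nat.size (N ^ 3) + 1) ^ 2 := by gcongr
    simp only [cost_add, cost_sub, cost_block, cost_var, cost_one] at ht₁ ht₂ ht₃ ⊢
    have h4 := Nat.mul_le_mul_left 60 h1
    have h5 : (3 * 1 + (1 + 1 + 1 + 1 + 1) + 2 * (1 + 1 + 1) + 30) * maxValue u ≤
      60 * maxValue u := Nat.mul_le_mul_right _ (by norm_num)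
    unfold sumStepTime
    omega

theorem Run.sums {N H ell J j h : ℕ} (hg : Good N H ell) (hm : Mem N H ell J s)
    (hj : s.vars .j = j) (hj1 : 1 ≤ j) (hjJ : j < J) (hh : H + ell ≤ h) (hhN : h ≤ N)
    (hM : N + 6 ≤ M.scalar) (hM3 : N ^ 3 ≤ M.scalar)
    (hnew : s.vars .newH = h) (hsh : s.vars .sh = h - 2 * ell + 1) (hS : Shifted ell j h s)
    (hprod : ∀ a b, 2 ≤ a → a ≤ b → h < a * b + ell → a * b ≤ h →
        s.get .B j (a * b - (h - 2 * ell + 1)) ≤ complexity a + complexity b) :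
    Run M sums s fun s' t => Changes (.n :: sumVars) (fun i _ => i = j) s s' ∧
      Block ell j h s' ∧
      t ≤ 20 + ∑ n ∈ Finset.Ico (h - ell + 1) (h + 1), (sumStepTime N n + 8) := by
  have h2e := hg.two_mul_le
  have hep := hg.ell_pos
  refine Run.forUp (fun n s' => Changes (.n :: sumVars) (fun i _ => i = j) s s' ∧
      Partial ell j h n s') (sumStepTime N) (h - ell + 1) (h + 1) (by simp)
    (by simp [hnew, hm.vell]) (by omega) (by omega) ?_ ?_ ?_ ?_
  · exact ⟨Changes.refl.set (by simp), hS.head, fun n h1 h2 h3 => hS.lower n h1 (by omega),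
      fun n h1 h2 => hS.upper n h1 h2, hprod⟩
  · rintro i s' h1 h2 ⟨hch, -⟩ hi
    refine ⟨by simp, ?_⟩
    simp only [holds_le, val_var, hi, hch.vars .newH (by decide), hnew]
    omega
  · rintro i s' h1 h2 ⟨hch, hP⟩ hi
    refine (Run.sumStep hg (hm.of_changes hch (by decide) (by omega)) ?_ hj1 hjJ hh hhN hM hM3 ?_ hi
      (by omega) (by omega) hP).mono ?_
    · rw [hch.vars _ (by decide), hj]
    · rw [hch.vars _ (by decide), hsh]
    · rintro s'' t - ⟨hch', hP', ht'⟩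
      exact ⟨by rw [hch'.vars _ (by decide), hi],
        ⟨(hch.trans (hch'.mono (by simp) fun _ _ h => h)).set (by simp), hP'.head, hP'.exact,
          hP'.lower, hP'.prod⟩, ht'⟩
  · rintro s' t ⟨hch, hP⟩ - ht
    refine ⟨hch, ⟨hP.head, by omega, fun n h1 h2 => hP.exact n h1 (by omega) h2⟩, ?_⟩
    simp only [cost_add, cost_sub, cost_var, cost_one, cost_le] at ht
    have hsum : ∑ i ∈ Finset.Ico (h - ell + 1) (h + 1), (sumStepTime N i + (1 + 1 + 1) + 5) =
      ∑ i ∈ Finset.Ico (h - ell + 1) (h + 1), (sumStepTime N i + 8) := rfl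
    omega

/-! ### Heads of the running blocks -/

/-- `⌈u / j⌉`. -/
def cdiv (u j : ℕ) : ℕ := (u + j - 1) / j

/-- The adjunction between ceiling division and multiplication, from which the facts on heads are
derived. -/
theorem cdiv_le_iff {u j w : ℕ} (hj : 0 < j) : cdiv u j ≤ w ↔ u ≤ j * w := by
  rw [cdiv, ← Nat.lt_succ_iff, Nat.div_lt_iff_lt_mul hj, Nat.succ_eq_add_one, add_mul, one_mul,
    mul_comm w]
  omega

theorem lt_cdiv_iff {u j w : ℕ} (hj : 0 < j) : w < cdiv u j ↔ j * w < u := by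
  rw [← not_le, cdiv_le_iff hj, not_le]

theorem le_mul_cdiv {u j : ℕ} (hj : 0 < j) : u ≤ j * cdiv u j := (cdiv_le_iff hj).1 le_rfl

theorem cdiv_mul_mul {u j ell : ℕ} (hj : 0 < j) (hell : 0 < ell) :
    cdiv (u * ell) (j * ell) = cdiv u j := by
  refine eq_of_forall_ge_iff fun w => ?_
  rw [cdiv_le_iff (Nat.mul_pos hj hell), cdiv_le_iff hj, mul_right_comm]
  exact Nat.mul_le_mul_right_iff hell

/-- Nested ceilings collapse; this is why B_{aj} has its head where the products for B_j need it. -/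
theorem cdiv_cdiv {u j a : ℕ} (hj : 0 < j) (ha : 0 < a) : cdiv (cdiv u j) a = cdiv u (a * j) := by
  refine eq_of_forall_ge_iff fun w => ?_
  rw [cdiv_le_iff ha, cdiv_le_iff hj, cdiv_le_iff (Nat.mul_pos ha hj), mul_comm a j, mul_assoc]

/-- A head moves by at most one step when the main head does, so a single shift by ell suffices. -/
theorem cdiv_succ {u j : ℕ} (hj : 0 < j) :
    cdiv (u + 1) j = cdiv u j ∨ cdiv (u + 1) j = cdiv u j + 1 := by
  have h1 : cdiv u j ≤ cdiv (u + 1) j :=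
    (cdiv_le_iff hj).2 ((Nat.le_succ u).trans (le_mul_cdiv hj))
  have h2 : cdiv (u + 1) j ≤ cdiv u j + 1 := by
    rw [cdiv_le_iff hj, mul_add]
    have := le_mul_cdiv (u := u) hj
    omega
  omega

theorem cdiv_one (u : ℕ) : cdiv u 1 = u := by simp [cdiv]

/-- With v = H/ell: the head of a running block that is needed is at least H. -/
theorem le_cdiv_of_mul_lt {u j v : ℕ} (hj : 0 < j) (h : j * v < u + 1) : v ≤ cdiv u j := by
  rcases Nat.eq_zero_or_pos v with rfl | hv
  · exact Nat.zero_le _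
  · have h1 : v - 1 < cdiv u j := by
      rw [lt_cdiv_iff hj]
      have h2 : j * (v - 1) + j = j * v := by
        rw [← Nat.mul_succ, Nat.succ_eq_add_one, Nat.sub_add_cancel hv]
      omega
    omega

/-! ### Advancing a running block -/

/-- A bound for the time of moving a block to the head `ell * w`. -/
noncomputable def advanceTime (N ell w : ℕ) : ℕ :=
  500 + 300 * ell + productTime ell (ell * w) +
    ∑ n ∈ Finset.Ico (ell * w - ell + 1) (ell * w + 1), (sumStepTime N n + 8)

/-- The first complexities. -/
noncomputable def complexities (n : ℕ) : List ℕ := (List.range n).map fun i => complexity (i + 1)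

theorem complexities_succ (n : ℕ) : complexities (n + 1) = complexities n ++ [complexity (n + 1)] := by
  simp [complexities, List.range_succ]

theorem Run.printBlock {N H ell J h : ℕ} (hg : Good N H ell) (hm : Mem N H ell J s)
    (hJ : 1 < J) (hh : H + ell ≤ h) (hhN : h ≤ N) (hM : N + 1 ≤ M.scalar)
    (hnew : s.vars .newH = h) (hsh : s.vars .sh = h - 2 * ell + 1) (hb : Block ell 1 h s)
    (hout : s.out = complexities (h - ell)) :
    Run M (Fuller.forUp .n (Var.newH - Var.ell + 1) (.le Var.n Var.newH) [
        .print (block 1 (Var.n - Var.sh))]) s fun s' t =>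
      (∀ v, v ≠ .n → s'.vars v = s.vars v) ∧ s'.arrs = s.arrs ∧ s'.out = complexities h ∧
      t ≤ 20 + 20 * ell := by
  have h2e := hg.two_mul_le
  have hep := hg.ell_pos
  refine Run.forUp (fun n s' => (∀ v, v ≠ .n → s'.vars v = s.vars v) ∧ s'.arrs = s.arrs ∧
      s'.out = complexities (n - 1)) (fun _ => 10) (h - ell + 1) (h + 1) (by simp)
    (by simp [hnew, hm.vell]) (by omega) (by omega) ?_ ?_ ?_ ?_
  · refine ⟨fun v hv => by simp [hv], rfl, ?_⟩
    rw [State.out_set, hout, Nat.add_sub_cancel]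
  · rintro i s' h1 h2 ⟨hv, -⟩ hi
    refine ⟨by simp, ?_⟩
    simp only [holds_le, val_var, hi, hv .newH (by decide), hnew]
    omega
  · rintro i s' h1 h2 ⟨hv, ha, ho⟩ hi
    have hsh' : s'.vars .sh = h - 2 * ell + 1 := by rw [hv _ (by decide), hsh]
    have hval : (block 1 (Var.n - Var.sh) : Expr).val s' = complexity i := by
      simp only [val_block, val_one, val_sub, val_var, hi, hsh', State.get_eq_of_arrs_eq ha]
      exact hb.get i (by omega) (by omega)
    refine Run.cons (Run.print ?_ (Run.nil ?_))
    · simp only [ok_block, ok_one, ok_sub, ok_var, val_one, val_sub, val_var, hi, hsh',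
        State.size_eq_of_arrs_eq ha, hm.size_block 1 le_rfl hJ, true_and, and_self]
      omega
    · rw [hval]
      refine ⟨by simp [hi], ⟨fun v hv' => by simp [hv', hv v hv'], by simp [ha], ?_⟩, by simp⟩
      rw [State.out_set, State.out_print, ho, Nat.add_sub_cancel]
      conv_rhs => rw [show i = i - 1 + 1 by omega]
      rw [complexities_succ, show i - 1 + 1 = i by omega]
  · rintro s' t ⟨hv, ha, ho⟩ - ht
    refine ⟨hv, ha, by simpa using ho, ?_⟩
    simp only [Finset.sum_const, Nat.card_Ico, smul_eq_mul, cost_add, cost_sub, cost_var, cost_one,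
      cost_le] at ht
    omega

/-- The blocks in the loop over `j`: those above `j` have been moved. -/
def Blocks (ell u j J : ℕ) (s : State) : Prop :=
  ∀ i, 1 ≤ i → i < J → Block ell i (ell * if j < i then cdiv (u + 1) i else cdiv u i) s

/-- In units of ell the main head goes from u to u + 1 and the head of B_j to w = ⌈(u + 1)/j⌉. A
source block B_{aj} has been moved before, as j descends, so its head is ⌈w/a⌉. The main task is to
verify that its window contains all cofactors. -/
theorem Run.advance {N H ell J j u v : ℕ} (hg : Good N H ell) (hHv : H = v * ell)
    (hm : Mem N H ell J s) (hJ : J = cdiv (u + 1) v) (hj : s.vars .j = j) (hj1 : 1 ≤ j)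
    (hju : v * j < u + 1) (huN : (u + 1) * ell ≤ N)
    (hM : 2 * N + 10 ≤ M.scalar) (hM3 : N ^ 3 ≤ M.scalar)
    (hnew : s.vars .newH = ell * cdiv (u + 1) j) (hstep : cdiv (u + 1) j = cdiv u j + 1)
    (hB : Blocks ell u j J s) (hout : s.out = complexities (u * ell)) :
    Run M (prog [
        Fuller.shift,
        .assign .sh (Var.newH - Var.L + 1),
        Fuller.products,
        Fuller.sums,
        Fuller.ifThen (.le Var.j 1) [
          Fuller.forUp .n (Var.newH - Var.ell + 1) (.le Var.n Var.newH) [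
            .print (block 1 (Var.n - Var.sh))]]]) s fun s' t =>
      Mem N H ell J s' ∧ Blocks ell u (j - 1) J s' ∧ s'.vars .j = j ∧ s'.vars .h = s.vars .h ∧
      s'.out = (if j = 1 then complexities ((u + 1) * ell) else complexities (u * ell)) ∧
      t ≤ advanceTime N ell (cdiv (u + 1) j) := by
  have h2e := hg.two_mul_le
  have hHN := hg.le_limit
  have hep := hg.ell_pos
  have hv : 0 < v := by
    rcases Nat.eq_zero_or_pos v with rfl | h
    · omega
    · exact h
  have hjJ : j < J := by rw [hJ, lt_cdiv_iff hv]; exact hju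
  set w := cdiv (u + 1) j with hw
  have hvw : v ≤ cdiv u j := le_cdiv_of_mul_lt hj1 (by rwa [mul_comm])
  have hbj := hB j hj1 hjJ
  rw [if_neg (lt_irrefl j)] at hbj
  have hwl : ell * w = ell * cdiv u j + ell := by rw [hstep]; ring
  have hwu : w ≤ u + 1 := (cdiv_le_iff hj1).2 (Nat.le_mul_of_pos_left _ hj1)
  have hwN : ell * w ≤ N := by
    rw [mul_comm]
    exact (Nat.mul_le_mul_right _ hwu).trans huN
  have hHw : H + ell ≤ ell * w := by
    rw [hwl, hHv, mul_comm v]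
    exact Nat.add_le_add_right (Nat.mul_le_mul_left _ hvw) _
  refine Run.cons ((Run.shift hg hm hj hj1 hjJ (by omega) hbj (by omega)).mono ?_)
  rintro s₁ t₁ - ⟨hm₁, hS₁, hbl₁, hv₁, ho₁, ht₁⟩
  rw [← hwl] at hS₁
  have hnew₁ : s₁.vars .newH = ell * w := by rw [hv₁ _ (by decide), hnew]
  refine Run.cons (Run.assign (by simp) (by simp [hnew₁, hm₁.vL]; omega) ?_)
  simp only [val_add, val_sub, val_var, val_one, hnew₁, hm₁.vL]
  set s₂ := s₁.set .sh (ell * w - 2 * ell + 1) with hs₂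
  have hch₂ : Changes [.sh] (fun _ _ => False) s₁ s₂ := Changes.refl.set (by simp)
  have hm₂ := hm₁.of_changes hch₂ (by decide) (by simp)
  have hj₂ : s₂.vars .j = j := by rw [hch₂.vars _ (by decide), hv₁ _ (by decide), hj]
  have hbl₂ : ∀ i h', i ≠ j → Block ell i h' s → Block ell i h' s₂ := fun i h' hi hb =>
    (hbl₁ i h' hi hb).of_changes hch₂ (by simp)
  refine Run.cons ((Run.products hg hm₂ hj₂ hj1 hjJ hHw hwN (by omega) ?_ ?_ ?_ ?_
    (hS₁.of_changes hch₂)).mono ?_)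
  · have : J ≤ N := by
      rw [hJ, cdiv_le_iff hv]
      have h1 : u + 1 ≤ (u + 1) * ell := Nat.le_mul_of_pos_right _ hep
      have h2 : N ≤ v * N := Nat.le_mul_of_pos_left _ hv
      omega
    omega
  · rw [hch₂.vars _ (by decide), hnew₁]
  · simp [hs₂]
  · intro a ha2 haa hlt
    have hav : a * v < w := by
      have h1 : H + 1 ≤ ell * w / a := hlt
      rw [Nat.le_div_iff_mul_le (by omega)] at h1
      have h2 : ell * (a * v) < ell * w := by
        have : (H + 1) * a = ell * (a * v) + a := by rw [hHv]; ring
        omega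
      exact lt_of_mul_lt_mul_left h2 (Nat.zero_le _)
    have hajJ : a * j < J := by
      rw [hJ, lt_cdiv_iff hv]
      rw [hw, lt_cdiv_iff hj1] at hav
      calc v * (a * j) = j * (a * v) := by ring
        _ < u + 1 := hav
    have hjaj : j < a * j := by
      have := Nat.mul_le_mul_right j ha2
      omega
    refine ⟨hajJ, ell * cdiv (u + 1) (a * j), ?_, ?_, ?_⟩
    · have := hB (a * j) (by omega) hajJ
      rw [if_pos hjaj] at this
      exact hbl₂ _ _ (by omega) this
    · rw [← cdiv_cdiv hj1 (by omega : 0 < a), ← hw]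
      refine Nat.div_le_of_le_mul ?_
      calc ell * w ≤ ell * (a * cdiv w a) := Nat.mul_le_mul_left _ (le_mul_cdiv (by omega))
        _ = a * (ell * cdiv w a) := by ring
    -- Write ⌈w/a⌉ = c + 1. From ac < w follows ell · c ≤ (ell · w - ell)/a, so the source head is
    -- at most ell above the quotient, within the 2 ell allowed.
    · rw [← cdiv_cdiv hj1 (by omega : 0 < a), ← hw]
      have hcpos : 0 < cdiv w a := by rw [lt_cdiv_iff (by omega)]; omega
      obtain ⟨c, hc⟩ := Nat.exists_eq_add_of_le' hcpos
      have h1 : a * c < w := by rw [← lt_cdiv_iff (by omega)]; omega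
      have h2 : ell * c ≤ (ell * w - ell) / a := by
        rw [Nat.le_div_iff_mul_le (by omega)]
        have h3 : ell * (a * c + 1) ≤ ell * w := Nat.mul_le_mul_left _ h1
        have h4 : ell * (a * c + 1) = ell * c * a + ell := by ring
        omega
      rw [hc, mul_add, Nat.succ_eq_add_one, zero_add, mul_one]
      omega
  rintro s₃ t₃ - ⟨hch₃, hS₃, hprod₃, ht₃⟩
  have hm₃ := hm₂.of_changes hch₃ (by decide) (by omega)
  have hj₃ : s₃.vars .j = j := by rw [hch₃.vars _ (by decide), hj₂]
  have hnew₃ : s₃.vars .newH = ell * w := by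
    rw [hch₃.vars _ (by decide), hch₂.vars _ (by decide), hnew₁]
  have hsh₃ : s₃.vars .sh = ell * w - 2 * ell + 1 := by
    rw [hch₃.vars _ (by decide)]
    simp [hs₂]
  refine Run.cons ((Run.sums hg hm₃ hj₃ hj1 hjJ hHw hwN (by omega) hM3 hnew₃ hsh₃ hS₃
    hprod₃).mono ?_)
  rintro s₄ t₄ - ⟨hch₄, hb₄, ht₄⟩
  have hm₄ := hm₃.of_changes hch₄ (by decide) (by omega)
  have hj₄ : s₄.vars .j = j := by rw [hch₄.vars _ (by decide), hj₃]
  have hnew₄ : s₄.vars .newH = ell * w := by rw [hch₄.vars _ (by decide), hnew₃]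
  have hsh₄ : s₄.vars .sh = ell * w - 2 * ell + 1 := by rw [hch₄.vars _ (by decide), hsh₃]
  have hh₄ : s₄.vars .h = s.vars .h := by
    rw [hch₄.vars _ (by decide), hch₃.vars _ (by decide), hch₂.vars _ (by decide),
      hv₁ _ (by decide)]
  have ho₄ : s₄.out = complexities (u * ell) := by
    rw [hch₄.out, hch₃.out, hch₂.out, ho₁, hout]
  have hB₄ : Blocks ell u (j - 1) J s₄ := by
    intro i hi1 hi
    rcases eq_or_ne i j with rfl | hne
    · rw [if_pos (by omega), ← hw]
      exact hb₄
    · have := ((hbl₂ i _ hne (hB i hi1 hi)).of_changes hch₃ (by omega)).of_changes hch₄ (by omega)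
      convert this using 2
      split_ifs <;> first | rfl | omega
  have htime : ∀ t₅, t₅ ≤ 50 + 20 * ell →
      t₁ + (6 + (t₃ + (t₄ + (t₅ + 1)))) ≤ advanceTime N ell w := by
    intro t₅ ht₅
    unfold advanceTime
    omega
  refine Run.cons (Run.ifThen (by simp) (fun hc => ?_) fun hc => ?_)
  · obtain rfl : j = 1 := by
      simp [hj₄] at hc
      omega
    have hw1 : w = u + 1 := by rw [hw, cdiv_one]
    refine Run.cons ((Run.printBlock hg hm₄ hjJ hHw hwN (by omega) hnew₄ hsh₄ hb₄ ?_).mono ?_)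
    · rw [ho₄, hwl, Nat.add_sub_cancel, cdiv_one, mul_comm]
    rintro s₅ t₅ - ⟨hv₅, ha₅, ho₅, ht₅⟩
    -- `Changes` fixes the output, so printing is treated by first replacing the output field and
    -- then comparing the rest of the state.
    have hch₅ : Changes [.n] (fun _ _ => False) { s₄ with out := s₅.out } s₅ :=
      Changes.of_arrs ha₅ rfl fun v hv => hv₅ v (by simpa using hv)
    have hm₄' : Mem N H ell J { s₄ with out := s₅.out } := ⟨hm₄.vN, hm₄.vH, hm₄.vell, hm₄.vL,
      hm₄.vcMax, hm₄.count_block, hm₄.count_head, hm₄.size_fixed, hm₄.width_fixed, hm₄.get_fixed,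
      hm₄.size_head, hm₄.width_head, hm₄.size_block, hm₄.width_block⟩
    refine Run.nil (Run.nil ⟨hm₄'.of_changes hch₅ (by decide) (by simp), fun i hi1 hi => ?_, ?_, ?_,
      ?_, ?_⟩)
    · have hb := hB₄ i hi1 hi
      exact Block.of_changes (s := { s₄ with out := s₅.out }) ⟨hb.head, hb.le_head, hb.get⟩ hch₅
        (by simp)
    · rw [hv₅ _ (by decide), hj₄]
    · rw [hv₅ _ (by decide), hh₄]
    · rw [if_pos rfl, ho₅, hw1, mul_comm]
    · have := htime (3 + t₅ + 1) (by omega)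
      simp only [cost_le, cost_add, cost_sub, cost_var, cost_one]
      omega
  · have hjne : j ≠ 1 := by
      simp [hj₄] at hc
      omega
    refine Run.nil ⟨hm₄, hB₄, hj₄, hh₄, by rw [if_neg hjne, ho₄], ?_⟩
    have := htime 4 (by omega)
    simp only [cost_le, cost_add, cost_sub, cost_var, cost_one]
    omega

/-! ### The main loop -/

/-- A bound for the time of the step `j` of the loop over the blocks. -/
noncomputable def blockStepTime (N ell u j : ℕ) : ℕ :=
  200 + ∑ w ∈ Finset.Ioc (cdiv u j) (cdiv (u + 1) j), advanceTime N ell w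

/-- The number of blocks that exist at the step `j`, where `J'` blocks are needed: either all of
them, or all but the one to be created at this step. -/
def BlockCount (u v j J J' : ℕ) : Prop := J = J' ∨ J = j ∧ J + 1 = J' ∧ u ≤ v * j

/-- Three things can happen: B_j is created, it is moved by one step, or ⌈u/j⌉ = ⌈(u + 1)/j⌉ and it
already has the head required for u + 1. -/
theorem Run.blockStep {N H ell J J' j u v : ℕ} (hg : Good N H ell) (hHv : H = v * ell)
    (hm : Mem N H ell J s) (hJ' : J' = cdiv (u + 1) v) (hJ : BlockCount u v j J J')
    (hj : s.vars .j = j) (hj1 : 1 ≤ j) (hjJ : j < J')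
    (hh : s.vars .h = (u + 1) * ell) (huN : (u + 1) * ell ≤ N)
    (hM : 3 * N + 10 ≤ M.scalar) (hM3 : N ^ 3 ≤ M.scalar)
    (hbits : (H + 1) * Nat.size (Nat.size (N ^ 3)) +
      J' * (2 * ell * Nat.size (Nat.size (N ^ 3))) + (J' + 1) * Nat.size N ≤ M.array)
    (hB : Blocks ell u j J s) (hout : s.out = complexities (u * ell)) :
    Run M (prog [
      .assign .newH (Var.ell * ceiling Var.h (Var.j * Var.ell)),
      Fuller.ifThen (.and (.lt (.len .Heads) (Var.j + 1)) (.lt Var.H Var.newH))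
        [Fuller.createRunningBlock],
      Fuller.ifThen (.lt (Fuller.head Var.j) Var.newH) [
        Fuller.shift,
        .assign .sh (Var.newH - Var.L + 1),
        Fuller.products,
        Fuller.sums,
        Fuller.ifThen (.le Var.j 1) [
          Fuller.forUp .n (Var.newH - Var.ell + 1) (.le Var.n Var.newH) [
            .print (block 1 (Var.n - Var.sh))]]],
      .assign .j (Var.j - 1)]) s fun s' t =>
      Mem N H ell J' s' ∧ Blocks ell u (j - 1) J' s' ∧ s'.vars .j = j - 1 ∧
      s'.vars .h = (u + 1) * ell ∧
      s'.out = (if j = 1 then complexities ((u + 1) * ell) else complexities (u * ell)) ∧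
      t ≤ blockStepTime N ell u j + (J' - J) * (100 * ell + 50) := by
  have h2e := hg.two_mul_le
  have hHN := hg.le_limit
  have hep := hg.ell_pos
  have hv : 0 < v := by
    rcases Nat.eq_zero_or_pos v with rfl | h
    · omega
    · exact h
  have hJ'N : J' ≤ N := by
    rw [hJ', cdiv_le_iff hv]
    have h1 : u + 1 ≤ (u + 1) * ell := Nat.le_mul_of_pos_right _ hep
    have h2 : N ≤ v * N := Nat.le_mul_of_pos_left _ hv
    omega
  have hju : v * j < u + 1 := by rw [← lt_cdiv_iff hv, ← hJ']; exact hjJ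
  have hceil : (ceiling Var.h (Var.j * Var.ell) : Expr).val s = cdiv (u + 1) j := by
    simp only [val_ceiling, val_mul, val_var, hh, hj, hm.vell]
    exact cdiv_mul_mul hj1 hep
  have hval : (Var.ell * ceiling Var.h (Var.j * Var.ell) : Expr).val s = ell * cdiv (u + 1) j := by
    rw [val_mul, hceil, val_var, hm.vell]
  have hwu : cdiv (u + 1) j ≤ u + 1 := (cdiv_le_iff hj1).2 (Nat.le_mul_of_pos_left _ hj1)
  have hwN : ell * cdiv (u + 1) j ≤ N := by
    rw [mul_comm]
    exact (Nat.mul_le_mul_right _ hwu).trans huN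
  have hvw : v < cdiv (u + 1) j := by rw [lt_cdiv_iff hj1, mul_comm]; exact hju
  have hHw : H < ell * cdiv (u + 1) j := by
    rw [hHv, mul_comm v]
    exact Nat.mul_lt_mul_of_pos_left hvw hep
  refine Run.cons (Run.assign (by simp) (by rw [hval]; omega) ?_)
  rw [hval]
  have hch₁ : Changes [.newH] (fun _ _ => False) s (s.set .newH (ell * cdiv (u + 1) j)) :=
    Changes.refl.set (by simp)
  set s₁ := s.set .newH (ell * cdiv (u + 1) j) with hs₁
  have hm₁ := hm.of_changes hch₁ (by decide) (by simp)
  have hj₁ : s₁.vars .j = j := by rw [hch₁.vars _ (by decide), hj]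
  have hB₁ : Blocks ell u j J s₁ := fun i hi1 hi => (hB i hi1 hi).of_changes hch₁ (by simp)
  have hcreate : Run M (Fuller.ifThen (.and (.lt (.len .Heads) (Var.j + 1)) (.lt Var.H Var.newH))
        [Fuller.createRunningBlock]) s₁ fun s' t => Mem N H ell J' s' ∧ Blocks ell u j J' s' ∧
      (∀ v, v ≠ .k → s'.vars v = s₁.vars v) ∧ s'.out = s₁.out ∧
      t ≤ 10 + (J' - J) * (100 * ell + 50) := by
    refine Run.ifThen (by simp) (fun hc => ?_) fun hc => ?_
    · simp only [holds_and, holds_lt, val_len, hm₁.count_head, val_add, val_var, val_one, hj₁] at hc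
      obtain ⟨rfl, hJJ, huj⟩ : J = j ∧ J + 1 = J' ∧ u ≤ v * j := by
        rcases hJ with h | h
        · omega
        · exact h
      refine Run.cons ((Run.createRunningBlock hg hm₁ hj1 (by omega) ?_).mono ?_)
      · refine le_trans ?_ hbits
        gcongr
      rintro s₂ t₂ - ⟨hm₂, hb₂, hbl₂, hv₂, ho₂, ht₂⟩
      rw [hJJ] at hm₂
      refine Run.nil ⟨hm₂, fun i hi1 hi => ?_, hv₂, ho₂, ?_⟩
      · rcases Nat.lt_or_ge i J with h | h
        · exact hbl₂ i _ h (hB₁ i hi1 h)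
        · obtain rfl : i = J := by omega
          rw [if_neg (lt_irrefl i)]
          -- A block is created only when vj ≤ u ≤ vj, hence u = vj. The copied block with head H is
          -- then exactly the block with head ell · ⌈u/j⌉ that the invariant expects.
          have hc : cdiv u i = v := by
            refine le_antisymm ((cdiv_le_iff hj1).2 (by rw [mul_comm]; exact huj))
              (le_cdiv_of_mul_lt hj1 (by rw [mul_comm]; exact hju))
          rw [hc, mul_comm, ← hHv]
          exact hb₂
      · rw [← hJJ]
        simp only [cost_and, cost_lt, cost_len, cost_add, cost_var, cost_one, Nat.add_sub_cancel_left,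
          one_mul]
        omega
    · have hJJ : J = J' := by
        rcases hJ with h | h
        · exact h
        · refine absurd ?_ hc
          simp only [holds_and, holds_lt, val_len, hm₁.count_head, val_add, val_var, val_one, hj₁,
            hm₁.vH]
          simp [hs₁]
          omega
      subst hJJ
      refine ⟨hm₁, hB₁, fun _ _ => rfl, rfl, ?_⟩
      simp
  refine Run.cons (hcreate.mono ?_)
  rintro s₂ t₂ - ⟨hm₂, hB₂, hv₂, ho₂, ht₂⟩
  have hj₂ : s₂.vars .j = j := by rw [hv₂ _ (by decide), hj₁]
  have hh₂ : s₂.vars .h = (u + 1) * ell := by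
    rw [hv₂ _ (by decide), hch₁.vars _ (by decide), hh]
  have hnew₂ : s₂.vars .newH = ell * cdiv (u + 1) j := by
    rw [hv₂ _ (by decide)]
    simp [hs₁]
  have hout₂ : s₂.out = complexities (u * ell) := by rw [ho₂, hs₁, State.out_set, hout]
  have hbj := hB₂ j hj1 hjJ
  rw [if_neg (lt_irrefl j)] at hbj
  have hok : (Test.lt (Fuller.head Var.j) Var.newH).ok s₂ := by
    simp [hj₂, hm₂.size_head j hjJ]
  refine Run.cons (Run.ifThen hok (fun hc => ?_) fun hc => ?_)
  · simp only [holds_lt, val_head, val_var, hj₂, hbj.head, hnew₂] at hc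
    have hstep : cdiv (u + 1) j = cdiv u j + 1 := by
      rcases cdiv_succ (u := u) hj1 with h | h
      · rw [h] at hc
        exact absurd hc (lt_irrefl _)
      · exact h
    refine (Run.advance hg hHv hm₂ hJ' hj₂ hj1 hju huN (by omega) hM3 hnew₂ hstep hB₂ hout₂).mono ?_
    rintro s₃ t₃ - ⟨hm₃, hB₃, hj₃, hh₃, ho₃, ht₃⟩
    have hch₄ : Changes [.j] (fun _ _ => False) s₃ (s₃.set .j (j - 1)) := Changes.refl.set (by simp)
    refine Run.cons (Run.assign (by simp) ?_ (Run.nil ?_))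
    · simp [hj₃]
      omega
    simp only [val_sub, val_var, val_one, hj₃]
    refine ⟨hm₃.of_changes hch₄ (by decide) (by simp),
      fun i hi1 hi => (hB₃ i hi1 hi).of_changes hch₄ (by simp), by simp, by simp [hh₃, hh₂],
      by simpa using ho₃, ?_⟩
    have hIoc : Finset.Ioc (cdiv u j) (cdiv u j + 1) = {cdiv u j + 1} := by
      ext x
      simp only [Finset.mem_Ioc, Finset.mem_singleton]
      omega
    have htime : advanceTime N ell (cdiv (u + 1) j) + 200 = blockStepTime N ell u j := by
      rw [blockStepTime, hstep, hIoc, Finset.sum_singleton, add_comm]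
    simp only [cost_mul, cost_var, cost_ceiling, cost_lt, cost_head, cost_sub, cost_one]
    omega
  · simp only [holds_lt, val_head, val_var, hj₂, hbj.head, hnew₂, not_lt] at hc
    have hstep : cdiv (u + 1) j = cdiv u j := by
      rcases cdiv_succ (u := u) hj1 with h | h
      · exact h
      · rw [h, mul_add, mul_one] at hc
        omega
    have hjne : j ≠ 1 := by
      rintro rfl
      rw [cdiv_one, cdiv_one] at hstep
      omega
    have hch₄ : Changes [.j] (fun _ _ => False) s₂ (s₂.set .j (j - 1)) := Changes.refl.set (by simp)
    refine Run.cons (Run.assign (by simp) ?_ (Run.nil ?_))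
    · simp [hj₂]
      omega
    simp only [val_sub, val_var, val_one, hj₂]
    refine ⟨hm₂.of_changes hch₄ (by decide) (by simp), fun i hi1 hi => ?_, by simp, by simp [hh₂],
      by simpa [hjne] using hout₂, ?_⟩
    · have hb := (hB₂ i hi1 hi).of_changes hch₄ (by simp)
      convert hb using 2
      rcases eq_or_ne i j with rfl | hne
      · rw [if_pos (by omega), if_neg (lt_irrefl _), hstep]
      · split_ifs <;> first | rfl | omega
    · unfold blockStepTime
      simp only [cost_mul, cost_var, cost_ceiling, cost_lt, cost_head, cost_sub, cost_one]
      omega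

/-- A bound for the time of one step of the main loop. -/
noncomputable def mainStepTime (N ell v u : ℕ) : ℕ :=
  200 + 100 * ell + ∑ j ∈ Finset.Ico 1 (cdiv (u + 1) v), (blockStepTime N ell u j + 3)

/-- The maximum with 2 accounts for B_1, which exists from the beginning although ⌈u/v⌉ = 1 at u =
v. -/
theorem Run.mainStep {N H ell u v : ℕ} (hg : Good N H ell) (hHv : H = v * ell)
    (hm : Mem N H ell (max 2 (cdiv u v)) s) (hvu : v ≤ u) (huN : (u + 1) * ell ≤ N)
    (hM : 3 * N + 10 ≤ M.scalar) (hM3 : N ^ 3 ≤ M.scalar)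
    (hbits : (H + 1) * Nat.size (Nat.size (N ^ 3)) +
      cdiv (u + 1) v * (2 * ell * Nat.size (Nat.size (N ^ 3))) +
      (cdiv (u + 1) v + 1) * Nat.size N ≤ M.array)
    (hB : ∀ i, 1 ≤ i → i < max 2 (cdiv u v) → Block ell i (ell * cdiv u i) s)
    (hout : s.out = complexities (u * ell)) :
    Run M (prog [
      .assign .h (Fuller.head 1 + Var.ell),
      Fuller.ifThen (.lt Var.N Var.h) [.assign .h Var.N],
      .assign .j (ceiling Var.h Var.H - 1),
      .while (.le 1 Var.j) (prog [
        .assign .newH (Var.ell * ceiling Var.h (Var.j * Var.ell)),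
        Fuller.ifThen (.and (.lt (.len .Heads) (Var.j + 1)) (.lt Var.H Var.newH))
          [Fuller.createRunningBlock],
        Fuller.ifThen (.lt (Fuller.head Var.j) Var.newH) [
          Fuller.shift,
          .assign .sh (Var.newH - Var.L + 1),
          Fuller.products,
          Fuller.sums,
          Fuller.ifThen (.le Var.j 1) [
            Fuller.forUp .n (Var.newH - Var.ell + 1) (.le Var.n Var.newH) [
              .print (block 1 (Var.n - Var.sh))]]],
        .assign .j (Var.j - 1)])]) s fun s' t =>
      Mem N H ell (max 2 (cdiv (u + 1) v)) s' ∧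
      (∀ i, 1 ≤ i → i < max 2 (cdiv (u + 1) v) → Block ell i (ell * cdiv (u + 1) i) s') ∧
      s'.out = complexities ((u + 1) * ell) ∧ t ≤ mainStepTime N ell v u := by
  have h2e := hg.two_mul_le
  have hHN := hg.le_limit
  have hep := hg.ell_pos
  have hv : 0 < v := by
    rcases Nat.eq_zero_or_pos v with rfl | h
    · omega
    · exact h
  set J' := cdiv (u + 1) v with hJ'
  have hJ'N : J' ≤ N := by
    rw [hJ', cdiv_le_iff hv]
    have h1 : u + 1 ≤ (u + 1) * ell := Nat.le_mul_of_pos_right _ hep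
    have h2 : N ≤ v * N := Nat.le_mul_of_pos_left _ hv
    omega
  have hJ'2 : 1 < J' := by rw [hJ', lt_cdiv_iff hv]; omega
  have hsucc : J' = cdiv u v ∨ J' = cdiv u v + 1 := cdiv_succ hv
  have hul : u * ell + ell ≤ N := by rw [← Nat.succ_mul]; exact huN
  have hb1 := hB 1 le_rfl (by omega)
  rw [cdiv_one] at hb1
  have hval : (Fuller.head 1 + Var.ell : Expr).val s = (u + 1) * ell := by
    simp only [val_add, val_head, val_one, val_var, hb1.head, hm.vell]
    ring
  refine Run.cons (Run.assign ?_ (by rw [hval]; omega) ?_)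
  · simp [hm.size_head 1 (by omega)]
  rw [hval]
  have hch₁ : Changes [.h] (fun _ _ => False) s (s.set .h ((u + 1) * ell)) :=
    Changes.refl.set (by simp)
  set s₁ := s.set .h ((u + 1) * ell) with hs₁
  have hm₁ := hm.of_changes hch₁ (by decide) (by simp)
  have hh₁ : s₁.vars .h = (u + 1) * ell := by simp [hs₁]
  -- The cap at N never takes effect, because N is a multiple of ell and so (u + 1) · ell ≤ N.
  refine Run.cons (Run.ifThen (by simp) (fun hc => ?_) fun _ => ?_)
  · simp only [holds_lt, val_var, hm₁.vN, hh₁] at hc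
    omega
  have hjv : (ceiling Var.h Var.H - 1 : Expr).val s₁ = J' - 1 := by
    simp only [val_sub, val_ceiling, val_var, hh₁, hm₁.vH, val_one, hHv]
    rw [hJ', ← cdiv_mul_mul (u := u + 1) hv hep]
    rfl
  refine Run.cons (Run.assign (by simp) (by rw [hjv]; omega) ?_)
  rw [hjv]
  have hch₂ : Changes [.j] (fun _ _ => False) s₁ (s₁.set .j (J' - 1)) := Changes.refl.set (by simp)
  set s₂ := s₁.set .j (J' - 1) with hs₂
  have hm₂ := hm₁.of_changes hch₂ (by decide) (by simp)
  -- At most one block is created per main step; the term with J' - J reserves the time for it until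
  -- that happens.
  refine Run.cons (Run.while (fun s' t => ∃ J j, s'.vars .j = j ∧ j < J' ∧ Mem N H ell J s' ∧
      BlockCount u v j J J' ∧ Blocks ell u j J s' ∧ s'.vars .h = (u + 1) * ell ∧
      s'.out = (if j = 0 then complexities ((u + 1) * ell) else complexities (u * ell)) ∧
      t + (J' - J) * (100 * ell + 50) ≤ (100 * ell + 50) +
        ∑ i ∈ Finset.Ico (j + 1) J', (blockStepTime N ell u i + 3))
    (fun s' => s'.vars .j) ?_ ?_)
  · refine ⟨max 2 (cdiv u v), J' - 1, by simp [hs₂], by omega, hm₂, ?_, fun i hi1 hi => ?_, ?_, ?_,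
      ?_⟩
    · have hle : u ≤ v * cdiv u v := le_mul_cdiv hv
      by_cases heq : max 2 (cdiv u v) = J'
      · exact Or.inl heq
      · have h1 : J' = cdiv u v + 1 := by omega
        refine Or.inr ⟨by omega, by omega, ?_⟩
        rw [h1, Nat.add_sub_cancel]
        exact hle
    · rw [if_neg (by omega)]
      exact ((hB i hi1 hi).of_changes hch₁ (by simp)).of_changes hch₂ (by simp)
    · rw [hch₂.vars _ (by decide), hh₁]
    · rw [if_neg (by omega), hs₂, hs₁, State.out_set, State.out_set, hout]
    · have h1 : (J' - max 2 (cdiv u v)) * (100 * ell + 50) ≤ 1 * (100 * ell + 50) :=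
        Nat.mul_le_mul_right _ (by omega)
      omega
  · rintro s' t - ⟨J, j, hj, hjJ, hm', hJ, hB', hh', ho', ht'⟩
    refine ⟨by simp, fun hc => ?_, fun hc => ?_⟩
    · have hj0 : j = 0 := by simpa [hj] using hc
      subst hj0
      have hJJ : J = J' := by
        rcases hJ with h | ⟨rfl, h, h'⟩
        · exact h
        · omega
      subst hJJ
      rw [max_eq_right (by omega)]
      refine Run.nil ⟨hm', fun i hi1 hi => ?_, by simpa using ho', ?_⟩
      · have := hB' i hi1 hi
        rwa [if_pos (by omega)] at this
      · unfold mainStepTime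
        simp only [cost_add, cost_head, cost_one, cost_var, cost_lt, cost_sub, cost_ceiling, cost_le,
          Nat.sub_self, zero_mul, zero_add] at ht' ⊢
        rw [← hJ']
        omega
    · have hj1 : 1 ≤ j := by simpa [hj] using hc
      refine (Run.blockStep hg hHv hm' hJ' hJ hj hj1 hjJ hh' huN hM hM3 hbits hB'
        (by rw [ho', if_neg (by omega)])).mono ?_
      rintro s'' t'' - ⟨hm'', hB'', hj'', hh'', ho'', ht''⟩
      refine ⟨⟨J', j - 1, hj'', by omega, hm'', Or.inl rfl, hB'', hh'', ?_, ?_⟩, by omega⟩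
      · rw [ho'']
        by_cases h1 : j = 1
        · rw [if_pos h1, if_pos (by omega)]
        · rw [if_neg h1, if_neg (by omega)]
      · rw [Nat.sub_self, zero_mul, Nat.sub_add_cancel hj1, Finset.sum_eq_sum_Ico_succ_bot hjJ]
        simp only [cost_le, cost_one, cost_var]
        omega

/-- A bound for the time of the main loop, where `N = U * ell` and `H = v * ell`. -/
noncomputable def mainTime (N ell v U : ℕ) : ℕ :=
  10 + ∑ u ∈ Finset.Ico v U, (mainStepTime N ell v u + 10)

theorem Run.mainLoop {N H ell v U : ℕ} (hg : Good N H ell) (hHv : H = v * ell)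
    (hNU : N = U * ell) (hm : Mem N H ell 2 s)
    (hM : 3 * N + 10 ≤ M.scalar) (hM3 : N ^ 3 ≤ M.scalar)
    (hbits : (H + 1) * Nat.size (Nat.size (N ^ 3)) +
      cdiv U v * (2 * ell * Nat.size (Nat.size (N ^ 3))) +
      (cdiv U v + 1) * Nat.size N ≤ M.array)
    (hB : Block ell 1 H s) (hout : s.out = complexities H) :
    Run M mainLoop s fun s' t => s'.out = complexities N ∧ t ≤ mainTime N ell v U := by
  have h2e := hg.two_mul_le
  have hHN := hg.le_limit
  have hep := hg.ell_pos
  have hv : 0 < v := by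
    rcases Nat.eq_zero_or_pos v with rfl | h
    · omega
    · exact h
  have hvU : v ≤ U := by
    rw [hHv, hNU] at hHN
    exact Nat.le_of_mul_le_mul_right hHN hep
  refine Run.while (fun s' t => ∃ u, v ≤ u ∧ u ≤ U ∧ Mem N H ell (max 2 (cdiv u v)) s' ∧
      (∀ i, 1 ≤ i → i < max 2 (cdiv u v) → Block ell i (ell * cdiv u i) s') ∧
      s'.out = complexities (u * ell) ∧ t ≤ ∑ u' ∈ Finset.Ico v u, (mainStepTime N ell v u' + 10))
    (fun s' => N - s'.get .Heads 1 0) ?_ ?_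
  · have hvv : cdiv v v ≤ 1 := (cdiv_le_iff hv).2 (by omega)
    refine ⟨v, le_rfl, hvU, by rwa [max_eq_left (by omega)], fun i hi1 hi => ?_, by rw [hout, hHv],
      by simp⟩
    obtain rfl : i = 1 := by omega
    rw [cdiv_one, mul_comm, ← hHv]
    exact hB
  · rintro s' t - ⟨u, hvu, huU, hm', hB', ho', ht'⟩
    have hb1 := hB' 1 le_rfl (by omega)
    rw [cdiv_one] at hb1
    have htest : (Test.lt (Fuller.head 1) Var.N).holds s' ↔ u < U := by
      simp only [holds_lt, val_head, val_one, val_var, hb1.head, hm'.vN]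
      rw [hNU, mul_comm ell u]
      exact Nat.mul_lt_mul_right hep
    refine ⟨by simp [hm'.size_head 1 (by omega)], fun hc => ?_, fun hc => ?_⟩
    · rw [htest] at hc
      obtain rfl : u = U := by omega
      refine ⟨by rw [ho', hNU], ?_⟩
      unfold mainTime
      simp only [cost_lt, cost_head, cost_one, cost_var]
      omega
    · rw [htest] at hc
      have huN : (u + 1) * ell ≤ N := by
        rw [hNU]
        exact Nat.mul_le_mul_right _ hc
      refine (Run.mainStep hg hHv hm' hvu huN hM hM3 ?_ hB' ho').mono ?_
      · refine le_trans ?_ hbits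
        have : cdiv (u + 1) v ≤ cdiv U v := by
          rw [cdiv_le_iff hv]
          exact (Nat.succ_le_of_lt hc).trans (le_mul_cdiv hv)
        gcongr
      rintro s'' t'' - ⟨hm'', hB'', ho'', ht''⟩
      have hb1' := hB'' 1 le_rfl (by omega)
      rw [cdiv_one] at hb1'
      refine ⟨⟨u + 1, by omega, hc, hm'', hB'', ho'', ?_⟩, ?_⟩
      · rw [Finset.sum_Ico_succ_top hvu]
        simp only [cost_lt, cost_head, cost_one, cost_var]
        omega
      · rw [hb1.head, hb1'.head, mul_add, mul_one]
        have : u * ell + ell ≤ N := by rw [← Nat.succ_mul]; exact huN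
        rw [mul_comm ell u]
        omega

/-! ### The program -/

/-- A bound for the running time of the program. -/
noncomputable def totalTime (N H ell v U : ℕ) : ℕ :=
  500 + 100 * H + 20 * Nat.size (N ^ 3) + 100 * ell + fixedTime H + mainTime N ell v U

/-- A bound for the storage of the program. -/
def totalLimits (N H ell v U : ℕ) : Limits where
  scalar := N ^ 3
  array := (H + 1) * Nat.size (Nat.size (N ^ 3)) +
      cdiv (U + v) v * (2 * ell * Nat.size (Nat.size (N ^ 3))) +
      (cdiv (U + v) v + 1) * Nat.size N

theorem arrBits_start (N H ell : ℕ) : (start N H ell).arrBits = 0 := by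
  simp [State.arrBits_eq, State.count, start]

theorem Run.program {N H ell v U : ℕ} (hg : Good N H ell) (hHv : H = v * ell)
    (hNU : N = U * ell) (hM3 : 3 * N + 10 ≤ N ^ 3) :
    Run (totalLimits N H ell v U) program (start N H ell) fun s' t =>
      s'.out = complexities N ∧ t ≤ totalTime N H ell v U := by
  have h2e := hg.two_mul_le
  have hHN := hg.le_limit
  have hep := hg.two_le
  have hv : 0 < v := by
    rcases Nat.eq_zero_or_pos v with rfl | h
    · omega
    · exact h
  have hvU : v ≤ U := by
    rw [hHv, hNU] at hHN
    exact Nat.le_of_mul_le_mul_right hHN (by omega)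
  have hH3 : H ^ 3 ≤ N ^ 3 := Nat.pow_le_pow_left hHN 3
  have hwidth : Nat.size (Nat.size (H ^ 3)) ≤ Nat.size (Nat.size (N ^ 3)) :=
    Nat.size_le_size (Nat.size_le_size hH3)
  have hc2 : 2 ≤ cdiv (U + v) v := (lt_cdiv_iff hv).2 (by omega)
  have harray : ∀ x ≤ cdiv (U + v) v, (H + 1) * Nat.size (Nat.size (N ^ 3)) +
      x * (2 * ell * Nat.size (Nat.size (N ^ 3))) + (x + 1) * Nat.size N ≤
      (totalLimits N H ell v U).array := fun x hx => by
    dsimp only [totalLimits]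
    gcongr
  have hfix : (H + 1) * Nat.size (Nat.size (H ^ 3)) ≤ (H + 1) * Nat.size (Nat.size (N ^ 3)) :=
    Nat.mul_le_mul_left _ hwidth
  have harr0 := harray 0 (Nat.zero_le _)
  rw [zero_mul, add_zero, zero_add, one_mul] at harr0
  set M := totalLimits N H ell v U with hMdef
  have hsc : M.scalar = N ^ 3 := rfl
  refine Run.cons (Run.assign (by simp) (by simp [start, hsc]; omega) ?_)
  simp only [val_mul, val_two, val_var]
  set s₁ := (start N H ell).set .L (2 * (start N H ell).vars .ell) with hs₁
  refine Run.cons ((Run.fixedBlock (H := H) (by simp [hs₁, start]) (by omega) (by omega)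
    (by simp [hs₁, start, State.count]) ?_).mono ?_)
  · rw [hs₁, State.arrBits_set, arrBits_start]
    omega
  rintro s₂ t₂ - ⟨hv₂, ho₂, hcB₂, hcH₂, hsz₂, hw₂, hget₂, ht₂⟩
  have hN₂ : s₂.vars .N = N := by rw [hv₂ _ (by decide)]; simp [hs₁, start]
  have hH₂ : s₂.vars .H = H := by rw [hv₂ _ (by decide)]; simp [hs₁, start]
  have hell₂ : s₂.vars .ell = ell := by rw [hv₂ _ (by decide)]; simp [hs₁, start]
  have hL₂ : s₂.vars .L = 2 * ell := by rw [hv₂ _ (by decide)]; simp [hs₁, start]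
  have hcH₂' : s₂.count .Heads = 0 := by rw [hcH₂]; simp [hs₁, start, State.count]
  have harr₂ : s₂.arrBits = (H + 1) * Nat.size (Nat.size (H ^ 3)) := by
    rw [State.arrBits_eq, show (Finset.univ : Finset Arr) = {.B, .Heads} from rfl,
      Finset.sum_pair (by decide), hcB₂, hcH₂']
    simp [hsz₂, hw₂]
  refine Run.cons (Run.append (by simp) (by simp) ?_ ?_)
  · simp only [val_one, val_var, hN₂, harr₂]
    omega
  simp only [val_one, val_var, hN₂]
  set s₃ := s₂.append .Heads 1 N with hs₃
  have hlt₃ : 0 < s₃.size .Heads 0 := by simp [hs₃, State.size_append, hcH₂']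
  have hw₃ : s₃.width .Heads 0 = Nat.size N := by simp [hs₃, State.width_append, hcH₂']
  have hH₃ : s₃.vars .H = H := by simp [hs₃, hH₂]
  refine Run.cons (Run.write (by simp) (by simp) (by simp) hlt₃ ?_ ?_)
  · simp only [val_var, val_zero, hH₃, hw₃]
    exact Nat.size_le_size hHN
  simp only [val_zero, val_var, hH₃]
  set s₄ := s₃.put .Heads 0 0 H with hs₄
  have hg₄ : ∀ i k, s₄.get .B i k = s₂.get .B i k := fun i k => by
    rw [hs₄, State.get_put hlt₃]
    simp [hs₃, State.get_append]
  have hsB₄ : s₄.size .B 0 = H + 1 := by simp [hs₄, hs₃, State.size_append, hsz₂]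
  have ho₄ : s₄.out = [] := by simp [hs₄, hs₃, ho₂, hs₁, start]
  have hprint : Run M (Fuller.forUp .n 1 (.le Var.n Var.H) [.print (block 0 Var.n)]) s₄ fun s' t =>
      (∀ v, v ≠ .n → s'.vars v = s₄.vars v) ∧ s'.arrs = s₄.arrs ∧ s'.out = complexities H ∧
      t ≤ 20 + 20 * H := by
    refine Run.forUp (fun n s' => (∀ v, v ≠ .n → s'.vars v = s₄.vars v) ∧ s'.arrs = s₄.arrs ∧
        s'.out = complexities (n - 1)) (fun _ => 10) 1 (H + 1) (by simp) (by simp) (by omega)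
      (by omega) ?_ ?_ ?_ ?_
    · exact ⟨fun v hv => by simp [hv], rfl, by simp [ho₄, complexities]⟩
    · rintro i s' h1 h2 ⟨hv, -⟩ hi
      refine ⟨by simp, ?_⟩
      simp only [holds_le, val_var, hi, hv .H (by decide), hs₄, State.vars_put, hH₃]
      omega
    · rintro i s' h1 h2 ⟨hv, ha, ho⟩ hi
      have hval : (block 0 Var.n : Expr).val s' = complexity i := by
        simp only [val_block, val_zero, val_var, hi, State.get_eq_of_arrs_eq ha, hg₄]
        exact hget₂ i h1 (by omega)
      refine Run.cons (Run.print ?_ (Run.nil ?_))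
      · simp [hi, State.size_eq_of_arrs_eq ha, hsB₄]
        omega
      · rw [hval]
        refine ⟨by simp [hi], ⟨fun v hv' => by simp [hv', hv v hv'], by simp [ha], ?_⟩, by simp⟩
        rw [State.out_set, State.out_print, ho, Nat.add_sub_cancel]
        conv_rhs => rw [show i = i - 1 + 1 by omega]
        rw [complexities_succ, show i - 1 + 1 = i by omega]
    · rintro s' t ⟨hv, ha, ho⟩ - ht
      refine ⟨hv, ha, by simpa using ho, ?_⟩
      simp only [Finset.sum_const, Nat.card_Ico, smul_eq_mul, cost_var, cost_one, cost_le] at ht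
      omega
  refine Run.cons (hprint.mono ?_)
  rintro s₅ t₅ - ⟨hv₅, ha₅, ho₅, ht₅⟩
  refine Run.cons ((Run.codeCMax (k := N) (by simp) (by simp [hv₅, hs₄, hs₃, hN₂]) le_rfl).mono ?_)
  rintro s₆ t₆ - ⟨ha₆, ho₆, hc₆, hv₆, ht₆⟩
  have ha : s₆.arrs = s₄.arrs := ha₆.trans ha₅
  have hvars : ∀ v, v ≠ .n → v ≠ .cMax → v ≠ .x → s₆.vars v = s₂.vars v := fun v h1 h2 h3 => by
    rw [hv₆ v h2 h3, hv₅ v h1]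
    simp [hs₄, hs₃]
  have hm₆ : Mem N H ell 1 s₆ := by
    refine ⟨?_, ?_, ?_, ?_, hc₆, ?_, ?_, ?_, ?_, fun n h1 h2 => ?_, ?_, ?_, by omega, by omega⟩
    · rw [hvars _ (by decide) (by decide) (by decide), hN₂]
    · rw [hvars _ (by decide) (by decide) (by decide), hH₂]
    · rw [hvars _ (by decide) (by decide) (by decide), hell₂]
    · rw [hvars _ (by decide) (by decide) (by decide), hL₂]
    · rw [State.count_eq_of_arrs_eq ha]
      simp [hs₄, hs₃, State.count_append, hcB₂]
    · rw [State.count_eq_of_arrs_eq ha]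
      simp [hs₄, hs₃, State.count_append, hcH₂']
    · rw [State.size_eq_of_arrs_eq ha, hsB₄]
    · rw [State.width_eq_of_arrs_eq ha]
      simpa [hs₄, hs₃, State.width_append, hw₂] using hwidth
    · rw [State.get_eq_of_arrs_eq ha, hg₄, hget₂ n h1 h2]
    · intro i hi
      obtain rfl : i = 0 := by omega
      rw [State.size_eq_of_arrs_eq ha]
      simp [hs₄, hs₃, State.size_append, hcH₂']
    · intro i hi
      obtain rfl : i = 0 := by omega
      rw [State.width_eq_of_arrs_eq ha]
      simpa [hs₄] using hw₃
  refine Run.cons ((Run.createRunningBlock hg hm₆ le_rfl (by omega) (harray 1 (by omega))).mono ?_)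
  rintro s₇ t₇ - ⟨hm₇, hb₇, -, hv₇, ho₇, ht₇⟩
  refine Run.cons ((Run.mainLoop hg hHv hNU hm₇ hM3 le_rfl (harray _ ?_) hb₇ ?_).mono ?_)
  · rw [cdiv_le_iff hv]
    exact (Nat.le_add_right U v).trans (le_mul_cdiv hv)
  · rw [ho₇, ho₆, ho₅]
  rintro s₈ t₈ - ⟨ho₈, ht₈⟩
  refine Run.nil ⟨ho₈, ?_⟩
  unfold totalTime
  simp only [cost_mul, cost_two, cost_var, cost_one, cost_zero] at ht₆ ⊢
  omega

theorem computes_of_good {N H ell v U : ℕ} (hg : Good N H ell) (hHv : H = v * ell)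
    (hNU : N = U * ell) (hM3 : 3 * N + 10 ≤ N ^ 3) :
    ∃ T S, Computes N H ell T S ∧ T ≤ totalTime N H ell v U ∧
      S ≤ (totalLimits N H ell v U).bits := by
  have hHN := hg.le_limit
  have h2e := hg.two_mul_le
  have hsmall : Small (totalLimits N H ell v U) (start N H ell) := by
    refine ⟨fun w => ?_, by rw [arrBits_start]; exact Nat.zero_le _, fun r i k => ?_⟩
    · change (start N H ell).vars w ≤ N ^ 3
      unfold start
      cases w <;> simp only <;> omega
    · simp [State.get, State.read, start]
  obtain ⟨s', T, S, h1, h2, -, h3, h4⟩ := Run.program hg hHv hNU hM3 hsmall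
  exact ⟨T, S, ⟨s', h1, h3⟩, h4, h2⟩

/-! ### The running time -/

/-- A power of a logarithm that bounds all logarithmic factors. -/
def logFactor (N : ℕ) : ℕ := (Nat.size (N ^ 3) + 2) ^ 2

theorem size_le_size_cube (N : ℕ) : Nat.size N ≤ Nat.size (N ^ 3) :=
  Nat.size_le_size (Nat.le_self_pow (by norm_num) N)

theorem size_add_two_le_logFactor (N : ℕ) : Nat.size (N ^ 3) + 2 ≤ logFactor N :=
  Nat.le_self_pow (by norm_num) _

theorem log_le_size (n : ℕ) : Real.log n ≤ Nat.size n := by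
  rcases Nat.eq_zero_or_pos n with rfl | hn
  · simp
  have h1 : (n : ℝ) ≤ 2 ^ Nat.size n := by exact_mod_cast (Nat.lt_size_self n).le
  calc Real.log n ≤ Real.log (2 ^ Nat.size n) := Real.log_le_log (by positivity) h1
    _ = Nat.size n * Real.log 2 := Real.log_pow _ _
    _ ≤ Nat.size n * 1 := by gcongr; linarith [Real.log_two_lt_d9]
    _ = Nat.size n := mul_one _

theorem sum_inv_le (m : ℕ) : ∑ a ∈ Finset.Ico 1 (m + 1), ((a : ℝ))⁻¹ ≤ 1 + Nat.size m := by
  have h := harmonic_le_one_add_log m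
  rw [harmonic_eq_sum_Icc] at h
  push_cast at h
  rw [show Finset.Ico 1 (m + 1) = Finset.Icc 1 m by ext; simp]
  exact h.trans (add_le_add_right (log_le_size m) 1)

theorem sum_div_le (x m : ℕ) : ∑ a ∈ Finset.Ico 2 (m + 1), x / a ≤ x * (1 + Nat.size m) := by
  have h : ((∑ a ∈ Finset.Ico 2 (m + 1), x / a : ℕ) : ℝ) ≤ x * (1 + Nat.size m) := by
    push_cast
    calc ∑ a ∈ Finset.Ico 2 (m + 1), ((x / a : ℕ) : ℝ)
        ≤ ∑ a ∈ Finset.Ico 2 (m + 1), (x : ℝ) * (a : ℝ)⁻¹ :=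
          Finset.sum_le_sum fun a _ => by rw [← div_eq_mul_inv]; exact Nat.cast_div_le
      _ ≤ ∑ a ∈ Finset.Ico 1 (m + 1), (x : ℝ) * (a : ℝ)⁻¹ :=
          Finset.sum_le_sum_of_subset_of_nonneg
            (Finset.Ico_subset_Ico_left (by norm_num)) fun _ _ _ => by positivity
      _ ≤ x * (1 + Nat.size m) := by
          rw [← Finset.mul_sum]
          exact mul_le_mul_of_nonneg_left (sum_inv_le m) (Nat.cast_nonneg x)
  exact_mod_cast h

/-- The cofactors contribute a harmonic sum. The constant overhead for each a ≤ √h is affordable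
because √N ≤ ell, so that it amounts to a constant per new entry. -/
theorem productTime_le {N ell h : ℕ} (hell : 1 ≤ ell) (hN : h ≤ N) (hs : Nat.sqrt N ≤ ell) :
    productTime ell h ≤ 400 * logFactor N * ell := by
  have h1 := sum_div_le ell (Nat.sqrt h)
  have h2 : Nat.size (Nat.sqrt h) ≤ Nat.size N :=
    Nat.size_le_size ((Nat.sqrt_le_self h).trans hN)
  have h3 := size_le_size_cube N
  have h4 := size_add_two_le_logFactor N
  have h5 : ell * (1 + Nat.size (Nat.sqrt h)) ≤ ell * logFactor N :=
    Nat.mul_le_mul_left _ (by omega)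
  have h6 : Nat.sqrt h ≤ ell := (Nat.sqrt_le_sqrt hN).trans hs
  have h7 : ell * 2 ≤ ell * logFactor N := Nat.mul_le_mul_left _ (by omega)
  rw [productTime, Finset.sum_add_distrib, ← Finset.mul_sum, Finset.sum_const, Nat.card_Ico,
    smul_eq_mul, mul_assoc 400, mul_comm (logFactor N)]
  omega

theorem advanceTime_le {N ell w : ℕ} (hell : 1 ≤ ell) (hw : 1 ≤ w) (hN : ell * w ≤ N)
    (hs : Nat.sqrt N ≤ ell) :
    advanceTime N ell w ≤ 2000 * logFactor N * ell +
      60 * ∑ n ∈ Finset.Ico (ell * w - ell + 1) (ell * w + 1), summandBound n := by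
  have h1 := productTime_le hell hN hs
  have h2 : (Nat.size (N ^ 3) + 1) ^ 2 ≤ logFactor N := Nat.pow_le_pow_left (by omega) 2
  have h3 := size_add_two_le_logFactor N
  have h4 : ell ≤ ell * w := Nat.le_mul_of_pos_right _ hw
  have h5 : ell * (208 + 100 * (Nat.size (N ^ 3) + 1) ^ 2) ≤ ell * (204 * logFactor N) :=
    Nat.mul_le_mul_left _ (by omega)
  have h7 : ell * 2 ≤ ell * logFactor N := Nat.mul_le_mul_left _ (by omega)
  have h8 : ∑ n ∈ Finset.Ico (ell * w - ell + 1) (ell * w + 1), (sumStepTime N n + 8) =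
      ell * (208 + 100 * (Nat.size (N ^ 3) + 1) ^ 2) +
      60 * ∑ n ∈ Finset.Ico (ell * w - ell + 1) (ell * w + 1), summandBound n := by
    rw [Finset.mul_sum]
    conv_lhs => rw [Finset.sum_congr rfl fun n _ => show sumStepTime N n + 8 =
      (208 + 100 * (Nat.size (N ^ 3) + 1) ^ 2) + 60 * summandBound n by unfold sumStepTime; ring]
    rw [Finset.sum_add_distrib, Finset.sum_const, Nat.card_Ico, smul_eq_mul,
      show ell * w + 1 - (ell * w - ell + 1) = ell by omega]
  rw [advanceTime, h8]
  rw [mul_assoc, mul_comm (logFactor N)] at h1 ⊢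
  rw [mul_left_comm] at h5
  omega

/-- The intervals of length ell below the successive heads tile the numbers up to ell · W, so each n
contributes its summands once. -/
theorem sum_advanceTime_le {N ell W : ℕ} (hell : 1 ≤ ell) (hN : ell * W ≤ N)
    (hs : Nat.sqrt N ≤ ell) :
    ∑ w ∈ Finset.Ioc 0 W, advanceTime N ell w ≤ 2000 * logFactor N * (ell * W) +
      60 * ∑ n ∈ Finset.Ico 1 (ell * W + 1), summandBound n := by
  induction W with
  | zero => simp
  | succ W ih =>
    have h1 := ih ((Nat.mul_le_mul_left _ (Nat.le_succ W)).trans hN)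
    have h2 := advanceTime_le hell (Nat.le_add_left 1 W) hN hs
    rw [Finset.sum_Ioc_succ_top (Nat.zero_le W),
      ← Finset.sum_Ico_consecutive summandBound (Nat.le_add_left 1 (ell * W))
        (show ell * W + 1 ≤ ell * (W + 1) + 1 by rw [mul_add]; omega)]
    rw [show ell * (W + 1) - ell = ell * W by rw [mul_add, mul_one, Nat.add_sub_cancel]] at h2
    rw [show 2000 * logFactor N * (ell * (W + 1)) =
      2000 * logFactor N * (ell * W) + 2000 * logFactor N * ell by ring]
    omega

/-- Interchange the sums over u and j. For fixed j the intervals from ⌈u/j⌉ to ⌈(u + 1)/j⌉ are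
consecutive, so every move of B_j is counted once, however often the block is visited. -/
theorem sum_blockStepTime_le {N ell v U : ℕ} (hv : 0 < v) (hvU : v ≤ U) :
    ∑ u ∈ Finset.Ico v U, ∑ j ∈ Finset.Ico 1 (cdiv (u + 1) v), (blockStepTime N ell u j + 3) ≤
      ∑ j ∈ Finset.Ico 1 (cdiv U v),
        (203 * U + ∑ w ∈ Finset.Ioc 0 (cdiv U j), advanceTime N ell w) := by
  have hmono : ∀ j, 0 < j → Monotone fun u => cdiv u j := fun j hj a b hab =>
    (cdiv_le_iff hj).2 (hab.trans (le_mul_cdiv hj))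
  have htel : ∀ j, 0 < j → ∀ V, v ≤ V →
      ∑ u ∈ Finset.Ico v V, ∑ w ∈ Finset.Ioc (cdiv u j) (cdiv (u + 1) j), advanceTime N ell w =
        ∑ w ∈ Finset.Ioc (cdiv v j) (cdiv V j), advanceTime N ell w := fun j hj V hV => by
    induction V, hV using Nat.le_induction with
    | base => simp
    | succ V hV ih =>
      rw [Finset.sum_Ico_succ_top hV, ih]
      exact Finset.sum_Ioc_consecutive _ (hmono j hj hV) (hmono j hj (Nat.le_succ V))
  calc _ ≤ ∑ u ∈ Finset.Ico v U, ∑ j ∈ Finset.Ico 1 (cdiv U v), (blockStepTime N ell u j + 3) :=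
        Finset.sum_le_sum fun u hu => Finset.sum_le_sum_of_subset
          (Finset.Ico_subset_Ico_right (hmono v hv (Finset.mem_Ico.1 hu).2))
    _ = ∑ j ∈ Finset.Ico 1 (cdiv U v), ∑ u ∈ Finset.Ico v U, (blockStepTime N ell u j + 3) :=
        Finset.sum_comm
    _ ≤ _ := Finset.sum_le_sum fun j hj => by
        have hj0 : 0 < j := (Finset.mem_Ico.1 hj).1
        rw [Finset.sum_congr rfl fun u _ => show blockStepTime N ell u j + 3 = 203 +
          ∑ w ∈ Finset.Ioc (cdiv u j) (cdiv (u + 1) j), advanceTime N ell w by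
            unfold blockStepTime; ring,
          Finset.sum_add_distrib, htel j hj0 U hvU, Finset.sum_const, Nat.card_Ico, smul_eq_mul,
          mul_comm]
        exact add_le_add (Nat.mul_le_mul_left _ (Nat.sub_le _ _))
          (Finset.sum_le_sum_of_subset (Finset.Ioc_subset_Ioc_left (Nat.zero_le _)))

theorem sum_summandBound_le (x : ℕ) :
    ((∑ n ∈ Finset.Ico 1 (x + 1), summandBound n : ℕ) : ℝ) ≤
      3 * ∑ n ∈ Finset.range (x + 1), ratio n := by
  rw [Finset.sum_Ico_eq_sum_range, Nat.add_sub_cancel, Finset.mul_sum]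
  push_cast
  refine le_trans (Finset.sum_le_sum fun n _ => ?_) (Finset.sum_le_sum_of_subset_of_nonneg
    (Finset.range_subset_range.2 (Nat.le_succ x)) fun n _ _ =>
      mul_nonneg zero_le_three (ratio_nonneg n))
  rw [summandBound, Nat.add_sub_cancel_left]
  exact Nat.floor_le (mul_nonneg zero_le_three (ratio_nonneg n))

theorem cast_cdiv_le {U j : ℕ} (hj : 0 < j) : (cdiv U j : ℝ) ≤ U / j + 1 := by
  rw [div_add_one (by positivity), le_div_iff₀ (by positivity)]
  have h : cdiv U j * j ≤ U + j - 1 := Nat.div_mul_le_self _ _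
  have : cdiv U j * j ≤ U + j := by omega
  exact_mod_cast this

/-- Since j ≤ U, block j treats at most 2N/j entries. As 11/9 > 1, the summands cost
O((2N)^(11/9)/j), and the other work costs one logarithmic factor per entry; the sum of 1/j
contributes the second logarithmic factor. -/
theorem exists_mainTime_le : ∃ C : ℝ, 0 ≤ C ∧ ∀ N H ell v U : ℕ, Good N H ell →
    H = v * ell → N = U * ell → Nat.sqrt N ≤ ell →
    (mainTime N ell v U : ℝ) ≤ C * (logFactor N ^ 2 * (N : ℝ) ^ (11 / 9 : ℝ)) := by
  obtain ⟨C₀, hC₀, hsum⟩ := exists_sum_ratio_le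
  refine ⟨5000 + 180 * C₀ * 2 ^ (11 / 9 : ℝ), by positivity, fun N H ell v U hg hHv hNU hs => ?_⟩
  have h2e := hg.two_mul_le
  have hHN := hg.le_limit
  have hep := hg.ell_pos
  have hv : 0 < v := by
    rcases Nat.eq_zero_or_pos v with rfl | h
    · omega
    · exact h
  have hvU : v ≤ U := by
    rw [hHv, hNU] at hHN
    exact Nat.le_of_mul_le_mul_right hHN hep
  have hUH : U ≤ H := by
    have := hg.limit_le
    rw [hNU, mul_comm] at this
    exact Nat.le_of_mul_le_mul_left this hep
  have hU0 : (0 : ℝ) < U := by exact_mod_cast hv.trans_le hvU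
  have hNR : (N : ℝ) = U * ell := by exact_mod_cast hNU
  have hN1 : (1 : ℝ) ≤ N := by exact_mod_cast (show 1 ≤ N by omega)
  have hpow : (N : ℝ) ≤ (N : ℝ) ^ (11 / 9 : ℝ) := by
    conv_lhs => rw [← Real.rpow_one (N : ℝ)]
    exact Real.rpow_le_rpow_of_exponent_le hN1 (by norm_num)
  set K : ℝ := (logFactor N : ℝ) with hK
  have hK2 : 2 ≤ K := by
    have := size_add_two_le_logFactor N
    rw [hK]
    exact_mod_cast (show 2 ≤ logFactor N by omega)
  -- the number of running blocks
  have hblocks : (U : ℝ) * cdiv U v ≤ 2 * N := by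
    have h1 : (cdiv U v : ℝ) ≤ U / v + 1 := cast_cdiv_le hv
    -- N ≤ ell · H means U ≤ H = v · ell, hence U²/v ≤ U · ell = N. This pays also for the visits of
    -- blocks that do not move.
    have h2 : (U : ℝ) * (U / v) ≤ N := by
      have hv' : (0 : ℝ) < v := by exact_mod_cast hv
      rw [← mul_div_assoc, div_le_iff₀ hv', hNR]
      have : U * U ≤ U * ell * v := by
        rw [mul_assoc]
        refine Nat.mul_le_mul_left _ ?_
        rw [mul_comm, ← hHv]
        exact hUH
      exact_mod_cast this
    have h3 : (U : ℝ) ≤ N := by exact_mod_cast hUH.trans hHN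
    calc (U : ℝ) * cdiv U v ≤ U * (U / v + 1) := by gcongr
      _ = U * (U / v) + U := by ring
      _ ≤ 2 * N := by linarith
  -- the time for a single running block
  have hblock : ∀ j ∈ Finset.Ico 1 (cdiv U v),
      ((203 * U + ∑ w ∈ Finset.Ioc 0 (cdiv U j), advanceTime N ell w : ℕ) : ℝ) ≤
        203 * U + (4000 * K * N + 180 * C₀ * (2 * N) ^ (11 / 9 : ℝ)) * (j : ℝ)⁻¹ := by
    intro j hj
    obtain ⟨hj1, hj2⟩ := Finset.mem_Ico.1 hj
    have hj0 : (0 : ℝ) < j := by exact_mod_cast hj1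
    have hj1' : (1 : ℝ) ≤ j := by exact_mod_cast hj1
    have hjU : j ≤ U := by
      have h1 := (lt_cdiv_iff hv).1 hj2
      have h2 : j ≤ v * j := Nat.le_mul_of_pos_left _ hv
      omega
    have hle : cdiv U j ≤ U := (cdiv_le_iff hj1).2 (Nat.le_mul_of_pos_left _ hj1)
    have hpos : 0 < cdiv U j := (lt_cdiv_iff hj1).2 (by omega)
    have h1 := sum_advanceTime_le hep (W := cdiv U j)
      (by rw [hNU, mul_comm]; exact Nat.mul_le_mul_right _ hle) hs
    have h2 := sum_summandBound_le (ell * cdiv U j)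
    have h3 := hsum (ell * cdiv U j) (Nat.mul_pos hep hpos)
    have h4 : ((ell * cdiv U j : ℕ) : ℝ) ≤ 2 * N * (j : ℝ)⁻¹ := by
      have h5 := cast_cdiv_le (U := U) hj1
      have h6 : (1 : ℝ) ≤ U / j := by
        rw [le_div_iff₀ hj0, one_mul]
        exact_mod_cast hjU
      push_cast
      calc (ell : ℝ) * cdiv U j ≤ ell * (U / j + U / j) := by gcongr; linarith
        _ = 2 * N * (j : ℝ)⁻¹ := by rw [hNR]; ring
    have h7 : ((ell * cdiv U j : ℕ) : ℝ) ^ (11 / 9 : ℝ) ≤ (2 * N) ^ (11 / 9 : ℝ) * (j : ℝ)⁻¹ := by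
      calc ((ell * cdiv U j : ℕ) : ℝ) ^ (11 / 9 : ℝ) ≤ (2 * N * (j : ℝ)⁻¹) ^ (11 / 9 : ℝ) :=
            Real.rpow_le_rpow (Nat.cast_nonneg _) h4 (by norm_num)
        _ = (2 * N) ^ (11 / 9 : ℝ) * ((j : ℝ)⁻¹) ^ (11 / 9 : ℝ) :=
            Real.mul_rpow (by positivity) (by positivity)
        _ ≤ (2 * N) ^ (11 / 9 : ℝ) * ((j : ℝ)⁻¹) ^ (1 : ℝ) := by
            refine mul_le_mul_of_nonneg_left ?_ (by positivity)
            exact Real.rpow_le_rpow_of_exponent_ge (by positivity) (inv_le_one_of_one_le₀ hj1')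
              (by norm_num)
        _ = _ := by rw [Real.rpow_one]
    have h8 : ((∑ w ∈ Finset.Ioc 0 (cdiv U j), advanceTime N ell w : ℕ) : ℝ) ≤
        2000 * K * ((ell * cdiv U j : ℕ) : ℝ) +
          60 * ((∑ n ∈ Finset.Ico 1 (ell * cdiv U j + 1), summandBound n : ℕ) : ℝ) := by
      rw [hK]
      exact_mod_cast h1
    have h9 : 2000 * K * ((ell * cdiv U j : ℕ) : ℝ) ≤ 2000 * K * (2 * N * (j : ℝ)⁻¹) :=
      mul_le_mul_of_nonneg_left h4 (by positivity)
    have h10 : C₀ * ((ell * cdiv U j : ℕ) : ℝ) ^ (11 / 9 : ℝ) ≤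
        C₀ * ((2 * N) ^ (11 / 9 : ℝ) * (j : ℝ)⁻¹) := mul_le_mul_of_nonneg_left h7 hC₀
    rw [Nat.cast_add, Nat.cast_mul, Nat.cast_ofNat]
    linarith
  -- all running blocks
  have hall : ((∑ u ∈ Finset.Ico v U, ∑ j ∈ Finset.Ico 1 (cdiv (u + 1) v),
      (blockStepTime N ell u j + 3) : ℕ) : ℝ) ≤
      406 * N + (4000 * K * N + 180 * C₀ * (2 * N) ^ (11 / 9 : ℝ)) * K := by
    have h1 : ∑ j ∈ Finset.Ico 1 (cdiv U v), (j : ℝ)⁻¹ ≤ K := by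
      have hc : cdiv U v ≤ N + 1 := by
        rw [cdiv_le_iff hv]
        have : N + 1 ≤ v * (N + 1) := Nat.le_mul_of_pos_left _ hv
        omega
      refine le_trans (Finset.sum_le_sum_of_subset_of_nonneg (Finset.Ico_subset_Ico_right hc)
        fun _ _ _ => by positivity) ((sum_inv_le N).trans ?_)
      have h2 := size_le_size_cube N
      have h3 := size_add_two_le_logFactor N
      rw [hK]
      exact_mod_cast (show 1 + Nat.size N ≤ logFactor N by omega)
    calc _ ≤ ((∑ j ∈ Finset.Ico 1 (cdiv U v),
          (203 * U + ∑ w ∈ Finset.Ioc 0 (cdiv U j), advanceTime N ell w) : ℕ) : ℝ) := by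
            exact_mod_cast sum_blockStepTime_le hv hvU
      _ ≤ ∑ j ∈ Finset.Ico 1 (cdiv U v),
          (203 * U + (4000 * K * N + 180 * C₀ * (2 * N) ^ (11 / 9 : ℝ)) * (j : ℝ)⁻¹) := by
            rw [Nat.cast_sum]
            exact Finset.sum_le_sum hblock
      _ = (cdiv U v - 1 : ℕ) * (203 * U) + (4000 * K * N + 180 * C₀ * (2 * N) ^ (11 / 9 : ℝ)) *
          ∑ j ∈ Finset.Ico 1 (cdiv U v), (j : ℝ)⁻¹ := by
            rw [Finset.sum_add_distrib, Finset.sum_const, Nat.card_Ico, nsmul_eq_mul,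
              ← Finset.mul_sum]
      _ ≤ 406 * N + (4000 * K * N + 180 * C₀ * (2 * N) ^ (11 / 9 : ℝ)) * K := by
            refine add_le_add ?_ (mul_le_mul_of_nonneg_left h1 (by positivity))
            have h2 : ((cdiv U v - 1 : ℕ) : ℝ) ≤ cdiv U v := by exact_mod_cast Nat.sub_le _ _
            calc ((cdiv U v - 1 : ℕ) : ℝ) * (203 * U) ≤ cdiv U v * (203 * U) := by gcongr
              _ = 203 * (U * cdiv U v) := by ring
              _ ≤ 406 * N := by linarith
  have htime : mainTime N ell v U = 10 + (U - v) * (210 + 100 * ell) +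
      ∑ u ∈ Finset.Ico v U, ∑ j ∈ Finset.Ico 1 (cdiv (u + 1) v), (blockStepTime N ell u j + 3) := by
    rw [mainTime, Finset.sum_congr rfl fun u _ => show mainStepTime N ell v u + 10 =
      (210 + 100 * ell) + ∑ j ∈ Finset.Ico 1 (cdiv (u + 1) v), (blockStepTime N ell u j + 3) by
        unfold mainStepTime; ring,
      Finset.sum_add_distrib, Finset.sum_const, Nat.card_Ico, smul_eq_mul, add_assoc]
  have hfirst : ((10 + (U - v) * (210 + 100 * ell) : ℕ) : ℝ) ≤ 320 * N := by
    have h1 : (U - v) * (210 + 100 * ell) ≤ U * (310 * ell) :=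
      Nat.mul_le_mul (Nat.sub_le _ _) (by omega)
    have h2 : U * (310 * ell) = 310 * N := by rw [hNU]; ring
    have : 10 + (U - v) * (210 + 100 * ell) ≤ 320 * N := by omega
    exact_mod_cast this
  rw [htime, Nat.cast_add]
  have hKK : 4 ≤ K ^ 2 := by nlinarith
  have hKK' : K ≤ K ^ 2 := by nlinarith
  set P := (N : ℝ) ^ (11 / 9 : ℝ) with hP
  have h2P : (2 * (N : ℝ)) ^ (11 / 9 : ℝ) = 2 ^ (11 / 9 : ℝ) * P :=
    Real.mul_rpow (by norm_num) (Nat.cast_nonneg N)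
  have e1 : 726 * (N : ℝ) ≤ 182 * (K ^ 2 * P) := by
    have : 4 * (N : ℝ) ≤ K ^ 2 * P := mul_le_mul hKK hpow (by positivity) (by positivity)
    linarith
  have e2 : K ^ 2 * (N : ℝ) ≤ K ^ 2 * P := by gcongr
  have e3 : 180 * C₀ * 2 ^ (11 / 9 : ℝ) * P * K ≤ 180 * C₀ * 2 ^ (11 / 9 : ℝ) * P * K ^ 2 :=
    mul_le_mul_of_nonneg_left hKK' (by positivity)
  rw [h2P] at hall
  linarith

theorem exists_fixedTime_le : ∃ C : ℝ, 0 ≤ C ∧ ∀ N H : ℕ, 0 < H → H ≤ N →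
    (fixedTime H : ℝ) ≤ C * (logFactor N ^ 2 * (N : ℝ) ^ (11 / 9 : ℝ)) := by
  obtain ⟨C₀, hC₀, hsum⟩ := exists_sum_ratio_le
  refine ⟨1000 + 150 * C₀, by positivity, fun N H hH hHN => ?_⟩
  have hsz : Nat.size (H ^ 3) ≤ Nat.size (N ^ 3) :=
    Nat.size_le_size (Nat.pow_le_pow_left hHN 3)
  have hK1 := size_add_two_le_logFactor N
  have hdiv := sum_div_le H H
  have h1 : H * (1 + Nat.size H) ≤ logFactor N * N := by
    have := size_le_size_cube H
    rw [mul_comm]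
    exact Nat.mul_le_mul (by omega) hHN
  have h2 : (Nat.size (H ^ 3) + 1) ^ 2 ≤ logFactor N := Nat.pow_le_pow_left (by omega) 2
  have h3 : ∑ n ∈ Finset.Ico 2 (H + 1), (fixedStepTime H n + 8) =
      (H - 1) * (208 + 100 * (Nat.size (H ^ 3) + 1) ^ 2) +
      50 * ∑ n ∈ Finset.Ico 2 (H + 1), summandBound n + 50 * ∑ n ∈ Finset.Ico 2 (H + 1), H / n := by
    rw [Finset.sum_congr rfl fun n _ => show fixedStepTime H n + 8 =
      (208 + 100 * (Nat.size (H ^ 3) + 1) ^ 2) + 50 * summandBound n + 50 * (H / n) by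
        unfold fixedStepTime; ring,
      Finset.sum_add_distrib, Finset.sum_add_distrib, Finset.sum_const, Nat.card_Ico, smul_eq_mul,
      ← Finset.mul_sum, ← Finset.mul_sum, show H + 1 - 2 = H - 1 by omega]
  have h4 : (H - 1) * (208 + 100 * (Nat.size (H ^ 3) + 1) ^ 2) ≤ N * (204 * logFactor N) :=
    Nat.mul_le_mul (by omega) (by omega)
  have h5 : ∑ n ∈ Finset.Ico 2 (H + 1), summandBound n ≤
      ∑ n ∈ Finset.Ico 1 (N + 1), summandBound n :=
    Finset.sum_le_sum_of_subset (Finset.Ico_subset_Ico (by norm_num) (by omega))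
  have h6 : logFactor N ≤ logFactor N * N := Nat.le_mul_of_pos_right _ (by omega)
  have h7 : 2 * N ≤ logFactor N * N := Nat.mul_le_mul_right _ (by omega)
  have h8 : fixedTime H ≤ 400 * (logFactor N * N) +
      50 * ∑ n ∈ Finset.Ico 1 (N + 1), summandBound n := by
    rw [mul_left_comm, mul_comm N] at h4
    rw [fixedTime, h3]
    omega
  have h9 := sum_summandBound_le N
  have h10 := hsum N (by omega)
  have hN1 : (1 : ℝ) ≤ N := by exact_mod_cast (show 1 ≤ N by omega)
  have hpow : (N : ℝ) ≤ (N : ℝ) ^ (11 / 9 : ℝ) := by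
    conv_lhs => rw [← Real.rpow_one (N : ℝ)]
    exact Real.rpow_le_rpow_of_exponent_le hN1 (by norm_num)
  have h11 : (fixedTime H : ℝ) ≤ 400 * (logFactor N * N) +
      50 * ((∑ n ∈ Finset.Ico 1 (N + 1), summandBound n : ℕ) : ℝ) := by exact_mod_cast h8
  have hK2 : (1 : ℝ) ≤ logFactor N := by exact_mod_cast (show 1 ≤ logFactor N by omega)
  set K : ℝ := (logFactor N : ℝ)
  set P := (N : ℝ) ^ (11 / 9 : ℝ)
  have e1 : K * N ≤ K ^ 2 * P := mul_le_mul (le_self_pow₀ hK2 (by norm_num)) hpow (by positivity)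
    (by positivity)
  have e2 : C₀ * P ≤ K ^ 2 * (C₀ * P) :=
    le_mul_of_one_le_left (by positivity) (one_le_pow₀ hK2)
  have e3 : 0 ≤ K ^ 2 * P := by positivity
  linarith

/-! ### Absorbing the logarithms into a power of N -/

theorem size_le_log {n : ℕ} (hn : 0 < n) : (Nat.size n : ℝ) ≤ 2 * Real.log n + 1 := by
  obtain ⟨k, hk⟩ : ∃ k, Nat.size n = k + 1 :=
    Nat.exists_eq_succ_of_ne_zero (Nat.size_pos.2 hn).ne'
  have h1 : 2 ^ k ≤ n := Nat.lt_size.1 (by omega)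
  have h2 : (2 : ℝ) ^ k ≤ n := by exact_mod_cast h1
  have h3 : k * Real.log 2 ≤ Real.log n := by
    rw [← Real.log_pow]
    exact Real.log_le_log (by positivity) h2
  have h4 : (k : ℝ) * (1 / 2) ≤ k * Real.log 2 := by
    gcongr
    linarith [Real.log_two_gt_d9]
  rw [hk]
  push_cast
  linarith

theorem size_cube_le_log {N : ℕ} (hN : 0 < N) : (Nat.size (N ^ 3) : ℝ) ≤ 6 * Real.log N + 1 := by
  have h := size_le_log (n := N ^ 3) (by positivity)
  rw [Nat.cast_pow, Real.log_pow] at h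
  push_cast at h
  linarith

/-- From log N ≤ 1000 N^0.001 the digit count plus 2 is at most (6 · 1000 + 1 + 2) N^0.001; the
fourth power has exponent 0.004. -/
theorem logFactor_sq_le {N : ℕ} (hN : 0 < N) :
    (logFactor N : ℝ) ^ 2 ≤ 6003 ^ 4 * (N : ℝ) ^ (0.004 : ℝ) := by
  have hN1 : (1 : ℝ) ≤ N := by exact_mod_cast hN
  have h1 := size_cube_le_log hN
  have h2 := Real.log_le_rpow_div (Nat.cast_nonneg N) (show (0 : ℝ) < 0.001 by norm_num)
  have h3 : (1 : ℝ) ≤ (N : ℝ) ^ (0.001 : ℝ) := Real.one_le_rpow hN1 (by norm_num)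
  have h4 : (Nat.size (N ^ 3) : ℝ) + 2 ≤ 6003 * (N : ℝ) ^ (0.001 : ℝ) := by
    have : (N : ℝ) ^ (0.001 : ℝ) / 0.001 = 1000 * (N : ℝ) ^ (0.001 : ℝ) := by ring
    linarith
  calc (logFactor N : ℝ) ^ 2 = ((Nat.size (N ^ 3) : ℝ) + 2) ^ 4 := by
        rw [logFactor]; push_cast; ring
    _ ≤ (6003 * (N : ℝ) ^ (0.001 : ℝ)) ^ 4 := by gcongr
    _ = 6003 ^ 4 * (N : ℝ) ^ (0.004 : ℝ) := by
        rw [mul_pow, ← Real.rpow_mul_natCast (Nat.cast_nonneg N)]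
        norm_num

/-- The final exponent is 11/9 + 0.004 < 1.2263, which leaves room below 1.230175. -/
theorem exists_totalTime_le : ∃ C : ℝ, 0 ≤ C ∧ ∀ N H ell v U : ℕ, Good N H ell →
    H = v * ell → N = U * ell → Nat.sqrt N ≤ ell →
    (totalTime N H ell v U : ℝ) ≤ C * (N : ℝ) ^ (1.230175 : ℝ) := by
  obtain ⟨C₁, hC₁, hmain⟩ := exists_mainTime_le
  obtain ⟨C₂, hC₂, hfixed⟩ := exists_fixedTime_le
  refine ⟨(1000 + C₁ + C₂) * 6003 ^ 4, by positivity, fun N H ell v U hg hHv hNU hs => ?_⟩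
  have h2e := hg.two_mul_le
  have hHN := hg.le_limit
  have hep := hg.ell_pos
  have h1 := hmain N H ell v U hg hHv hNU hs
  have h2 := hfixed N H (by omega) hHN
  have hN1 : (1 : ℝ) ≤ N := by exact_mod_cast (show 1 ≤ N by omega)
  have hN0 : (0 : ℝ) < N := by linarith
  have hpow : (N : ℝ) ≤ (N : ℝ) ^ (11 / 9 : ℝ) := by
    conv_lhs => rw [← Real.rpow_one (N : ℝ)]
    exact Real.rpow_le_rpow_of_exponent_le hN1 (by norm_num)
  have hK := size_add_two_le_logFactor N
  have hKN : logFactor N ≤ logFactor N * N := Nat.le_mul_of_pos_right _ (by omega)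
  have hKN2 : N ≤ logFactor N * N := Nat.le_mul_of_pos_left _ (by omega)
  have h3 : 500 + 100 * H + 20 * Nat.size (N ^ 3) + 100 * ell ≤ 1000 * (logFactor N * N) := by
    omega
  have h3' : ((500 + 100 * H + 20 * Nat.size (N ^ 3) + 100 * ell : ℕ) : ℝ) ≤
      1000 * (logFactor N * N) := by exact_mod_cast h3
  have hK1 : (1 : ℝ) ≤ logFactor N := by exact_mod_cast (show 1 ≤ logFactor N by omega)
  have h4 : (logFactor N : ℝ) * N ≤ logFactor N ^ 2 * (N : ℝ) ^ (11 / 9 : ℝ) :=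
    mul_le_mul (le_self_pow₀ hK1 (by norm_num)) hpow hN0.le (by positivity)
  have h5 : (logFactor N : ℝ) ^ 2 * (N : ℝ) ^ (11 / 9 : ℝ) ≤
      6003 ^ 4 * (N : ℝ) ^ (1.230175 : ℝ) := by
    calc (logFactor N : ℝ) ^ 2 * (N : ℝ) ^ (11 / 9 : ℝ)
        ≤ 6003 ^ 4 * (N : ℝ) ^ (0.004 : ℝ) * (N : ℝ) ^ (11 / 9 : ℝ) := by
          gcongr
          exact logFactor_sq_le (by omega)
      _ = 6003 ^ 4 * (N : ℝ) ^ (0.004 + 11 / 9 : ℝ) := by rw [mul_assoc, Real.rpow_add hN0]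
      _ ≤ _ := by
          refine mul_le_mul_of_nonneg_left ?_ (by positivity)
          exact Real.rpow_le_rpow_of_exponent_le hN1 (by norm_num)
  calc (totalTime N H ell v U : ℝ)
      = ((500 + 100 * H + 20 * Nat.size (N ^ 3) + 100 * ell : ℕ) : ℝ) + fixedTime H +
        mainTime N ell v U := by rw [totalTime, Nat.cast_add, Nat.cast_add]
    _ ≤ (1000 + C₁ + C₂) * (logFactor N ^ 2 * (N : ℝ) ^ (11 / 9 : ℝ)) := by linarith
    _ ≤ (1000 + C₁ + C₂) * (6003 ^ 4 * (N : ℝ) ^ (1.230175 : ℝ)) :=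
        mul_le_mul_of_nonneg_left h5 (by positivity)
    _ = _ := by ring

/-! ### Admissible parameters -/

/-- The defining property of β: it converts 2^s ≤ n^3 into 3^(s/3) ≤ n^(1 + β). -/
theorem two_rpow_one_add_beta : (2 : ℝ) ^ (1 + beta) = 3 := by
  rw [Real.rpow_def_of_pos two_pos, beta, add_sub_cancel,
    mul_div_cancel₀ _ (Real.log_pos one_lt_two).ne', Real.exp_log three_pos]

/-- Equivalent to 2^3 ≤ 3^2; hence ell dominates √N. -/
theorem half_le_beta : 1 / 2 ≤ beta := by
  have h0 : 0 < Real.log 2 := Real.log_pos one_lt_two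
  have h1 : Real.log ((2 : ℝ) ^ 3) ≤ Real.log ((3 : ℝ) ^ 2) :=
    Real.log_le_log (by norm_num) (by norm_num)
  rw [Real.log_pow, Real.log_pow] at h1
  push_cast at h1
  rw [beta, le_sub_iff_add_le, le_div_iff₀ h0]
  linarith

/-- Follows from 3^5 ≤ 2^8. It makes N^β log N negligible against N^((1 + β)/2). -/
theorem beta_le : beta ≤ 3 / 5 := by
  have h0 : 0 < Real.log 2 := Real.log_pos one_lt_two
  have h1 : Real.log ((3 : ℝ) ^ 5) ≤ Real.log ((2 : ℝ) ^ 8) :=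
    Real.log_le_log (by norm_num) (by norm_num)
  rw [Real.log_pow, Real.log_pow] at h1
  push_cast at h1
  rw [beta, sub_le_iff_le_add, div_le_iff₀ h0]
  linarith

-- The fractions 1054/665 and 1539/971 enclose log 3 / log 2 closely enough; each bound is a
-- comparison of a power of 2 with a power of 3.
set_option exponentiation.threshold 2000 in
theorem abs_exponent_sub_lt : |(1 + beta) / 2 - 0.792481| < 1 / 10 ^ 6 := by
  have h0 : 0 < Real.log 2 := Real.log_pos one_lt_two
  have h1 : Real.log ((2 : ℝ) ^ 1054) ≤ Real.log ((3 : ℝ) ^ 665) :=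
    Real.log_le_log (by norm_num) (by norm_num)
  have h2 : Real.log ((3 : ℝ) ^ 971) ≤ Real.log ((2 : ℝ) ^ 1539) :=
    Real.log_le_log (by norm_num) (by norm_num)
  rw [Real.log_pow, Real.log_pow] at h1 h2
  push_cast at h1 h2
  have h3 : 1054 / 665 ≤ Real.log 3 / Real.log 2 := by
    rw [le_div_iff₀ h0]
    linarith
  have h4 : Real.log 3 / Real.log 2 ≤ 1539 / 971 := by
    rw [div_le_iff₀ h0]
    linarith
  rw [beta, abs_lt]
  constructor <;> norm_num <;> linarith

/-- Combines kMax · n ≤ 2 · 3^(s/3) with 3^(s/3) ≤ n^(1 + β). The choice of the step ell rests on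
this bound. -/
theorem IsCut.maxValue_le_rpow {n S u : ℕ} (h : IsCut n S u) (hS : 2 ^ S ≤ n ^ 3) :
    (maxValue u : ℝ) ≤ 2 * (n : ℝ) ^ beta := by
  have hn : 0 < n := by
    rcases Nat.eq_zero_or_pos n with rfl | hn
    · have : 0 < 2 ^ S := by positivity
      omega
    · exact hn
  have hn' : (0 : ℝ) < n := by exact_mod_cast hn
  have hb := half_le_beta
  have h1 : ((maxValue u : ℝ) * n) ^ 3 ≤ 8 * 3 ^ S := by exact_mod_cast h.mul_pow_le
  have h2 : (3 : ℝ) ^ S ≤ ((n : ℝ) ^ (1 + beta)) ^ 3 := by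
    have h3 : (2 : ℝ) ^ S ≤ (n : ℝ) ^ 3 := by exact_mod_cast hS
    calc (3 : ℝ) ^ S = ((2 : ℝ) ^ S) ^ (1 + beta) := by
          rw [← two_rpow_one_add_beta, ← Real.rpow_natCast, ← Real.rpow_natCast,
            ← Real.rpow_mul two_pos.le, ← Real.rpow_mul two_pos.le, mul_comm]
      _ ≤ ((n : ℝ) ^ 3) ^ (1 + beta) := Real.rpow_le_rpow (by positivity) h3 (by linarith)
      _ = ((n : ℝ) ^ (1 + beta)) ^ 3 := by
          rw [← Real.rpow_natCast, ← Real.rpow_natCast, ← Real.rpow_mul hn'.le,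
            ← Real.rpow_mul hn'.le, mul_comm]
  have h3 : ((maxValue u : ℝ) * n) ^ 3 ≤ (2 * (n : ℝ) ^ (1 + beta)) ^ 3 := by
    rw [mul_pow 2]
    linarith
  have h4 := le_of_pow_le_pow_left₀ (by norm_num) (by positivity) h3
  rw [Real.rpow_add hn', Real.rpow_one] at h4
  refine le_of_mul_le_mul_right ?_ hn'
  linarith

theorem Admissible.sqrt_le {N H ell : ℕ} (h : Admissible N H ell) : 2 * √(N : ℝ) ≤ ell := by
  have hN : (1 : ℝ) ≤ N := by exact_mod_cast h.pos
  rw [Real.sqrt_eq_rpow]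
  have := Real.rpow_le_rpow_of_exponent_le hN half_le_beta
  linarith [h.step_large]

theorem Admissible.four_mul_le {N H ell : ℕ} (h : Admissible N H ell) : 4 * N ≤ ell * ell := by
  have h1 := h.sqrt_le
  have h2 : √(N : ℝ) * √N = N := Real.mul_self_sqrt (Nat.cast_nonneg N)
  have h3 : (4 : ℝ) * N ≤ ell * ell := by
    have := mul_le_mul h1 h1 (by positivity) (Nat.cast_nonneg ell)
    linarith
  exact_mod_cast h3

theorem Admissible.mul_le {N H ell : ℕ} (h : Admissible N H ell) : 2 * ell * N ≤ H * H := by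
  have h1 := h.block_large
  have h2 : ((2 * ell : ℝ) * N) ≤ H * H := by
    rw [← sq]
    exact (Real.sqrt_le_left (Nat.cast_nonneg H)).1 h1
  exact_mod_cast h2

/-- From L N ≤ H² ≤ H N: a running block fits into the fixed block from which it is copied. -/
theorem Admissible.two_mul_le {N H ell : ℕ} (h : Admissible N H ell) : 2 * ell ≤ H := by
  have h1 := h.mul_le
  have h2 := Nat.mul_le_mul_left H h.le_limit
  exact Nat.le_of_mul_le_mul_right (h1.trans h2) h.pos

/-- Squaring 2 ell ≤ N and inserting 4N ≤ ell² gives 16 N ≤ N². So small N need no separate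
treatment. -/
theorem Admissible.sixteen_le {N H ell : ℕ} (h : Admissible N H ell) : 16 ≤ N := by
  have h1 := h.four_mul_le
  have h2 := h.two_mul_le.trans h.le_limit
  have h3 := Nat.mul_le_mul h2 h2
  refine Nat.le_of_mul_le_mul_right (c := N) ?_ h.pos
  rw [mul_mul_mul_comm] at h3
  omega

theorem Admissible.good {N H ell : ℕ} (h : Admissible N H ell) : Good N H ell where
  two_le := by
    have h1 := h.four_mul_le
    have h2 := h.sixteen_le
    by_contra! hlt
    have := Nat.mul_le_mul (Nat.le_of_lt_succ hlt) (Nat.le_of_lt_succ hlt)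
    omega
  two_mul_le := h.two_mul_le
  le_limit := h.le_limit
  limit_le := h.limit_le
  cut_le n S u hn hc hS := by
    have h1 := hc.maxValue_le_rpow hS
    have h2 : (n : ℝ) ^ beta ≤ (N : ℝ) ^ beta :=
      Real.rpow_le_rpow (Nat.cast_nonneg n) (by exact_mod_cast hn) (by linarith [half_le_beta])
    have h3 : (maxValue u : ℝ) ≤ ell := by linarith [h.step_large]
    exact_mod_cast h3

/-! ### The storage -/

/-- The value 16 just suffices, since 4 log 2 > e. The bound lets log log N absorb additive
constants. -/
theorem one_le_log_log {N : ℕ} (hN : 16 ≤ N) : 1 ≤ Real.log (Real.log N) := by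
  have h1 : Real.log ((2 : ℝ) ^ 4) ≤ Real.log N :=
    Real.log_le_log (by norm_num) (by norm_num; exact_mod_cast hN)
  rw [Real.log_pow] at h1
  push_cast at h1
  have h2 : Real.exp 1 ≤ Real.log N := by
    linarith [Real.exp_one_lt_d9, Real.log_two_gt_d9]
  exact (Real.le_log_iff_exp_le ((Real.exp_pos 1).trans_le h2)).2 h2

theorem one_le_log {N : ℕ} (hN : 16 ≤ N) : 1 ≤ Real.log N := by
  have h1 : Real.log ((2 : ℝ) ^ 4) ≤ Real.log N :=
    Real.log_le_log (by norm_num) (by norm_num; exact_mod_cast hN)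
  rw [Real.log_pow] at h1
  push_cast at h1
  linarith [Real.log_two_gt_d9]

/-- The digit count of N^3 is at most 7 log N, and log 7 ≤ 2; thus its own digit count is at most 2
(2 + log log N) + 1 ≤ 7 log log N. -/
theorem size_size_le {N : ℕ} (hN : 16 ≤ N) :
    (Nat.size (Nat.size (N ^ 3)) : ℝ) ≤ 7 * Real.log (Real.log N) := by
  have h1 := one_le_log hN
  have h2 := one_le_log_log hN
  have h3 := size_cube_le_log (N := N) (by omega)
  have hpos : 0 < Nat.size (N ^ 3) := Nat.size_pos.2 (by positivity)
  have h4 := size_le_log hpos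
  have h5 : Real.log (Nat.size (N ^ 3)) ≤ Real.log 7 + Real.log (Real.log N) := by
    rw [← Real.log_mul (by norm_num) (by linarith)]
    exact Real.log_le_log (by exact_mod_cast hpos) (by linarith)
  have h6 : Real.log 7 ≤ 2 := by
    rw [Real.log_le_iff_le_exp (by norm_num)]
    have h7 := Real.exp_one_gt_d9
    have h8 : Real.exp 2 = Real.exp 1 * Real.exp 1 := by rw [← Real.exp_add]; norm_num
    rw [h8]
    have := mul_le_mul h7.le h7.le (by norm_num) (Real.exp_pos 1).le
    linarith
  linarith

/-- All blocks have together at most 5H cells of O(log log N) bits, with H ≤ A² N^((1 + β)/2). The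
heads take O(ell log N) bits and the scalars O(log N), both of smaller order. The constants arise as
875 = 25 · 7 · 5, 35 = 5 · 7 and 15 = 3 · 5. -/
theorem bits_le {N H ell v U : ℕ} {A : ℝ} (h : Admissible N H ell)
    (hA : (2 * ell : ℝ) ≤ A * (N : ℝ) ^ beta) (hH : (H : ℝ) ≤ A * √((2 * ell : ℝ) * N))
    (hHv : H = v * ell) (hNU : N = U * ell) :
    ((totalLimits N H ell v U).bits : ℝ) ≤ (875 + 35 * A ^ 2 + 15 * |A|) *
      ((N : ℝ) ^ ((1 + beta) / 2) * Real.log (Real.log N)) := by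
  have hg := h.good
  have hN16 := h.sixteen_le
  have hep := hg.two_le
  have h2e := hg.two_mul_le
  have hv : 0 < v := by
    rcases Nat.eq_zero_or_pos v with rfl | hv
    · omega
    · exact hv
  have hN1 : (1 : ℝ) ≤ N := by exact_mod_cast (show 1 ≤ N by omega)
  have hN0 : (0 : ℝ) < N := by linarith
  have hNb : 0 < (N : ℝ) ^ beta := by positivity
  have hA4 : 4 ≤ A := by
    refine le_of_mul_le_mul_right ?_ hNb
    linarith [h.step_large]
  rw [abs_of_nonneg (by linarith)]
  have hlog := one_le_log hN16
  have hLL := one_le_log_log hN16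
  set G := (N : ℝ) ^ ((1 + beta) / 2) with hG
  set LL := Real.log (Real.log N) with hLLdef
  have hG0 : 0 < G := by positivity
  have hGG : G ≤ G * LL := le_mul_of_one_le_right hG0.le hLL
  have hlogle : Real.log N ≤ 5 * (N : ℝ) ^ (1 / 5 : ℝ) := by
    have := Real.log_le_rpow_div hN0.le (show (0 : ℝ) < 1 / 5 by norm_num)
    linarith
  -- β + 1/5 ≤ (1 + β)/2 is the same as β ≤ 3/5.
  have hfifth : (N : ℝ) ^ beta * (N : ℝ) ^ (1 / 5 : ℝ) ≤ G := by
    rw [← Real.rpow_add hN0]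
    exact Real.rpow_le_rpow_of_exponent_le hN1 (by linarith [beta_le])
  have hfifth' : (N : ℝ) ^ (1 / 5 : ℝ) ≤ G :=
    Real.rpow_le_rpow_of_exponent_le hN1 (by linarith [half_le_beta])
  have hsqrt : √((2 * ell : ℝ) * N) ≤ A * G := by
    have h1 : (2 * ell : ℝ) * N ≤ (A * G) ^ 2 := by
      have h2 : G ^ 2 = N * (N : ℝ) ^ beta := by
        rw [hG, ← Real.rpow_mul_natCast hN0.le]
        push_cast
        rw [div_mul_cancel₀ _ two_ne_zero, Real.rpow_add hN0, Real.rpow_one]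
      calc (2 * ell : ℝ) * N ≤ A * (N : ℝ) ^ beta * N := by gcongr
        _ = A * G ^ 2 := by rw [h2]; ring
        _ ≤ A ^ 2 * G ^ 2 := by gcongr; exact le_self_pow₀ (by linarith) two_ne_zero
        _ = (A * G) ^ 2 := by ring
    exact (Real.sqrt_le_sqrt h1).trans_eq (Real.sqrt_sq (by positivity))
  have hHG : (H : ℝ) ≤ A ^ 2 * G :=
    calc (H : ℝ) ≤ A * √((2 * ell : ℝ) * N) := hH
      _ ≤ A * (A * G) := by gcongr
      _ = A ^ 2 * G := by ring
  -- the number of running blocks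
  have hcell : cdiv (U + v) v ≤ ell + 1 := by
    rw [cdiv_le_iff hv, mul_add, mul_one, ← hHv]
    have := hg.limit_le
    rw [hNU, mul_comm] at this
    have := Nat.le_of_mul_le_mul_left this (by omega)
    omega
  -- The number c of blocks satisfies cH ≤ N + 2H. Multiplication by L = 2 ell, with L N ≤ H² and L
  -- ≤ H, gives cLH ≤ 3H². This is where H ≥ √(L N) balances the fixed block against the running
  -- blocks.
  have hblocks : cdiv (U + v) v * (2 * ell) ≤ 3 * H := by
    have h1 : cdiv (U + v) v * v ≤ U + v + v - 1 := Nat.div_mul_le_self _ _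
    have h2 : cdiv (U + v) v * H ≤ N + 2 * H := by
      have h3 := Nat.mul_le_mul_right ell (h1.trans (Nat.sub_le _ _))
      rw [mul_assoc, ← hHv, add_mul, add_mul, ← hHv, ← hNU] at h3
      omega
    have h4 := Nat.mul_le_mul_right (2 * ell) h2
    have h5 := h.mul_le
    refine Nat.le_of_mul_le_mul_right (c := H) ?_ (by omega)
    have h6 : H * (2 * ell) ≤ H * H := Nat.mul_le_mul_left _ h2e
    have h7 : cdiv (U + v) v * (2 * ell) * H = cdiv (U + v) v * H * (2 * ell) := by ring
    have h8 : (N + 2 * H) * (2 * ell) = 2 * ell * N + 2 * (H * (2 * ell)) := by ring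
    rw [h7, mul_assoc 3]
    omega
  set w := Nat.size (Nat.size (N ^ 3)) with hw
  have hbits : (totalLimits N H ell v U).bits ≤
      25 * Nat.size (N ^ 3) + 5 * H * w + 2 * ell * Nat.size N := by
    have h1 : (cdiv (U + v) v + 1) * Nat.size N ≤ 2 * ell * Nat.size N :=
      Nat.mul_le_mul_right _ (by omega)
    have h2 : cdiv (U + v) v * (2 * ell * w) ≤ 3 * H * w := by
      rw [← mul_assoc]
      exact Nat.mul_le_mul_right _ hblocks
    have h3 : (H + 1) * w ≤ 2 * H * w := Nat.mul_le_mul_right _ (by omega)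
    have h4 : 5 * H * w = 2 * H * w + 3 * H * w := by ring
    dsimp only [Limits.bits, totalLimits]
    rw [← hw]
    omega
  have hbits' : ((totalLimits N H ell v U).bits : ℝ) ≤
      25 * Nat.size (N ^ 3) + 5 * H * w + 2 * ell * Nat.size N := by exact_mod_cast hbits
  have e1 : 25 * (Nat.size (N ^ 3) : ℝ) ≤ 875 * (G * LL) := by
    have := size_cube_le_log (N := N) (by omega)
    linarith
  have e2 : 5 * (H : ℝ) * w ≤ 35 * A ^ 2 * (G * LL) :=
    calc 5 * (H : ℝ) * w ≤ 5 * (A ^ 2 * G) * (7 * LL) := by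
          gcongr
          exact size_size_le hN16
      _ = 35 * A ^ 2 * (G * LL) := by ring
  have e3 : 2 * (ell : ℝ) * Nat.size N ≤ 15 * A * (G * LL) := by
    have h1 : (Nat.size N : ℝ) ≤ 15 * (N : ℝ) ^ (1 / 5 : ℝ) := by
      have := size_le_log (n := N) (by omega)
      linarith
    calc 2 * (ell : ℝ) * Nat.size N ≤ (A * (N : ℝ) ^ beta) * (15 * (N : ℝ) ^ (1 / 5 : ℝ)) := by
          gcongr
      _ = 15 * A * ((N : ℝ) ^ beta * (N : ℝ) ^ (1 / 5 : ℝ)) := by ring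
      _ ≤ 15 * A * (G * LL) := by
          have := hfifth.trans hGG
          gcongr
  linarith

/-! ### The main results -/

theorem exists_computes_time : ∃ C : ℝ, 0 ≤ C ∧ ∀ N H ell : ℕ, Admissible N H ell →
    ∃ v U T S : ℕ, H = v * ell ∧ N = U * ell ∧ Computes N H ell T S ∧
      (T : ℝ) ≤ C * (N : ℝ) ^ (1.230175 : ℝ) ∧ S ≤ (totalLimits N H ell v U).bits := by
  obtain ⟨C, hC, htime⟩ := exists_totalTime_le
  refine ⟨C, hC, fun N H ell h => ?_⟩
  obtain ⟨v, hv⟩ := h.dvd_block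
  obtain ⟨U, hU⟩ := h.dvd_limit
  rw [mul_comm] at hv hU
  have h16 := h.sixteen_le
  have hM3 : 3 * N + 10 ≤ N ^ 3 := by
    have h1 : 16 * 16 ≤ N * N := Nat.mul_le_mul h16 h16
    have h2 := Nat.mul_le_mul_right N h1
    rw [show N ^ 3 = N * N * N by ring]
    omega
  have hs : Nat.sqrt N ≤ ell := by
    have := Nat.sqrt_le_sqrt (show N ≤ ell * ell by have := h.four_mul_le; omega)
    rwa [Nat.sqrt_eq] at this
  obtain ⟨T, S, hc, hT, hS⟩ := computes_of_good h.good hv hU hM3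
  exact ⟨v, U, T, S, hv, hU, hc,
    (show (T : ℝ) ≤ totalTime N H ell v U by exact_mod_cast hT).trans
      (htime N H ell v U h.good hv hU hs), hS⟩

theorem exists_computes_time_storage (A : ℝ) : ∃ C : ℝ, 0 ≤ C ∧ ∀ N H ell : ℕ,
    Admissible N H ell → (2 * ell : ℝ) ≤ A * (N : ℝ) ^ beta →
    (H : ℝ) ≤ A * √((2 * ell : ℝ) * N) →
    ∃ T S : ℕ, Computes N H ell T S ∧ (T : ℝ) ≤ C * (N : ℝ) ^ (1.230175 : ℝ) ∧
      (S : ℝ) ≤ C * ((N : ℝ) ^ ((1 + beta) / 2) * Real.log (Real.log N)) := by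
  obtain ⟨C, hC, htime⟩ := exists_computes_time
  refine ⟨C + (875 + 35 * A ^ 2 + 15 * |A|), by positivity, fun N H ell h hA hH => ?_⟩
  obtain ⟨v, U, T, S, hv, hU, hc, hT, hS⟩ := htime N H ell h
  have hLL := one_le_log_log h.sixteen_le
  refine ⟨T, S, hc, hT.trans ?_, ?_⟩
  · gcongr
    exact le_add_of_nonneg_right (by positivity)
  · refine ((show (S : ℝ) ≤ (totalLimits N H ell v U).bits by exact_mod_cast hS).trans
      (bits_le h hA hH hv hU)).trans ?_
    exact mul_le_mul_of_nonneg_right (le_add_of_nonneg_left hC) (by positivity)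

/-- Take ell = ⌈4 N^β⌉ and round N up to a multiple N' of ell. As N' ≤ 2N and β < 1, the power N'^β
at most doubles, which the factor 4 anticipates. Then round √(L N') up to a multiple of ell; the
result does not exceed N', itself a multiple of ell. -/
theorem exists_admissible {N : ℕ} (hN : 1000 ≤ N) : ∃ N' H ell : ℕ,
    N ≤ N' ∧ N' < N + ell ∧ N' ≤ 2 * N ∧ Admissible N' H ell ∧
    (2 * ell : ℝ) ≤ 10 * (N' : ℝ) ^ beta ∧ (H : ℝ) ≤ 10 * √((2 * ell : ℝ) * N') := by
  have hN1 : (1 : ℝ) ≤ N := by exact_mod_cast (show 1 ≤ N by omega)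
  have hN0 : (0 : ℝ) < N := by linarith
  have hb := half_le_beta
  have hb' := beta_le
  have hNb : 1 ≤ (N : ℝ) ^ beta := Real.one_le_rpow hN1 (by linarith)
  set ell := ⌈4 * (N : ℝ) ^ beta⌉₊ with hell
  have hle : 4 * (N : ℝ) ^ beta ≤ ell := Nat.le_ceil _
  have hlt : (ell : ℝ) < 4 * (N : ℝ) ^ beta + 1 := Nat.ceil_lt_add_one (by positivity)
  have hep : 0 < ell := by
    have : (0 : ℝ) < ell := by linarith
    exact_mod_cast this
  -- Since ell ≤ 5 N^β, it suffices that 10 ≤ N^(2/5) ≤ N^(1 - β); this is the reason for N ≥ 1000.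
  have h2ell : 2 * ell ≤ N := by
    have h1 : (10 : ℝ) ≤ (N : ℝ) ^ (2 / 5 : ℝ) := by
      have h2 : (1000 : ℝ) ≤ N := by exact_mod_cast hN
      calc (10 : ℝ) = ((10 : ℝ) ^ (5 / 2 : ℝ)) ^ (2 / 5 : ℝ) := by
            rw [← Real.rpow_mul (by norm_num)]
            norm_num
        _ ≤ ((10 : ℝ) ^ (3 : ℝ)) ^ (2 / 5 : ℝ) := by
            refine Real.rpow_le_rpow (by positivity) ?_ (by norm_num)
            exact Real.rpow_le_rpow_of_exponent_le (by norm_num) (by norm_num)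
        _ ≤ (N : ℝ) ^ (2 / 5 : ℝ) := by
            refine Real.rpow_le_rpow (by positivity) ?_ (by norm_num)
            norm_num
            linarith
    have h3 : (N : ℝ) ^ beta * (N : ℝ) ^ (2 / 5 : ℝ) ≤ N := by
      rw [← Real.rpow_add hN0]
      conv_rhs => rw [← Real.rpow_one (N : ℝ)]
      exact Real.rpow_le_rpow_of_exponent_le hN1 (by linarith)
    have h4 : (N : ℝ) ^ beta * 10 ≤ (N : ℝ) ^ beta * (N : ℝ) ^ (2 / 5 : ℝ) := by gcongr
    have h5 : (2 : ℝ) * ell ≤ N := by linarith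
    exact_mod_cast h5
  have hround : ∀ x, x ≤ ell * cdiv x ell ∧ ell * cdiv x ell < x + ell := fun x => by
    refine ⟨le_mul_cdiv hep, ?_⟩
    have : cdiv x ell * ell ≤ x + ell - 1 := Nat.div_mul_le_self _ _
    rw [mul_comm]
    omega
  set N' := ell * cdiv N ell with hN'
  obtain ⟨hNN', hN'lt⟩ := hround N
  rw [← hN'] at hNN' hN'lt
  set r := √((2 * ell : ℝ) * N') with hr
  have h2ell' : (2 * ell : ℝ) ≤ N' := by exact_mod_cast h2ell.trans hNN'
  have hrsq : r * r = (2 * ell : ℝ) * N' := Real.mul_self_sqrt (by positivity)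
  have hrN : r ≤ N' := by
    rw [hr, Real.sqrt_le_left (Nat.cast_nonneg _), sq]
    gcongr
  have hellr : (ell : ℝ) ≤ r := by
    refine Real.le_sqrt_of_sq_le ?_
    rw [sq]
    refine mul_le_mul ?_ ?_ (Nat.cast_nonneg _) (by positivity) <;>
      linarith [Nat.cast_nonneg (α := ℝ) ell]
  obtain ⟨hH1, hH2⟩ := hround ⌈r⌉₊
  set H := ell * cdiv ⌈r⌉₊ ell with hH
  have hrH : r ≤ H := (Nat.le_ceil r).trans (by exact_mod_cast hH1)
  have hstep : 2 * (N' : ℝ) ^ beta ≤ ell := by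
    have h1 : (N' : ℝ) ≤ 2 * N := by exact_mod_cast (show N' ≤ 2 * N by omega)
    have h2 : (N' : ℝ) ^ beta ≤ 2 * (N : ℝ) ^ beta :=
      calc (N' : ℝ) ^ beta ≤ (2 * (N : ℝ)) ^ beta :=
            Real.rpow_le_rpow (Nat.cast_nonneg _) h1 (by linarith)
        _ = 2 ^ beta * (N : ℝ) ^ beta := Real.mul_rpow two_pos.le hN0.le
        _ ≤ 2 ^ (1 : ℝ) * (N : ℝ) ^ beta := by
            gcongr
            · norm_num
            · linarith
        _ = 2 * (N : ℝ) ^ beta := by rw [Real.rpow_one]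
    linarith
  refine ⟨N', H, ell, hNN', hN'lt, by omega, ⟨by omega, ?_, hstep, ?_, ⟨_, rfl⟩, ⟨_, rfl⟩, hrH⟩,
    ?_, ?_⟩
  · rw [hH, hN']
    refine Nat.mul_le_mul_left _ ((cdiv_le_iff hep).2 ?_)
    rw [← hN']
    exact Nat.ceil_le.2 hrN
  · have h1 : (N' : ℝ) ≤ ell * H := by
      have hN'1 : (1 : ℝ) ≤ N' := by exact_mod_cast (show 1 ≤ N' by omega)
      have h2 : √(N' : ℝ) ≤ ell := by
        rw [Real.sqrt_eq_rpow]
        have := Real.rpow_le_rpow_of_exponent_le hN'1 hb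
        have h3 : 0 ≤ (N' : ℝ) ^ beta := by positivity
        linarith
      calc (N' : ℝ) = √(N' : ℝ) * √N' := (Real.mul_self_sqrt (Nat.cast_nonneg _)).symm
        _ ≤ ell * H := mul_le_mul h2 (h2.trans (hellr.trans hrH)) (by positivity) (by positivity)
    exact_mod_cast h1
  · have h1 : (N : ℝ) ^ beta ≤ (N' : ℝ) ^ beta :=
      Real.rpow_le_rpow hN0.le (by exact_mod_cast hNN') (by linarith)
    linarith
  · have h1 : (H : ℝ) ≤ ⌈r⌉₊ + ell := by exact_mod_cast hH2.le
    have h2 := Nat.ceil_lt_add_one (show 0 ≤ r by positivity)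
    have h3 : (1 : ℝ) ≤ ell := by exact_mod_cast hep
    linarith

/-- For N ≥ 16, log (2N) ≤ 2 log N ≤ (log N)², because log N ≥ 2. -/
theorem log_log_two_mul_le {N : ℕ} (hN : 16 ≤ N) :
    Real.log (Real.log ((2 * N : ℕ) : ℝ)) ≤ 2 * Real.log (Real.log N) := by
  have h1 : Real.log ((2 : ℝ) ^ 4) ≤ Real.log N :=
    Real.log_le_log (by norm_num) (by norm_num; exact_mod_cast hN)
  rw [Real.log_pow] at h1
  push_cast at h1
  have h2 := Real.log_two_gt_d9
  have hN0 : (0 : ℝ) < N := by exact_mod_cast (show 0 < N by omega)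
  have h3 : Real.log ((2 * N : ℕ) : ℝ) = Real.log 2 + Real.log N := by
    rw [Nat.cast_mul, Nat.cast_ofNat, Real.log_mul two_ne_zero hN0.ne']
  have h4 : 2 * Real.log N ≤ Real.log N ^ 2 := by
    rw [sq]
    exact mul_le_mul_of_nonneg_right (by linarith) (by linarith)
  rw [show 2 * Real.log (Real.log N) = Real.log (Real.log N ^ 2) by rw [Real.log_pow]; norm_cast]
  exact Real.log_le_log (by linarith) (by linarith)

/-- Since N' ≤ 2N, replacing N' by N changes the time bound by a factor 4 at most, and the storage
bound by 2 for the power and 2 for the double logarithm. -/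
theorem exists_parameters : ∃ A C : ℝ, ∃ N₀ : ℕ, ∀ N : ℕ, N₀ ≤ N → ∃ N' H ell : ℕ,
    N ≤ N' ∧ N' < N + ell ∧ Admissible N' H ell ∧
    (2 * ell : ℝ) ≤ A * (N' : ℝ) ^ beta ∧ (H : ℝ) ≤ A * √((2 * ell : ℝ) * N') ∧
    ∃ T S : ℕ, Computes N' H ell T S ∧ (T : ℝ) ≤ C * (N : ℝ) ^ (1.230175 : ℝ) ∧
      (S : ℝ) ≤ C * ((N : ℝ) ^ ((1 + beta) / 2) * Real.log (Real.log N)) := by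
  obtain ⟨C, hC, hrun⟩ := exists_computes_time_storage 10
  refine ⟨10, 4 * C, 1000, fun N hN => ?_⟩
  obtain ⟨N', H, ell, h1, h2, h3, h4, h5, h6⟩ := exists_admissible hN
  obtain ⟨T, S, hc, hT, hS⟩ := hrun N' H ell h4 h5 h6
  refine ⟨N', H, ell, h1, h2, h4, h5, h6, T, S, hc, hT.trans ?_, hS.trans ?_⟩
  · have h7 : (N' : ℝ) ^ (1.230175 : ℝ) ≤ 4 * (N : ℝ) ^ (1.230175 : ℝ) := by
      calc (N' : ℝ) ^ (1.230175 : ℝ) ≤ (2 * (N : ℝ)) ^ (1.230175 : ℝ) :=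
            Real.rpow_le_rpow (Nat.cast_nonneg _) (by exact_mod_cast h3) (by norm_num)
        _ = 2 ^ (1.230175 : ℝ) * (N : ℝ) ^ (1.230175 : ℝ) :=
            Real.mul_rpow two_pos.le (Nat.cast_nonneg _)
        _ ≤ 2 ^ (2 : ℝ) * (N : ℝ) ^ (1.230175 : ℝ) := by
            refine mul_le_mul_of_nonneg_right ?_ (by positivity)
            exact Real.rpow_le_rpow_of_exponent_le (by norm_num) (by norm_num)
        _ = 4 * (N : ℝ) ^ (1.230175 : ℝ) := by norm_num
    have := mul_le_mul_of_nonneg_left h7 hC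
    linarith
  · have hb := half_le_beta
    have hb' := beta_le
    have h7 : (N' : ℝ) ^ ((1 + beta) / 2) ≤ 2 * (N : ℝ) ^ ((1 + beta) / 2) := by
      calc (N' : ℝ) ^ ((1 + beta) / 2) ≤ (2 * (N : ℝ)) ^ ((1 + beta) / 2) :=
            Real.rpow_le_rpow (Nat.cast_nonneg _) (by exact_mod_cast h3) (by linarith)
        _ = 2 ^ ((1 + beta) / 2) * (N : ℝ) ^ ((1 + beta) / 2) :=
            Real.mul_rpow two_pos.le (Nat.cast_nonneg _)
        _ ≤ 2 ^ (1 : ℝ) * (N : ℝ) ^ ((1 + beta) / 2) := by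
            refine mul_le_mul_of_nonneg_right ?_ (by positivity)
            exact Real.rpow_le_rpow_of_exponent_le (by norm_num) (by linarith)
        _ = 2 * (N : ℝ) ^ ((1 + beta) / 2) := by norm_num
    have h8 : Real.log (Real.log N') ≤ 2 * Real.log (Real.log N) := by
      have hlog := one_le_log h4.sixteen_le
      refine le_trans ?_ (log_log_two_mul_le (N := N) (by omega))
      have hN'0 : (0 : ℝ) < N' := by exact_mod_cast h4.pos
      exact Real.log_le_log (by linarith) (Real.log_le_log hN'0 (by exact_mod_cast h3))
    have hLL := one_le_log_log h4.sixteen_le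
    calc C * ((N' : ℝ) ^ ((1 + beta) / 2) * Real.log (Real.log N'))
        ≤ C * (2 * (N : ℝ) ^ ((1 + beta) / 2) * (2 * Real.log (Real.log N))) := by gcongr
      _ = 4 * C * ((N : ℝ) ^ ((1 + beta) / 2) * Real.log (Real.log N)) := by ring

end Fuller

theorem mainTheorem2 :
    -- correctness and running time, for all admissible parameters
    (∃ C : ℝ, ∀ N H ell : ℕ, Fuller.Admissible N H ell →
      ∃ T S : ℕ, Fuller.Computes N H ell T S ∧ (T : ℝ) ≤ C * (N : ℝ) ^ (1.230175 : ℝ)) ∧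
    -- storage, for parameters with `L ≍ N ^ β` and `H ≍ √(L N)`, where `L = 2 * ell`
    (∀ A : ℝ, ∃ C : ℝ, ∀ N H ell : ℕ, Fuller.Admissible N H ell →
      (2 * ell : ℝ) ≤ A * (N : ℝ) ^ Fuller.beta → (H : ℝ) ≤ A * √((2 * ell : ℝ) * N) →
      ∃ T S : ℕ, Fuller.Computes N H ell T S ∧
        (T : ℝ) ≤ C * (N : ℝ) ^ (1.230175 : ℝ) ∧
        (S : ℝ) ≤ C * ((N : ℝ) ^ ((1 + Fuller.beta) / 2) * Real.log (Real.log N))) ∧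
    -- for every large limit `N` there are such parameters, after an increase of `N` by less than
    -- one step, and the bounds hold in terms of the original `N`
    (∃ (A C : ℝ) (N₀ : ℕ), ∀ N : ℕ, N₀ ≤ N → ∃ N' H ell : ℕ,
      N ≤ N' ∧ N' < N + ell ∧ Fuller.Admissible N' H ell ∧
      (2 * ell : ℝ) ≤ A * (N' : ℝ) ^ Fuller.beta ∧ (H : ℝ) ≤ A * √((2 * ell : ℝ) * N') ∧
      ∃ T S : ℕ, Fuller.Computes N' H ell T S ∧
        (T : ℝ) ≤ C * (N : ℝ) ^ (1.230175 : ℝ) ∧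
        (S : ℝ) ≤ C * ((N : ℝ) ^ ((1 + Fuller.beta) / 2) * Real.log (Real.log N))) ∧
    -- the numerical value of the exponent of the storage
    |(1 + Fuller.beta) / 2 - 0.792481| < 1 / 10 ^ 6 := by
  obtain ⟨C, -, hC⟩ := Fuller.exists_computes_time
  refine ⟨⟨C, fun N H ell h => ?_⟩, fun A => ?_, Fuller.exists_parameters,
    Fuller.abs_exponent_sub_lt⟩
  · obtain ⟨-, -, T, S, -, -, hc, hT, -⟩ := hC N H ell h
    exact ⟨T, S, hc, hT⟩
  · obtain ⟨C, -, hC⟩ := Fuller.exists_computes_time_storage A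
    exact ⟨C, hC⟩
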